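/- Let $N\ge 1$, let $W$ be a complex vector space of dimension $m$, let $A_N=\mathbb C[t]/(t^N)$, and write $t$ also for the operator $\mathrm{id}_W\otimes t$ on $W\otimes A_N$. Let $N\ge\lambda_1\ge\dots\ge\lambda_m\ge 0$ be a partition of $k=\sum_j\lambda_j$, put $\lambda'_i=\#\{j:\lambda_j\ge i\}$ and $k_i=k_i(\lambda)=\sum_{j:\lambda_j\ge i-1}(\lambda_j-i+1)$ for $1\le i\le N$, and $k_{N+1}=0$. Let $\mathcal O_\lambda\subset \mathrm{Gr}_k(W\otimes A_N)$ be the set of $k$-dimensional $A_N$-submodules of $W\otimes A_N$ isomorphic to $\bigoplus_{j=1}^m\mathbb C[t]/(t^{\lambda_j})$; it is an orbit of the group $\mathrm{Aut}_{A_N}(W\otimes A_N)\simeq \mathrm{GL}_m(A_N)$. For $1\le i\le N+1$ let $Y_i$ be the variety of tuples $(U_i,\dots,U_N)$ of subspaces $U_j\subset W\otimes t^{j-1}A_N$ with $\dim U_j=k_j$ for $i\le j\le N$, and with $U_{j+1}\subset U_j$ and $tU_j\subset U_{j+1}$ for $i\le j<N$, with the structure induced from the product of Grassmannians; $Y_{N+1}$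 is a point. Put $Y(k_*(\lambda))=Y_1$. Then: (1) The projection $(U_1,\dots,U_N)\mapsto U_1$ maps $Y(k_*(\lambda))$ into the Zariski closure $\overline{\mathcal O_\lambda}$, and $\pi_\lambda:Y(k_*(\lambda))\to\overline{\mathcal O_\lambda}$ is a resolution of singularities: $Y(k_*(\lambda))$ is a smooth irreducible variety and $\pi_\lambda$ is a proper birational morphism. (2) $Y(k_*(\lambda))=Y_1\to Y_2\to\dots\to Y_{N+1}=\mathrm{pt}$ is a tower of Grassmann bundles: for $1\le i\le N$ the map $Y_i\to Y_{i+1}$ forgetting $U_i$ is the bundle of Grassmannians of $(k_i-k_{i+1})$-dimensional subspaces $U_i/U_{i+1}$ in the vector bundle with fibre $\bigl(t^{-1}(U_{i+1})\cap (W\otimes t^{i-1}A_N)\bigr)/U_{i+1}\simeq W$ (where $U_{N+1}=0$); it is Zariski locally trivial with fibre $\mathrm{Gr}_{k_i-k_{i+1}}(W)$, where $k_i-k_{i+1}=\lambda'_i$. (3) $\dim Y(k_*(\lambda))=mk-\sum_{i=1}^N(\lambda'_i)^2$. -/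

import Mathlib

open scoped TensorProduct Polynomial

/-! ### Spaces with functions and varieties over `ℂ` -/

/-- A space with (`ℂ`-valued) functions. `reg x` consists of the functions that are regular in some
neighbourhood of `x`; the values of `f` away from `x` do not matter, so a regular function on an
open set `U` is a function that belongs to `reg x` for every `x ∈ U`. -/
structure FunSpace where
  carrier : Type*
  top : TopologicalSpace carrier
  reg : carrier → Subalgebra ℂ (carrier → ℂ)
  reg_congr : ∀ (x : carrier) (f g : carrier → ℂ) (U : Set carrier), IsOpen U → x ∈ U →
    (∀ y ∈ U, f y = g y) → f ∈ reg x → g ∈ reg x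
  reg_spread : ∀ (x : carrier) (f : carrier → ℂ), f ∈ reg x →
    ∃ U : Set carrier, IsOpen U ∧ x ∈ U ∧ ∀ y ∈ U, f ∈ reg y
  reg_inv : ∀ (x : carrier) (f : carrier → ℂ), f ∈ reg x → f x ≠ 0 →
    f⁻¹ ∈ reg x ∧ ∃ U : Set carrier, IsOpen U ∧ x ∈ U ∧ ∀ y ∈ U, f y ≠ 0

namespace FunSpace

instance : CoeSort FunSpace (Type _) := ⟨FunSpace.carrier⟩

instance (X : FunSpace) : TopologicalSpace X := X.top

section Generate

variable {X : Type*}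

/-- The common domain of a family of partially defined functions `(S, f)`. -/
def dom (b : Set (Set X × (X → ℂ))) : Set X := {x | ∀ p ∈ b, x ∈ p.1}

/-- The polynomial expressions in a family of partially defined functions. -/
def polys (b : Set (Set X × (X → ℂ))) : Subalgebra ℂ (X → ℂ) := Algebra.adjoin ℂ (Prod.snd '' b)

theorem dom_union (b c : Set (Set X × (X → ℂ))) (x : X) :
    x ∈ dom (b ∪ c) ↔ x ∈ dom b ∧ x ∈ dom c := by
  simp only [dom, Set.mem_ofPred_eq, Set.mem_union]
  constructor
  · exact fun h => ⟨fun p hp => h p (Or.inl hp), fun p hp => h p (Or.inr hp)⟩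
  · rintro ⟨h1, h2⟩ p (hp | hp)
    exacts [h1 p hp, h2 p hp]

theorem polys_left (b c : Set (Set X × (X → ℂ))) {h : X → ℂ} (hh : h ∈ polys b) :
    h ∈ polys (b ∪ c) :=
  Algebra.adjoin_mono (Set.image_mono Set.subset_union_left) hh

theorem polys_right (b c : Set (Set X × (X → ℂ))) {h : X → ℂ} (hh : h ∈ polys c) :
    h ∈ polys (b ∪ c) :=
  Algebra.adjoin_mono (Set.image_mono Set.subset_union_right) hh

/-- The coarsest topology for which `S` is open and `f` is a regular function on `S`
for all `(S, f) ∈ L`: the sets `{y ∈ S₁ ∩ … ∩ Sᵣ | h y ≠ 0}`, `h` a polynomial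
in `f₁, …, fᵣ`, form a basis. -/
@[reducible] def generateTop (L : Set (Set X × (X → ℂ))) : TopologicalSpace X where
  IsOpen V := ∀ x ∈ V, ∃ b : Set (Set X × (X → ℂ)), b ⊆ L ∧ b.Finite ∧ x ∈ dom b ∧
    ∃ h ∈ polys b, h x ≠ 0 ∧ ∀ y ∈ dom b, h y ≠ 0 → y ∈ V
  isOpen_univ := fun x _ => ⟨∅, by simp, by simp, by simp [dom], 1, one_mem _, by simp, by simp⟩
  isOpen_inter := by
    rintro s t hs ht x ⟨hxs, hxt⟩
    obtain ⟨b, hbL, hbf, hxb, h, hh, hx, hb⟩ := hs x hxs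
    obtain ⟨c, hcL, hcf, hxc, k, hk, kx, hc⟩ := ht x hxt
    refine ⟨b ∪ c, Set.union_subset hbL hcL, hbf.union hcf, (dom_union _ _ _).2 ⟨hxb, hxc⟩,
      h * k, mul_mem (polys_left _ _ hh) (polys_right _ _ hk), mul_ne_zero hx kx, ?_⟩
    intro y hy hne
    have hy' := (dom_union _ _ _).1 hy
    exact ⟨hb y hy'.1 (left_ne_zero_of_mul hne), hc y hy'.2 (right_ne_zero_of_mul hne)⟩
  isOpen_sUnion := by
    rintro S hS x ⟨t, ht, hxt⟩
    obtain ⟨b, hbL, hbf, hxb, h, hh, hx, hb⟩ := hS t ht x hxt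
    exact ⟨b, hbL, hbf, hxb, h, hh, hx, fun y hy hne => ⟨t, ht, hb y hy hne⟩⟩

/-- `f` is, near `x`, a quotient `p / q` of polynomials in functions from `L`. -/
def GenReg (L : Set (Set X × (X → ℂ))) (x : X) (f : X → ℂ) : Prop :=
  ∃ b : Set (Set X × (X → ℂ)), b ⊆ L ∧ b.Finite ∧ x ∈ dom b ∧
    ∃ p ∈ polys b, ∃ q ∈ polys b, q x ≠ 0 ∧ ∀ y ∈ dom b, q y ≠ 0 → f y = p y / q y

/-- The coarsest space with functions on `X` for which `S` is open and `f` is regular on `S`,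
for all `(S, f) ∈ L`. -/
def generate (L : Set (Set X × (X → ℂ))) : FunSpace where
  carrier := X
  top := generateTop L
  reg x :=
    { carrier := {f | GenReg L x f}
      mul_mem' := by
        rintro f g ⟨b, hbL, hbf, hxb, p, hp, q, hq, hqx, hf⟩ ⟨c, hcL, hcf, hxc, r, hr, s, hs, hsx, hg⟩
        refine ⟨b ∪ c, Set.union_subset hbL hcL, hbf.union hcf, (dom_union _ _ _).2 ⟨hxb, hxc⟩,
          p * r, mul_mem (polys_left _ _ hp) (polys_right _ _ hr),
          q * s, mul_mem (polys_left _ _ hq) (polys_right _ _ hs), mul_ne_zero hqx hsx, ?_⟩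
        intro y hy hne
        have hy' := (dom_union _ _ _).1 hy
        simp only [Pi.mul_apply] at hne ⊢
        rw [hf y hy'.1 (left_ne_zero_of_mul hne), hg y hy'.2 (right_ne_zero_of_mul hne),
          div_mul_div_comm]
      add_mem' := by
        rintro f g ⟨b, hbL, hbf, hxb, p, hp, q, hq, hqx, hf⟩ ⟨c, hcL, hcf, hxc, r, hr, s, hs, hsx, hg⟩
        refine ⟨b ∪ c, Set.union_subset hbL hcL, hbf.union hcf, (dom_union _ _ _).2 ⟨hxb, hxc⟩,
          p * s + q * r, add_mem (mul_mem (polys_left _ _ hp) (polys_right _ _ hs))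
            (mul_mem (polys_left _ _ hq) (polys_right _ _ hr)),
          q * s, mul_mem (polys_left _ _ hq) (polys_right _ _ hs), mul_ne_zero hqx hsx, ?_⟩
        intro y hy hne
        have hy' := (dom_union _ _ _).1 hy
        simp only [Pi.mul_apply, Pi.add_apply] at hne ⊢
        rw [hf y hy'.1 (left_ne_zero_of_mul hne), hg y hy'.2 (right_ne_zero_of_mul hne),
          div_add_div _ _ (left_ne_zero_of_mul hne) (right_ne_zero_of_mul hne)]
      algebraMap_mem' := fun r => ⟨∅, by simp, by simp, by simp [dom], algebraMap ℂ _ r,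
        Subalgebra.algebraMap_mem _ r, 1, one_mem _, by simp, by simp⟩ }
  reg_congr := by
    rintro x f g U hU hxU hfg ⟨b, hbL, hbf, hxb, p, hp, q, hq, hqx, hf⟩
    obtain ⟨c, hcL, hcf, hxc, h, hh, hx, hc⟩ := hU x hxU
    refine ⟨b ∪ c, Set.union_subset hbL hcL, hbf.union hcf, (dom_union _ _ _).2 ⟨hxb, hxc⟩,
      p * h, mul_mem (polys_left _ _ hp) (polys_right _ _ hh),
      q * h, mul_mem (polys_left _ _ hq) (polys_right _ _ hh), mul_ne_zero hqx hx, ?_⟩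
    intro y hy hne
    have hy' := (dom_union _ _ _).1 hy
    simp only [Pi.mul_apply] at hne ⊢
    rw [← hfg y (hc y hy'.2 (right_ne_zero_of_mul hne)), hf y hy'.1 (left_ne_zero_of_mul hne),
      mul_div_mul_right _ _ (right_ne_zero_of_mul hne)]
  reg_spread := by
    rintro x f ⟨b, hbL, hbf, hxb, p, hp, q, hq, hqx, hf⟩
    refine ⟨{y | y ∈ dom b ∧ q y ≠ 0}, ?_, ⟨hxb, hqx⟩, ?_⟩
    · rintro y ⟨hy, hqy⟩
      exact ⟨b, hbL, hbf, hy, q, hq, hqy, fun z hz hqz => ⟨hz, hqz⟩⟩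
    · rintro y ⟨hy, hqy⟩
      exact ⟨b, hbL, hbf, hy, p, hp, q, hq, hqy, hf⟩
  reg_inv := by
    rintro x f ⟨b, hbL, hbf, hxb, p, hp, q, hq, hqx, hf⟩ hfx
    have hpx : p x ≠ 0 := by
      intro h0
      apply hfx
      rw [hf x hxb hqx, h0, zero_div]
    have hpq : p * q ∈ polys b := mul_mem hp hq
    refine ⟨⟨b, hbL, hbf, hxb, q * q, mul_mem hq hq, p * q, hpq, mul_ne_zero hpx hqx, ?_⟩,
      {y | y ∈ dom b ∧ (p * q) y ≠ 0}, ?_, ⟨hxb, mul_ne_zero hpx hqx⟩, ?_⟩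
    · intro y hy hne
      simp only [Pi.mul_apply] at hne ⊢
      rw [Pi.inv_apply, hf y hy (right_ne_zero_of_mul hne), inv_div,
        mul_div_mul_right _ _ (right_ne_zero_of_mul hne)]
    · rintro y ⟨hy, hne⟩
      exact ⟨b, hbL, hbf, hy, p * q, hpq, hne, fun z hz hqz => ⟨hz, hqz⟩⟩
    · rintro y ⟨hy, hne⟩
      rw [hf y hy (right_ne_zero_of_mul hne)]
      exact div_ne_zero (left_ne_zero_of_mul hne) (right_ne_zero_of_mul hne)

/-- The partially defined functions on `X` obtained from those on `Y` by composition with `g`. -/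
def pulled (Y : FunSpace) (g : X → Y) : Set (Set X × (X → ℂ)) :=
  {p | ∃ (U : Set Y) (f : Y → ℂ), IsOpen U ∧ (∀ y ∈ U, f ∈ Y.reg y) ∧ p = (g ⁻¹' U, f ∘ g)}

end Generate

/-- A complex vector space as an affine space, with its Zariski topology. -/
def vec (E : Type*) [AddCommGroup E] [Module ℂ E] : FunSpace :=
  generate {p : Set E × (E → ℂ) | ∃ l : Module.Dual ℂ E, p = (Set.univ, fun v => l v)}

/-- A subset with the induced structure. -/
def sub (X : FunSpace) (S : Set X) : FunSpace :=
  generate (pulled X (Subtype.val : S → X))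

/-- The product of two spaces with functions. -/
def prod (X Y : FunSpace) : FunSpace :=
  generate (pulled X (Prod.fst : X × Y → X) ∪ pulled Y (Prod.snd : X × Y → Y))

/-- The product of a family of spaces with functions. -/
def pi {ι : Type*} (X : ι → FunSpace) : FunSpace :=
  generate (⋃ i, pulled (X i) (fun x : (∀ i, X i) => x i))

/-- The quotient structure on `Z` defined by a map `q : P → Z`. -/
def quot (P : FunSpace) {Z : Type*} (q : P → Z) : FunSpace where
  carrier := Z
  top := TopologicalSpace.coinduced q P.top
  reg z :=
    { carrier := {f | ∃ U : Set Z, IsOpen (q ⁻¹' U) ∧ z ∈ U ∧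
        ∀ p ∈ q ⁻¹' U, f ∘ q ∈ P.reg p}
      mul_mem' := by
        rintro f g ⟨U, hU, hzU, hf⟩ ⟨V, hV, hzV, hg⟩
        exact ⟨U ∩ V, hU.inter hV, ⟨hzU, hzV⟩,
          fun p hp => mul_mem (hf p hp.1) (hg p hp.2)⟩
      add_mem' := by
        rintro f g ⟨U, hU, hzU, hf⟩ ⟨V, hV, hzV, hg⟩
        exact ⟨U ∩ V, hU.inter hV, ⟨hzU, hzV⟩,
          fun p hp => add_mem (hf p hp.1) (hg p hp.2)⟩
      algebraMap_mem' := fun r => ⟨Set.univ, isOpen_univ, trivial,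
        fun p _ => (P.reg p).algebraMap_mem r⟩ }
  reg_congr := by
    rintro z f g V hV hzV hfg ⟨U, hU, hzU, hf⟩
    exact ⟨U ∩ V, hU.inter hV, ⟨hzU, hzV⟩, fun p hp =>
      P.reg_congr p (f ∘ q) (g ∘ q) (q ⁻¹' V) hV hp.2 (fun y hy => hfg (q y) hy) (hf p hp.1)⟩
  reg_spread := by
    rintro z f ⟨U, hU, hzU, hf⟩
    exact ⟨U, hU, hzU, fun y hy => ⟨U, hU, hy, hf⟩⟩
  reg_inv := by
    rintro z f ⟨U, hU, hzU, hf⟩ hfz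
    have hV : IsOpen (q ⁻¹' {y | y ∈ U ∧ f y ≠ 0}) := by
      rw [isOpen_iff_forall_mem_open]
      rintro p ⟨hpU, hfp⟩
      obtain ⟨-, V, hV, hpV, hne⟩ := P.reg_inv p (f ∘ q) (hf p hpU) hfp
      exact ⟨q ⁻¹' U ∩ V, fun y hy => ⟨hy.1, hne y hy.2⟩, hU.inter hV, hpU, hpV⟩
    exact ⟨⟨_, hV, ⟨hzU, hfz⟩, fun p hp => (P.reg_inv p (f ∘ q) (hf p hp.1) hp.2).1⟩,
      _, hV, ⟨hzU, hfz⟩, fun y hy => hy.2⟩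

/-- Morphisms of spaces with functions. -/
def IsMorphism (X Y : FunSpace) (φ : X → Y) : Prop :=
  Continuous φ ∧ ∀ x, ∀ f ∈ Y.reg (φ x), f ∘ φ ∈ X.reg x

/-- Isomorphisms of spaces with functions. -/
def IsIso (X Y : FunSpace) (φ : X → Y) : Prop :=
  IsMorphism X Y φ ∧ ∃ ψ : Y → X, IsMorphism Y X ψ ∧ ψ ∘ φ = id ∧ φ ∘ ψ = id

/-- An affine variety: isomorphic to a Zariski closed subset of some `ℂⁿ`. -/
def IsAffineVariety (X : FunSpace) : Prop :=
  ∃ (n : ℕ) (S : Set (vec (Fin n → ℂ))), IsClosed S ∧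
    ∃ φ : X → (vec (Fin n → ℂ)).sub S, IsIso X ((vec (Fin n → ℂ)).sub S) φ

/-- A (possibly reducible) variety: a separated space with functions that has a finite cover by
open affine varieties. -/
def IsVariety (X : FunSpace) : Prop :=
  (∃ (n : ℕ) (U : Fin n → Set X),
    (∀ i, IsOpen (U i) ∧ IsAffineVariety (X.sub (U i))) ∧ ∀ x, ∃ i, x ∈ U i) ∧
  IsClosed {z : X.prod X | (show X × X from z).1 = (show X × X from z).2}

/-- The Zariski tangent space at `x`: the derivations at `x` of the functions regular near `x`. -/
def zariskiTangent (X : FunSpace) (x : X) : Submodule ℂ (X.reg x →ₗ[ℂ] ℂ) where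
  carrier := {D | ∀ f g : X.reg x, D (f * g) = f.1 x * D g + g.1 x * D f}
  add_mem' := by
    intro D E hD hE f g
    simp only [LinearMap.add_apply, hD f g, hE f g]
    ring
  zero_mem' := by
    intro f g
    simp
  smul_mem' := by
    intro c D hD f g
    simp only [LinearMap.smul_apply, hD f g, smul_eq_mul]
    ring

/-- The dimension of `X` at `x`. -/
noncomputable def localDim (X : FunSpace) (x : X) : WithBot ℕ∞ :=
  ⨅ U : {U : Set X // IsOpen U ∧ x ∈ U}, topologicalKrullDim U.1

/-- Smoothness: everywhere the dimension of the tangent space equals the local dimension. -/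
def IsSmooth (X : FunSpace) : Prop :=
  ∀ x : X, Module.Finite ℂ (X.zariskiTangent x) ∧
    ((Module.finrank ℂ (X.zariskiTangent x) : ℕ) : WithBot ℕ∞) = X.localDim x

/-- A proper morphism (of varieties): universally closed. -/
def IsProperMorphism (Y X : FunSpace) (φ : Y → X) : Prop :=
  IsMorphism Y X φ ∧ ∀ T : FunSpace.{0}, IsVariety T →
    IsClosedMap (X := Y.prod T) (Y := X.prod T) (Prod.map φ id)

/-- A birational morphism: an isomorphism from a dense open set onto a dense open set. -/
def IsBirationalMorphism (Y X : FunSpace) (φ : Y → X) : Prop :=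
  IsMorphism Y X φ ∧ ∃ (U : Set Y) (V : Set X), IsOpen U ∧ Dense U ∧ IsOpen V ∧ Dense V ∧
    ∃ h : Set.MapsTo φ U V, IsIso (Y.sub U) (X.sub V) (h.restrict φ U V)

/-- `φ : Y → X` is a resolution of singularities of the variety `X`. -/
structure IsResolution (Y X : FunSpace) (φ : Y → X) : Prop where
  isVariety_source : IsVariety Y
  isVariety_target : IsVariety X
  irreducible_source : IrreducibleSpace Y
  smooth : IsSmooth Y
  proper : IsProperMorphism Y X φ
  birational : IsBirationalMorphism Y X φ

/-- The Grassmannian of `k`-dimensional subspaces of `V`, as the quotient of the open set of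
linearly independent `k`-tuples of vectors by change of basis. -/
noncomputable def grass (k : ℕ) (V : Type*) [AddCommGroup V] [Module ℂ V] : FunSpace :=
  quot ((vec (Fin k → V)).sub {v : Fin k → V | LinearIndependent ℂ v})
    (Z := {U : Submodule ℂ V // Module.finrank ℂ U = k})
    (fun v => ⟨Submodule.span ℂ (Set.range v.1), by
      simpa using finrank_span_eq_card (R := ℂ) (b := v.1) v.2⟩)

/-- The subspace that a point of the Grassmannian stands for. -/
def grass.space {k : ℕ} {V : Type*} [AddCommGroup V] [Module ℂ V] (U : grass k V) :
    Submodule ℂ V :=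
  Subtype.val (p := fun U : Submodule ℂ V => Module.finrank ℂ U = k) U

/-- Let `K x ≤ E x` be subspaces of `V` that depend on `x ∈ X`. The map `p : Y → X`, together with
the subspaces `S y` of `V`, is the bundle over `X` of Grassmannians of `d`-dimensional subspaces
`S y / K (p y)` of the spaces `E x / K x`: every point of `X` has an open neighbourhood `T`, on
which a morphism `l : T → Hom(V, W)` trivializes the vector bundle `E / K` with fibre `W`, such
that `y ↦ (p y, l (p y) (S y))` is an isomorphism from `p⁻¹ T` to `T × Gr_d(W)`. -/
def IsGrassmannBundle (Y X : FunSpace) (p : Y → X) {V : Type*} [AddCommGroup V] [Module ℂ V]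
    (W : Type*) [AddCommGroup W] [Module ℂ W] (d : ℕ)
    (K E : X → Submodule ℂ V) (S : Y → Submodule ℂ V) : Prop :=
  IsMorphism Y X p ∧ (∀ x, K x ≤ E x) ∧ (∀ y, K (p y) ≤ S y ∧ S y ≤ E (p y)) ∧
  ∀ x₀ : X, ∃ T : Set X, IsOpen T ∧ x₀ ∈ T ∧
    ∃ (l : T → (V →ₗ[ℂ] W)) (ψ : ↥(p ⁻¹' T) → grass d W),
      IsMorphism (X.sub T) (vec (V →ₗ[ℂ] W)) l ∧
      (∀ x : T, (E x).map (l x) = ⊤ ∧ E x ⊓ LinearMap.ker (l x) = K x) ∧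
      (∀ y : ↥(p ⁻¹' T), grass.space (ψ y) = (S y).map (l ⟨p y, y.2⟩)) ∧
      IsIso (Y.sub (p ⁻¹' T)) ((X.sub T).prod (grass d W))
        (fun y : ↥(p ⁻¹' T) => ((⟨p y, y.2⟩ : T), ψ y))

end FunSpace

/-! ### The module `W ⊗ A_N` and the varieties of chains -/

/-- `A_N = ℂ[t] / (t ^ N)`. -/
abbrev TruncPoly (N : ℕ) : Type := ℂ[X] ⧸ Ideal.span {(Polynomial.X : ℂ[X]) ^ N}

namespace TruncPoly

/-- The class of `t` in `A_N`. -/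
noncomputable def t (N : ℕ) : TruncPoly N := Ideal.Quotient.mk _ Polynomial.X

/-- `W ⊗ A_N`, written with the factor `A_N` first, as Mathlib does for the `A_N`-module structure
on it. -/
abbrev Free (N : ℕ) (W : Type*) [AddCommGroup W] [Module ℂ W] : Type _ := TruncPoly N ⊗[ℂ] W

/-- Multiplication by `t` on `W ⊗ A_N`, as a `ℂ`-linear map. -/
noncomputable def shift (N : ℕ) (W : Type*) [AddCommGroup W] [Module ℂ W] :
    Free N W →ₗ[ℂ] Free N W :=
  (LinearMap.lsmul (TruncPoly N) (Free N W) (t N)).restrictScalars ℂ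

/-- The subspace `W ⊗ t ^ i A_N` of `W ⊗ A_N`. -/
noncomputable def level (N : ℕ) (W : Type*) [AddCommGroup W] [Module ℂ W] (i : ℕ) :
    Submodule ℂ (Free N W) :=
  LinearMap.range (shift N W ^ i)

/-- `O_λ`: the `A_N`-submodules of `W ⊗ A_N` of dimension `k` that are isomorphic to the direct sum
of the `ℂ[t] / (t ^ λ_j) = A_N / (t ^ λ_j)`. -/
def orbit (N k : ℕ) (W : Type*) [AddCommGroup W] [Module ℂ W] {m : ℕ} (lam : Fin m → ℕ) :
    Set (FunSpace.grass k (Free N W)) :=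
  {U | ∃ U' : Submodule (TruncPoly N) (Free N W),
    U'.restrictScalars ℂ = FunSpace.grass.space U ∧
    Nonempty (U' ≃ₗ[TruncPoly N] (∀ j : Fin m, TruncPoly N ⧸ Ideal.span {t N ^ lam j}))}

/-- The orbit of a point under the group of `A_N`-linear automorphisms of `W ⊗ A_N`. -/
def autOrbit (N : ℕ) {k : ℕ} (W : Type*) [AddCommGroup W] [Module ℂ W]
    (U₀ : FunSpace.grass k (Free N W)) : Set (FunSpace.grass k (Free N W)) :=
  {U | ∃ g : Free N W ≃ₗ[TruncPoly N] Free N W,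
    FunSpace.grass.space U = (FunSpace.grass.space U₀).map (g.toLinearMap.restrictScalars ℂ)}

/-- The indices `j < N` with `i ≤ j`. -/
abbrev Idx (N i : ℕ) : Type := {j : Fin N // i ≤ (j : ℕ)}

/-- The product of the Grassmannians of `k_j`-dimensional subspaces of `W ⊗ A_N`, `i ≤ j < N`. -/
noncomputable def grassProd (N : ℕ) (W : Type*) [AddCommGroup W] [Module ℂ W] (k : ℕ → ℕ) (i : ℕ) :
    FunSpace :=
  FunSpace.pi (fun j : Idx N i => FunSpace.grass (k j.1) (Free N W))

/-- The chains `(U_j)`, `i ≤ j < N`, with `dim U_j = k_j`, `U_j ⊆ W ⊗ t ^ j A_N`,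
`U_{j+1} ⊆ U_j` and `t U_j ⊆ U_{j+1}`. Indices start at `0`. -/
def chainSet (N : ℕ) (W : Type*) [AddCommGroup W] [Module ℂ W] (k : ℕ → ℕ) (i : ℕ) :
    Set (grassProd N W k i) :=
  {U : ∀ j : Idx N i, FunSpace.grass (k j.1) (Free N W) |
    (∀ j, FunSpace.grass.space (U j) ≤ level N W j.1) ∧
    ∀ j j' : Idx N i, (j'.1 : ℕ) = j.1 + 1 →
      FunSpace.grass.space (U j') ≤ FunSpace.grass.space (U j) ∧
      (FunSpace.grass.space (U j)).map (shift N W) ≤ FunSpace.grass.space (U j')}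

/-- The variety of chains `(U_j)`, `i ≤ j < N`; for `i = 0` this is `Y(k_*)`. -/
noncomputable def chains (N : ℕ) (W : Type*) [AddCommGroup W] [Module ℂ W] (k : ℕ → ℕ) (i : ℕ) :
    FunSpace :=
  (grassProd N W k i).sub (chainSet N W k i)

section

variable {N : ℕ} {W : Type*} [AddCommGroup W] [Module ℂ W] {k : ℕ → ℕ} {i : ℕ}

/-- The member `U_j` of a chain. -/
def member (y : chains N W k i) (j : Idx N i) : FunSpace.grass (k j.1) (Free N W) :=
  (show ∀ j : Idx N i, FunSpace.grass (k j.1) (Free N W) from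
    (show chainSet N W k i from y).1) j

/-- The first member `U_i` of a chain, as a subspace; by convention `U_N = 0`. -/
noncomputable def first (y : chains N W k i) : Submodule ℂ (Free N W) :=
  if h : i < N then FunSpace.grass.space (member y ⟨⟨i, h⟩, le_rfl⟩) else ⊥

/-- The projection that forgets `U_i`. -/
def forget (y : chains N W k i) : chains N W k (i + 1) :=
  (⟨fun j => member y ⟨j.1, (Nat.le_succ i).trans j.2⟩,
    fun _ => (show chainSet N W k i from y).2.1 _,
    fun _ _ h => (show chainSet N W k i from y).2.2 _ _ h⟩ : chainSet N W k (i + 1))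

/-- The projection `(U_0, …, U_{N-1}) ↦ U_0`. -/
def proj (hN : 0 < N) (y : chains N W k 0) : FunSpace.grass (k 0) (Free N W) :=
  member y ⟨⟨0, hN⟩, le_rfl⟩

end

/-- `λ'_{i+1} = #{j | λ_j ≥ i + 1}`. -/
def conj {m : ℕ} (lam : Fin m → ℕ) (i : ℕ) : ℕ := (Finset.univ.filter fun j => i + 1 ≤ lam j).card

/-- `k_{i+1}(λ) = ∑_{j : λ_j ≥ i} (λ_j - i)`. -/
def dims {m : ℕ} (lam : Fin m → ℕ) (i : ℕ) : ℕ :=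
  ∑ j ∈ Finset.univ.filter fun j => i ≤ lam j, (lam j - i)

end TruncPoly

/-! The orbit is cut out by ranks. By Smith normal form every submodule of `W ⊗ A_N` is `⨁ t ^ c_j
A_N e_j` for some `A_N`-basis `e`, so two submodules of the same type differ by an automorphism of
`W ⊗ A_N`. The type itself is read off from the ranks of the `t ^ i`: their first differences are
the `λ'_i`, and the second differences count the summands of each length. Hence a subspace lies in
`O_λ` iff it is stable under `t` and `t ^ i` has rank `dims lam i` on it for all `i < N`
(`mem_orbit_iff_rank`).

The tower (`isGrassmannBundle_forget`, `chains_tower`): given `U_{i+1}`, the admissible `U_i` are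
the subspaces of the right dimension between `K = U_{i+1}` and `E = t⁻¹ K ∩ (W ⊗ t ^ i A_N)`. Since
`t` maps `W ⊗ t ^ i A_N` onto `W ⊗ t ^ (i+1) A_N` with a kernel of dimension `dim W`, the quotient
`E / K` has constant rank `dim W`, and it can be split locally by regular maps
(`splitsAt_inf_comap`). So each step is a Grassmann bundle, locally a product. Charts by affine
space, irreducibility and completeness therefore climb from the point at the top index down to index
`0`. Charts give smoothness and the dimension `∑ λ'_i (m - λ'_i)`, which is the stated number
because `∑ λ'_i = k`.

The resolution (`isResolution_proj`): in a chain `t ^ i U_0 ⊆ U_i`, so the ranks on `U_0` never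
exceed `dims lam i`, and `U_0` lies in the orbit iff they are at least that large, an open
condition. There equality of dimensions forces `U_i = t ^ i U_0`; conversely `U ↦ (t ^ i U)` is a
morphism on the orbit because the ranks are constant. This is the birational inverse. As the chains
form an irreducible space, the preimage of the orbit is dense, and so the image of the projection
lies in the closure.

Two foundations carry this. A map to a Grassmannian is a morphism iff its subspaces have regular
frames locally (`morphAt_grass`); consequently incidence conditions are closed and ranks are lower
semicontinuous. Completeness is proved for projective space by elimination theory
(`eventually_not_mem_of_cone`), then for Grassmannians by induction through flags, then for
Grassmann bundles; a morphism from a complete space to a variety is universally closed by the graph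
argument. -/

section

open Filter Topology

namespace FunSpace

universe u v w

/-! ### Morphisms, tested at a point -/

section Basic

variable {X : FunSpace.{u}} {Y : FunSpace.{v}} {Z : FunSpace.{w}}

theorem reg_of_eventuallyEq {x : X} {f g : X → ℂ} (h : ∀ᶠ y in 𝓝 x, f y = g y)
    (hf : f ∈ X.reg x) : g ∈ X.reg x := by
  obtain ⟨U, hU, hUo, hx⟩ := eventually_nhds_iff.1 h
  exact X.reg_congr x f g U hUo hx hU hf

theorem eventually_reg {x : X} {f : X → ℂ} (hf : f ∈ X.reg x) : ∀ᶠ y in 𝓝 x, f ∈ X.reg y := by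
  obtain ⟨U, hUo, hx, hU⟩ := X.reg_spread x f hf
  exact eventually_nhds_iff.2 ⟨U, hU, hUo, hx⟩

theorem eventually_ne {x : X} {f : X → ℂ} (hf : f ∈ X.reg x) (h0 : f x ≠ 0) :
    ∀ᶠ y in 𝓝 x, f y ≠ 0 := by
  obtain ⟨-, U, hUo, hx, hU⟩ := X.reg_inv x f hf h0
  exact eventually_nhds_iff.2 ⟨U, hU, hUo, hx⟩

theorem inv_reg {x : X} {f : X → ℂ} (hf : f ∈ X.reg x) (h0 : f x ≠ 0) : f⁻¹ ∈ X.reg x :=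
  (X.reg_inv x f hf h0).1

theorem const_reg (x : X) (c : ℂ) : (fun _ => c) ∈ X.reg x := (X.reg x).algebraMap_mem c

/-- A map of spaces with functions is a morphism near a point. -/
def MorphAt (X : FunSpace.{u}) (Y : FunSpace.{v}) (φ : X → Y) (x : X) : Prop :=
  ContinuousAt φ x ∧ ∀ f ∈ Y.reg (φ x), f ∘ φ ∈ X.reg x

theorem isMorphism_iff {φ : X → Y} : IsMorphism X Y φ ↔ ∀ x, MorphAt X Y φ x :=
  ⟨fun h x => ⟨h.1.continuousAt, h.2 x⟩,
    fun h => ⟨continuous_iff_continuousAt.2 fun x => (h x).1, fun x => (h x).2⟩⟩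

theorem IsMorphism.morphAt {φ : X → Y} (h : IsMorphism X Y φ) (x : X) : MorphAt X Y φ x :=
  isMorphism_iff.1 h x

theorem MorphAt.comp {ψ : Y → Z} {φ : X → Y} {x : X} (hψ : MorphAt Y Z ψ (φ x))
    (hφ : MorphAt X Y φ x) : MorphAt X Z (ψ ∘ φ) x :=
  ⟨hψ.1.comp hφ.1, fun f hf => hφ.2 _ (hψ.2 f hf)⟩

theorem morphAt_id (x : X) : MorphAt X X id x := ⟨continuousAt_id, fun _ hf => hf⟩

theorem MorphAt.congr {φ ψ : X → Y} {x : X} (h : MorphAt X Y φ x) (hφ : ∀ᶠ y in 𝓝 x, φ y = ψ y) :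
    MorphAt X Y ψ x := by
  refine ⟨h.1.congr hφ, fun f hf => ?_⟩
  rw [← hφ.self_of_nhds] at hf
  exact reg_of_eventuallyEq (hφ.mono fun y hy => by simp [hy]) (h.2 f hf)

theorem IsMorphism.comp {ψ : Y → Z} {φ : X → Y} (hψ : IsMorphism Y Z ψ)
    (hφ : IsMorphism X Y φ) : IsMorphism X Z (ψ ∘ φ) :=
  isMorphism_iff.2 fun x => (hψ.morphAt _).comp (hφ.morphAt x)

theorem morphAt_const (y : Y) (x : X) : MorphAt X Y (fun _ => y) x :=
  ⟨continuousAt_const, fun f _ => const_reg x (f y)⟩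

theorem IsIso.of_inverse {φ : X → Y} {ψ : Y → X} (hφ : IsMorphism X Y φ) (hψ : IsMorphism Y X ψ)
    (h1 : ∀ x, ψ (φ x) = x) (h2 : ∀ y, φ (ψ y) = y) : IsIso X Y φ :=
  ⟨hφ, ψ, hψ, funext h1, funext h2⟩

theorem IsIso.comp {ψ : Y → Z} {φ : X → Y} (hψ : IsIso Y Z ψ) (hφ : IsIso X Y φ) :
    IsIso X Z (ψ ∘ φ) := by
  obtain ⟨hψ, ψ', hψ', h1, h2⟩ := hψ
  obtain ⟨hφ, φ', hφ', h3, h4⟩ := hφ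
  refine IsIso.of_inverse (hψ.comp hφ) (hφ'.comp hψ') (fun x => ?_) fun z => ?_
  · simpa using (congrArg φ' (congrFun h1 (φ x))).trans (congrFun h3 x)
  · simpa using (congrArg ψ (congrFun h4 (ψ' z))).trans (congrFun h2 z)

end Basic

/-! ### The universal property of a generated structure -/

section Generate

variable {X : Type u} {L : Set (Set X × (X → ℂ))} {Y : FunSpace.{v}} {Z : FunSpace.{w}}

theorem generate_isOpen {p : Set X × (X → ℂ)} (hp : p ∈ L) :
    @IsOpen (generate L) _ p.1 := by
  intro x hx
  exact ⟨{p}, by simpa using hp, Set.finite_singleton _, by simpa [dom] using hx, 1, one_mem _,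
    by simp, fun y hy _ => hy p rfl⟩

theorem generate_reg {p : Set X × (X → ℂ)} (hp : p ∈ L) {x : X} (hx : x ∈ p.1) :
    p.2 ∈ (generate L).reg x :=
  ⟨{p}, by simpa using hp, Set.finite_singleton _, by simpa [dom] using hx, p.2,
    Algebra.subset_adjoin (by simp), 1, one_mem _, by simp, fun y _ _ => by simp⟩

theorem polys_comp_reg {b : Set (Set X × (X → ℂ))} {φ : Z → X} {z : Z}
    (hb : ∀ p ∈ b, p.2 ∘ φ ∈ Z.reg z) {h : X → ℂ} (hh : h ∈ polys b) : h ∘ φ ∈ Z.reg z := by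
  induction hh using Algebra.adjoin_induction with
  | mem f hf => obtain ⟨p, hp, rfl⟩ := hf; exact hb p hp
  | algebraMap r => exact (Z.reg z).algebraMap_mem r
  | add f g _ _ hf hg => exact add_mem hf hg
  | mul f g _ _ hf hg => exact mul_mem hf hg

/-- A basic open set or a quotient `p / q` involves only finitely many generators, and regular
functions are closed under polynomials and under inversion where they do not vanish. It is therefore
enough to test a map on generators. -/
theorem morphAt_generate {φ : Z → X} {z : Z} :
    MorphAt Z (generate L) φ z ↔
      ∀ p ∈ L, φ z ∈ p.1 → (∀ᶠ y in 𝓝 z, φ y ∈ p.1) ∧ p.2 ∘ φ ∈ Z.reg z := by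
  constructor
  · intro h p hp hz
    exact ⟨h.1.eventually ((generate_isOpen hp).mem_nhds hz), h.2 _ (generate_reg hp hz)⟩
  · intro h
    have key : ∀ b : Set (Set X × (X → ℂ)), b ⊆ L → b.Finite → φ z ∈ dom b →
        (∀ᶠ y in 𝓝 z, φ y ∈ dom b) ∧ ∀ q ∈ polys b, q ∘ φ ∈ Z.reg z := by
      intro b hbL hbf hb
      refine ⟨?_, fun q hq => polys_comp_reg (fun p hp => (h p (hbL hp) (hb p hp)).2) hq⟩
      simp only [dom, Set.mem_ofPred_eq]
      exact (hbf.eventually_all).2 fun p hp => (h p (hbL hp) (hb p hp)).1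
    constructor
    · intro V hV
      obtain ⟨V', hV', hVo, hz⟩ := mem_nhds_iff.1 hV
      obtain ⟨b, hbL, hbf, hzb, q, hq, hqz, hb⟩ := hVo (φ z) hz
      obtain ⟨h1, h2⟩ := key b hbL hbf hzb
      have : ∀ᶠ y in 𝓝 z, φ y ∈ V := by
        filter_upwards [h1, eventually_ne (h2 q hq) hqz] with y hy hqy
        exact hV' (hb _ hy hqy)
      exact this
    · rintro f ⟨b, hbL, hbf, hzb, p, hp, q, hq, hqz, hf⟩
      obtain ⟨h1, h2⟩ := key b hbL hbf hzb
      refine reg_of_eventuallyEq ?_ (mul_mem (h2 p hp) (inv_reg (h2 q hq) hqz))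
      filter_upwards [h1, eventually_ne (h2 q hq) hqz] with y hy hqy
      simp only [Pi.mul_apply, Pi.inv_apply, Function.comp]
      rw [hf _ hy hqy, div_eq_mul_inv]

theorem morphAt_of_pulled_subset {g : X → Y} (h : pulled Y g ⊆ L) (x : X) :
    MorphAt (generate L) Y g x := by
  constructor
  · intro V hV
    obtain ⟨V', hV', hVo, hz⟩ := mem_nhds_iff.1 hV
    have : (g ⁻¹' V', (0 : Y → ℂ) ∘ g) ∈ L :=
      h ⟨V', 0, hVo, fun y _ => zero_mem _, rfl⟩
    exact Filter.mem_of_superset ((generate_isOpen this).mem_nhds hz) fun y hy => hV' hy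
  · intro f hf
    obtain ⟨U, hUo, hx, hU⟩ := Y.reg_spread _ f hf
    have : (g ⁻¹' U, f ∘ g) ∈ L := h ⟨U, f, hUo, hU, rfl⟩
    exact generate_reg this hx

theorem pulled_cond {g : X → Y} {φ : Z → X} {z : Z} (h : MorphAt Z Y (g ∘ φ) z) :
    ∀ p ∈ pulled Y g, φ z ∈ p.1 → (∀ᶠ y in 𝓝 z, φ y ∈ p.1) ∧ p.2 ∘ φ ∈ Z.reg z := by
  rintro p ⟨U, f, hU, hf, rfl⟩ hz
  exact ⟨h.1.eventually (hU.mem_nhds hz), h.2 f (hf _ hz)⟩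

/-- Pull-back along one map commutes with finite intersections of domains and with polynomial
expressions, so generating from pulled-back functions produces nothing beyond pulled-back functions.
-/
theorem polys_pulled {g : X → Y} {b : Set (Set X × (X → ℂ))} (hb : b ⊆ pulled Y g)
    (hbf : b.Finite) : ∃ O : Set Y, IsOpen O ∧ dom b = g ⁻¹' O ∧
      ∀ h ∈ polys b, ∃ h' : Y → ℂ, (∀ y ∈ O, h' ∈ Y.reg y) ∧ h = h' ∘ g := by
  choose! U f hU hf he using fun p (hp : p ∈ b) => hb hp
  refine ⟨⋂ p ∈ b, U p, hbf.isOpen_biInter fun p hp => hU p hp, ?_, ?_⟩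
  · ext x
    simp only [dom, Set.mem_ofPred_eq, Set.preimage_iInter, Set.mem_iInter]
    exact forall₂_congr fun p hp => by rw [show p.1 = g ⁻¹' U p from congrArg Prod.fst (he p hp)]
  · intro h hh
    induction hh using Algebra.adjoin_induction with
    | mem h hp =>
      obtain ⟨p, hp, rfl⟩ := hp
      exact ⟨f p, fun y hy => hf p hp y (Set.mem_iInter₂.1 hy p hp), congrArg Prod.snd (he p hp)⟩
    | algebraMap r => exact ⟨fun _ => r, fun y _ => const_reg y r, rfl⟩
    | add p q _ _ hp hq =>
      obtain ⟨p', hp, rfl⟩ := hp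
      obtain ⟨q', hq, rfl⟩ := hq
      exact ⟨p' + q', fun y hy => add_mem (hp y hy) (hq y hy), rfl⟩
    | mul p q _ _ hp hq =>
      obtain ⟨p', hp, rfl⟩ := hp
      obtain ⟨q', hq, rfl⟩ := hq
      exact ⟨p' * q', fun y hy => mul_mem (hp y hy) (hq y hy), rfl⟩

theorem generate_pulled_nhds {g : X → Y} {x : X} {A : Set X} :
    A ∈ @nhds (generate (pulled Y g)) _ x ↔ ∃ B ∈ 𝓝 (g x), g ⁻¹' B ⊆ A := by
  constructor
  · intro hA
    obtain ⟨V, hV, hVo, hx⟩ := mem_nhds_iff.1 hA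
    obtain ⟨b, hbL, hbf, hxb, q, hq, hqx, hb⟩ := hVo x hx
    obtain ⟨O, hO, hd, hp⟩ := polys_pulled hbL hbf
    obtain ⟨q', hq', rfl⟩ := hp q hq
    rw [hd] at hxb hb
    have hne := eventually_ne (hq' _ hxb) hqx
    exact ⟨_, Filter.inter_mem (hO.mem_nhds hxb) hne, fun y hy => hV (hb y hy.1 hy.2)⟩
  · rintro ⟨B, hB, hBA⟩
    exact Filter.mem_of_superset
      ((morphAt_of_pulled_subset (L := pulled Y g) (g := g) subset_rfl x).1 hB) hBA

theorem generate_pulled_reg {g : X → Y} {x : X} {f : X → ℂ} :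
    f ∈ (generate (pulled Y g)).reg x ↔
      ∃ f' ∈ Y.reg (g x), ∃ B ∈ 𝓝 (g x), ∀ y, g y ∈ B → f y = f' (g y) := by
  constructor
  · rintro ⟨b, hbL, hbf, hxb, p, hp, q, hq, hqx, hf⟩
    obtain ⟨O, hO, hd, hpol⟩ := polys_pulled hbL hbf
    obtain ⟨q', hq', rfl⟩ := hpol q hq
    obtain ⟨p', hp', rfl⟩ := hpol p hp
    rw [hd] at hxb hf
    refine ⟨p' * q'⁻¹, mul_mem (hp' _ hxb) (inv_reg (hq' _ hxb) hqx), _,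
      Filter.inter_mem (hO.mem_nhds hxb) (eventually_ne (hq' _ hxb) hqx), fun y hy => ?_⟩
    rw [hf y hy.1 hy.2, div_eq_mul_inv]
    rfl
  · rintro ⟨f', hf', B, hB, h⟩
    have hm := morphAt_of_pulled_subset (L := pulled Y g) (g := g) subset_rfl x
    refine reg_of_eventuallyEq ?_ (hm.2 f' hf')
    filter_upwards [hm.1 hB] with y hy
    exact (h y hy).symm

end Generate

/-! ### Subspaces, products and families -/

section Sub

variable {X : FunSpace.{u}} {Y : FunSpace.{v}} {Z : FunSpace.{w}} {S : Set X}

theorem morphAt_val (x : X.sub S) : MorphAt (X.sub S) X (Subtype.val : S → X) x :=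
  morphAt_of_pulled_subset subset_rfl x

theorem isMorphism_val : IsMorphism (X.sub S) X (Subtype.val : S → X) :=
  isMorphism_iff.2 morphAt_val

theorem morphAt_sub {φ : Z → X.sub S} {z : Z} :
    MorphAt Z (X.sub S) φ z ↔ MorphAt Z X (fun y => (show S from φ y).1) z :=
  ⟨fun h => (morphAt_val (φ z)).comp h, fun h => morphAt_generate.2 (pulled_cond h)⟩

theorem sub_nhds {x : S} {A : Set S} :
    A ∈ @nhds (X.sub S) _ x ↔ ∃ B ∈ 𝓝 x.1, Subtype.val ⁻¹' B ⊆ A := generate_pulled_nhds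

theorem sub_isOpen {A : Set S} :
    @IsOpen (X.sub S) _ A ↔ ∃ B : Set X, IsOpen B ∧ Subtype.val ⁻¹' B = A := by
  constructor
  · intro h
    refine ⟨interior {x | ∀ hx : x ∈ S, (⟨x, hx⟩ : S) ∈ A}, isOpen_interior, ?_⟩
    ext x
    constructor
    · intro hx
      exact interior_subset hx x.2
    · intro hx
      obtain ⟨B, hB, hBA⟩ := sub_nhds.1 (h.mem_nhds hx)
      exact mem_interior_iff_mem_nhds.2 (Filter.mem_of_superset hB fun y hy hyS => hBA hy)
  · rintro ⟨B, hB, rfl⟩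
    exact hB.preimage isMorphism_val.1

theorem sub_isInducing : @Topology.IsInducing (X.sub S) X _ _ (Subtype.val : S → X) :=
  ⟨TopologicalSpace.ext (by
    ext A
    exact sub_isOpen.trans isOpen_induced_iff.symm)⟩

theorem sub_isClosed {A : Set S} :
    @IsClosed (X.sub S) _ A ↔ ∃ B : Set X, IsClosed B ∧ Subtype.val ⁻¹' B = A :=
  (sub_isInducing (X := X) (S := S)).isClosed_iff

theorem sub_reg {x : S} {f : S → ℂ} : f ∈ (X.sub S).reg x ↔
    ∃ f' ∈ X.reg x.1, ∀ᶠ y in 𝓝 x.1, ∀ hy : y ∈ S, f ⟨y, hy⟩ = f' y := by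
  refine generate_pulled_reg.trans ⟨?_, ?_⟩
  · rintro ⟨f', hf', B, hB, h⟩
    exact ⟨f', hf', Filter.mem_of_superset hB fun y hy hyS => h ⟨y, hyS⟩ hy⟩
  · rintro ⟨f', hf', h⟩
    exact ⟨f', hf', _, h, fun y hy => hy y.2⟩

/-- Being a morphism near a point is local: this lets constructions made on an open piece be
transported to the whole space. -/
theorem morphAt_sub_open (hS : IsOpen S) {φ : X → Y} {x : S} :
    MorphAt (X.sub S) Y (fun y : S => φ y.1) x ↔ MorphAt X Y φ x.1 := by
  refine ⟨fun h => ⟨?_, ?_⟩, fun h => h.comp (morphAt_val x)⟩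
  · intro V hV
    obtain ⟨B, hB, hBA⟩ := sub_nhds.1 (h.1 hV)
    rw [Filter.mem_map]
    filter_upwards [hB, hS.mem_nhds x.2] with y hy hyS
    exact hBA (show (⟨y, hyS⟩ : S) ∈ _ from hy)
  · intro f hf
    obtain ⟨f', hf', h'⟩ := sub_reg.1 (h.2 f hf)
    refine reg_of_eventuallyEq ?_ hf'
    filter_upwards [h', hS.mem_nhds x.2] with y hy hyS
    exact (hy hyS).symm

end Sub

section Prod

variable {X : FunSpace.{u}} {Y : FunSpace.{v}} {Z : FunSpace.{w}}

theorem isMorphism_fst : IsMorphism (X.prod Y) X (Prod.fst : X × Y → X) :=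
  isMorphism_iff.2 fun x => morphAt_of_pulled_subset Set.subset_union_left x

theorem isMorphism_snd : IsMorphism (X.prod Y) Y (Prod.snd : X × Y → Y) :=
  isMorphism_iff.2 fun x => morphAt_of_pulled_subset Set.subset_union_right x

theorem morphAt_prod {φ : Z → X × Y} {z : Z} :
    MorphAt Z (X.prod Y) φ z ↔
      MorphAt Z X (fun y => (φ y).1) z ∧ MorphAt Z Y (fun y => (φ y).2) z := by
  refine ⟨fun h => ⟨(isMorphism_fst.morphAt (φ z)).comp h, (isMorphism_snd.morphAt (φ z)).comp h⟩,
    fun h => morphAt_generate.2 ?_⟩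
  rintro p (hp | hp)
  exacts [pulled_cond h.1 p hp, pulled_cond h.2 p hp]

theorem isMorphism_prod {φ : Z → X × Y} :
    IsMorphism Z (X.prod Y) φ ↔
      IsMorphism Z X (fun y => (φ y).1) ∧ IsMorphism Z Y (fun y => (φ y).2) := by
  exact ⟨fun h => ⟨isMorphism_fst.comp h, isMorphism_snd.comp h⟩,
    fun h => isMorphism_iff.2 fun z => morphAt_prod.2 ⟨h.1.morphAt z, h.2.morphAt z⟩⟩

end Prod

section Pi

variable {ι : Type w} {X : ι → FunSpace.{u}} {Z : FunSpace.{v}}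

theorem isMorphism_eval (i : ι) : IsMorphism (pi X) (X i) (fun x : ∀ i, X i => x i) :=
  isMorphism_iff.2 fun x => morphAt_of_pulled_subset
    (Set.subset_iUnion (fun i => pulled (X i) (fun x : ∀ i, X i => x i)) i) x

theorem morphAt_pi {φ : Z → ∀ i, X i} {z : Z} :
    MorphAt Z (pi X) φ z ↔ ∀ i, MorphAt Z (X i) (fun y => φ y i) z := by
  refine ⟨fun h i => ((isMorphism_eval i).morphAt (φ z)).comp h, fun h => morphAt_generate.2 ?_⟩
  intro p hp
  obtain ⟨i, hi⟩ := Set.mem_iUnion.1 hp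
  exact pulled_cond (h i) p hi

end Pi

/-! ### Regular maps to vector spaces -/

section Vec

variable {X : FunSpace.{u}} {Y : FunSpace.{v}}
variable {E F G : Type*} [AddCommGroup E] [Module ℂ E] [AddCommGroup F] [Module ℂ F]
  [AddCommGroup G] [Module ℂ G]

/-- A map to a vector space is regular near a point. -/
def RegAt (X : FunSpace.{u}) (φ : X → E) (x : X) : Prop :=
  ∀ l : Module.Dual ℂ E, (fun y => l (φ y)) ∈ X.reg x

theorem morphAt_vec {φ : X → E} {x : X} : MorphAt X (vec E) φ x ↔ RegAt X φ x := by
  refine morphAt_generate.trans ⟨fun h l => (h _ ⟨l, rfl⟩ trivial).2, ?_⟩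
  rintro h p ⟨l, rfl⟩ -
  exact ⟨Filter.univ_mem, h l⟩

theorem regAt_const (e : E) (x : X) : RegAt X (fun _ => e) x := fun l => const_reg x (l e)

theorem regAt_id (e : E) : RegAt (vec E) (fun y : E => y) e := morphAt_vec.1 (morphAt_id (X := vec E) e)

theorem RegAt.congr {φ ψ : X → E} {x : X} (h : RegAt X φ x) (he : ∀ᶠ y in 𝓝 x, φ y = ψ y) :
    RegAt X ψ x := fun l => reg_of_eventuallyEq (he.mono fun y hy => by rw [hy]) (h l)

theorem RegAt.comp {φ : Y → E} {g : X → Y} {x : X} (h : RegAt Y φ (g x)) (hg : MorphAt X Y g x) :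
    RegAt X (fun y => φ (g y)) x := fun l => hg.2 _ (h l)

theorem RegAt.linear {φ : X → E} {x : X} (h : RegAt X φ x) (A : E →ₗ[ℂ] F) :
    RegAt X (fun y => A (φ y)) x := fun l => h (l ∘ₗ A)

theorem RegAt.add {φ ψ : X → E} {x : X} (h : RegAt X φ x) (h' : RegAt X ψ x) :
    RegAt X (fun y => φ y + ψ y) x := fun l => by
  simp only [map_add]
  exact add_mem (h l) (h' l)

theorem RegAt.sub {φ ψ : X → E} {x : X} (h : RegAt X φ x) (h' : RegAt X ψ x) :
    RegAt X (fun y => φ y - ψ y) x := fun l => by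
  simp only [map_sub]
  exact sub_mem (h l) (h' l)

theorem regAt_sum {ι : Type*} (s : Finset ι) {φ : ι → X → E} {x : X}
    (h : ∀ i ∈ s, RegAt X (φ i) x) : RegAt X (fun y => ∑ i ∈ s, φ i y) x := fun l => by
  simp only [map_sum]
  have := sum_mem (S := X.reg x) (t := s) (f := fun i y => l (φ i y)) fun i hi => h i hi l
  convert this using 1
  ext y
  simp

theorem regAt_complex {f : X → ℂ} {x : X} : RegAt X f x ↔ f ∈ X.reg x := by
  refine ⟨fun h => h LinearMap.id, fun h l => ?_⟩
  have : (fun y => l (f y)) = (fun _ => l 1) * f := by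
    ext y
    rw [Pi.mul_apply, mul_comm, ← smul_eq_mul, ← map_smul, smul_eq_mul, mul_one]
  rw [this]
  exact mul_mem (const_reg x _) h

theorem RegAt.smul {f : X → ℂ} {φ : X → E} {x : X} (hf : f ∈ X.reg x) (h : RegAt X φ x) :
    RegAt X (fun y => f y • φ y) x := fun l => by
  simp only [map_smul, smul_eq_mul]
  exact mul_mem hf (h l)

theorem regAt_basis {ι : Type*} [Finite ι] (b : Module.Basis ι ℂ E) {φ : X → E} {x : X} :
    RegAt X φ x ↔ ∀ i, (fun y => b.repr (φ y) i) ∈ X.reg x := by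
  have := Fintype.ofFinite ι
  refine ⟨fun h i => h (b.coord i), fun h => ?_⟩
  have : φ = fun y => ∑ i, b.repr (φ y) i • b i := funext fun y => (b.sum_repr _).symm
  rw [this]
  exact regAt_sum _ fun i _ => (regAt_const (b i) x).smul (h i)

theorem regAt_pi {ι : Type*} [Finite ι] {E : ι → Type*} [∀ i, AddCommGroup (E i)]
    [∀ i, Module ℂ (E i)] {φ : X → ∀ i, E i} {x : X} :
    RegAt X φ x ↔ ∀ i, RegAt X (fun y => φ y i) x := by
  classical
  have := Fintype.ofFinite ι
  refine ⟨fun h i => h.linear (LinearMap.proj i), fun h => ?_⟩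
  have : φ = fun y => ∑ i, LinearMap.single ℂ E i (φ y i) := by
    ext y i
    simp
  rw [this]
  exact regAt_sum _ fun i _ => (h i).linear _

theorem regAt_prod {φ : X → E} {ψ : X → F} {x : X} (hφ : RegAt X φ x) (hψ : RegAt X ψ x) :
    RegAt X (fun y => (φ y, ψ y)) x := by
  have := (hφ.linear (LinearMap.inl ℂ E F)).add (hψ.linear (LinearMap.inr ℂ E F))
  simpa using this

/-- Expanding `φ` in a basis leaves a finite sum of linear images of `ψ` with regular coefficients.
-/
theorem RegAt.bilin [FiniteDimensional ℂ E] (B : E →ₗ[ℂ] F →ₗ[ℂ] G) {φ : X → E}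
    {ψ : X → F} {x : X} (hφ : RegAt X φ x) (hψ : RegAt X ψ x) :
    RegAt X (fun y => B (φ y) (ψ y)) x := by
  let b := Module.finBasis ℂ E
  have : (fun y => B (φ y) (ψ y)) = fun y => ∑ i, b.repr (φ y) i • B (b i) (ψ y) := by
    ext y
    conv_lhs => rw [← b.sum_repr (φ y)]
    simp only [map_sum, map_smul, LinearMap.sum_apply, LinearMap.smul_apply]
  rw [this]
  exact regAt_sum _ fun i _ => (hψ.linear (B (b i))).smul ((regAt_basis b).1 hφ i)

theorem RegAt.apply [FiniteDimensional ℂ E] [FiniteDimensional ℂ F] {A : X → E →ₗ[ℂ] F}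
    {φ : X → E} {x : X} (hA : RegAt X A x) (h : RegAt X φ x) : RegAt X (fun y => A y (φ y)) x :=
  hA.bilin LinearMap.id h

theorem RegAt.lcomp [FiniteDimensional ℂ E] [FiniteDimensional ℂ F] [FiniteDimensional ℂ G]
    {A : X → F →ₗ[ℂ] G} {B : X → E →ₗ[ℂ] F} {x : X} (hA : RegAt X A x) (hB : RegAt X B x) :
    RegAt X (fun y => A y ∘ₗ B y) x :=
  hA.bilin (LinearMap.llcomp ℂ E F G) hB

theorem eventually_regAt [FiniteDimensional ℂ E] {φ : X → E} {x : X} (h : RegAt X φ x) :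
    ∀ᶠ y in 𝓝 x, RegAt X φ y := by
  let b := Module.finBasis ℂ E
  simp only [regAt_basis b] at h ⊢
  exact eventually_all.2 fun i => eventually_reg (h i)

theorem det_reg {ι : Type*} [Fintype ι] [DecidableEq ι] {M : X → Matrix ι ι ℂ} {x : X}
    (h : ∀ i j, (fun y => M y i j) ∈ X.reg x) : (fun y => (M y).det) ∈ X.reg x := by
  have : (fun y => (M y).det) =
      ∑ σ : Equiv.Perm ι, (fun _ => ((Equiv.Perm.sign σ : ℤ) : ℂ)) * ∏ i, fun y => M y (σ i) i := by
    ext y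
    simp [Matrix.det_apply']
  rw [this]
  exact sum_mem fun σ _ => mul_mem (const_reg x _) (prod_mem fun i _ => h _ _)

theorem RegAt.det [FiniteDimensional ℂ E] {A : X → E →ₗ[ℂ] E} {x : X} (hA : RegAt X A x) :
    (fun y => LinearMap.det (A y)) ∈ X.reg x := by
  let b := Module.finBasis ℂ E
  simp only [← LinearMap.det_toMatrix b]
  refine det_reg fun i j => ?_
  simp only [LinearMap.toMatrix_apply]
  exact (regAt_basis b).1 (hA.apply (regAt_const (b j) x)) i

/-- Cramer's rule: near `x` the inverse is the adjugate divided by the determinant. `Ring.inverse`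
is `0` at non-invertible maps, but these do not occur near `x`. -/
theorem RegAt.ringInverse [FiniteDimensional ℂ E] {A : X → E →ₗ[ℂ] E} {x : X} (hA : RegAt X A x)
    (hx : LinearMap.det (A x) ≠ 0) : RegAt X (fun y => Ring.inverse (A y)) x := by
  let b := Module.finBasis ℂ E
  have hM : ∀ i j, (fun y => LinearMap.toMatrix b b (A y) i j) ∈ X.reg x := fun i j => by
    simp only [LinearMap.toMatrix_apply]
    exact (regAt_basis b).1 (hA.apply (regAt_const (b j) x)) i
  have hadj : RegAt X (fun y => (LinearMap.toMatrix b b (A y)).adjugate) x := by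
    refine regAt_pi.2 fun i => regAt_pi.2 fun j => regAt_complex.2 ?_
    simp only [Matrix.adjugate_apply]
    refine det_reg fun i' j' => ?_
    by_cases h : i' = j
    · subst h
      simp only [Matrix.updateRow_self]
      exact const_reg x _
    · simp only [Matrix.updateRow_ne h]
      exact hM _ _
  have h1 := ((hadj.linear (Matrix.toLin b b).toLinearMap).smul (inv_reg hA.det hx))
  refine h1.congr ?_
  filter_upwards [eventually_ne hA.det hx] with y hy
  have hy' : (LinearMap.toMatrix b b (A y)).det ≠ 0 := by rwa [LinearMap.det_toMatrix]
  have hinv : (LinearMap.det (A y))⁻¹ • Matrix.toLin b b (LinearMap.toMatrix b b (A y)).adjugate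
      * A y = 1 := by
    apply (LinearMap.toMatrix b b).injective
    rw [LinearMap.toMatrix_mul, map_smul, LinearMap.toMatrix_toLin, LinearMap.toMatrix_one,
      Matrix.smul_mul, Matrix.adjugate_mul, LinearMap.det_toMatrix, smul_smul, inv_mul_cancel₀ hy,
      one_smul]
  have hu : IsUnit (A y) := LinearMap.isUnit_iff_isUnit_det _ |>.2 (isUnit_iff_ne_zero.2 hy)
  exact left_inv_eq_right_inv hinv (Ring.mul_inverse_cancel _ hu)

/-- The linear map `(ι → ℂ) → E` defined by a tuple of vectors. -/
noncomputable def tupleMap (ι E : Type*) [Finite ι] [AddCommGroup E] [Module ℂ E] :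
    (ι → E) →ₗ[ℂ] ((ι → ℂ) →ₗ[ℂ] E) :=
  ((Pi.basisFun ℂ ι).constr ℂ).toLinearMap

theorem tupleMap_single {ι : Type*} [Finite ι] [DecidableEq ι] (v : ι → E) (i : ι) :
    tupleMap ι E v (Pi.single i 1) = v i := by
  have := (Pi.basisFun ℂ ι).constr_basis ℂ v i
  rw [Pi.basisFun_apply] at this
  convert this
  rfl

theorem tupleMap_apply {ι : Type*} [Fintype ι] (v : ι → E) (c : ι → ℂ) :
    tupleMap ι E v c = ∑ i, c i • v i := by
  simp [tupleMap, Module.Basis.constr_apply_fintype]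

theorem range_tupleMap {ι : Type*} [Finite ι] (v : ι → E) :
    LinearMap.range (tupleMap ι E v) = Submodule.span ℂ (Set.range v) :=
  (Pi.basisFun ℂ ι).constr_range ℂ

theorem linearIndependent_iff_tupleMap {ι : Type*} [Finite ι] (v : ι → E) :
    LinearIndependent ℂ v ↔ Function.Injective (tupleMap ι E v) := by
  have := Fintype.ofFinite ι
  rw [linearIndependent_iff_injective_fintypeLinearCombination]
  have : Fintype.linearCombination ℂ v = tupleMap ι E v := by
    ext c
    simp [tupleMap_apply, Fintype.linearCombination_apply]
  rw [this]

theorem det_ne_zero_iff_injective [FiniteDimensional ℂ E] (A : E →ₗ[ℂ] E) :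
    LinearMap.det A ≠ 0 ↔ Function.Injective A := by
  rw [← isUnit_iff_ne_zero, ← LinearMap.isUnit_iff_isUnit_det, LinearMap.isUnit_iff_ker_eq_bot,
    LinearMap.ker_eq_bot]

theorem inverse_apply_apply [FiniteDimensional ℂ E] {A : E →ₗ[ℂ] E} (hA : LinearMap.det A ≠ 0)
    (e : E) : Ring.inverse A (A e) = e :=
  LinearMap.congr_fun (Ring.inverse_mul_cancel A
    ((LinearMap.isUnit_iff_isUnit_det _).2 (isUnit_iff_ne_zero.2 hA))) e

theorem apply_inverse_apply [FiniteDimensional ℂ E] {A : E →ₗ[ℂ] E} (hA : LinearMap.det A ≠ 0)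
    (e : E) : A (Ring.inverse A e) = e :=
  LinearMap.congr_fun (Ring.mul_inverse_cancel A
    ((LinearMap.isUnit_iff_isUnit_det _).2 (isUnit_iff_ne_zero.2 hA))) e

/-- Injectivity of a linear map is an open condition. -/
theorem eventually_injective [FiniteDimensional ℂ E] [FiniteDimensional ℂ F]
    {A : X → E →ₗ[ℂ] F} {x : X} (hA : RegAt X A x) (h : Function.Injective (A x)) :
    ∀ᶠ y in 𝓝 x, Function.Injective (A y) := by
  -- With `B` a left inverse of `A x`, the determinant of `B ∘ A y` is regular and nonzero at `y =
  -- x`, hence nonzero nearby, and then `A y` is injective.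
  obtain ⟨B, hB⟩ := (A x).exists_leftInverse_of_injective (LinearMap.ker_eq_bot.2 h)
  have hr : RegAt X (fun y => B ∘ₗ A y) x := (regAt_const B x).lcomp hA
  filter_upwards [eventually_ne hr.det (by simp [hB])] with y hy
  exact Function.Injective.of_comp ((det_ne_zero_iff_injective _).1 hy)

/-- Linear independence is an open condition. -/
theorem eventually_linearIndependent {ι : Type*} [Finite ι] {u : X → ι → E} {x : X}
    [FiniteDimensional ℂ E] (hu : RegAt X u x) (h : LinearIndependent ℂ (u x)) :
    ∀ᶠ y in 𝓝 x, LinearIndependent ℂ (u y) := by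
  simp only [linearIndependent_iff_tupleMap] at h ⊢
  exact eventually_injective (hu.linear (tupleMap ι E)) h

end Vec

end FunSpace

namespace FunSpace

universe u v w

set_option linter.unusedSectionVars false

/-! ### Grassmannians and regular families of subspaces -/

section Grass

variable {V : Type v} [AddCommGroup V] [Module ℂ V] {k : ℕ}

/-- The linearly independent `k`-tuples. -/
noncomputable abbrev frames (k : ℕ) (V : Type v) [AddCommGroup V] [Module ℂ V] : FunSpace.{v} :=
  (vec (Fin k → V)).sub {v : Fin k → V | LinearIndependent ℂ v}

/-- The span of a frame. -/
noncomputable def frameSpan (v : {v : Fin k → V // LinearIndependent ℂ v}) : grass k V :=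
  (⟨Submodule.span ℂ (Set.range v.1), by
    simpa using finrank_span_eq_card (R := ℂ) (b := v.1) v.2⟩ :
      {U : Submodule ℂ V // Module.finrank ℂ U = k})

theorem frameSpan_space (v : {v : Fin k → V // LinearIndependent ℂ v}) :
    grass.space (frameSpan v) = Submodule.span ℂ (Set.range v.1) := rfl

theorem finrank_space (U : grass k V) : Module.finrank ℂ (grass.space U) = k := U.2

@[ext]
theorem grass_ext {U U' : grass k V} (h : grass.space U = grass.space U') : U = U' := Subtype.ext h

/-- The point of the Grassmannian that a subspace defines. -/
def grass.mk (U : Submodule ℂ V) (h : Module.finrank ℂ U = k) : grass k V :=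
  (⟨U, h⟩ : {U : Submodule ℂ V // Module.finrank ℂ U = k})

@[simp]
theorem grass.space_mk (U : Submodule ℂ V) (h : Module.finrank ℂ U = k) :
    grass.space (grass.mk U h) = U := rfl

theorem grass_isOpen {O : Set (grass k V)} :
    IsOpen O ↔ @IsOpen (frames k V) _ {v | frameSpan v ∈ O} := isOpen_coinduced

theorem grass_reg {U : grass k V} {f : grass k V → ℂ} : f ∈ (grass k V).reg U ↔
    ∃ O : Set (grass k V), IsOpen O ∧ U ∈ O ∧
      ∀ v, frameSpan v ∈ O → (fun v => f (frameSpan v)) ∈ (frames k V).reg v := by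
  constructor
  · rintro ⟨O, h1, h2, h3⟩
    exact ⟨O, grass_isOpen.2 h1, h2, h3⟩
  · rintro ⟨O, h1, h2, h3⟩
    exact ⟨O, grass_isOpen.1 h1, h2, h3⟩

theorem isMorphism_frameSpan : IsMorphism (frames k V) (grass k V) frameSpan := by
  refine ⟨continuous_def.2 fun O hO => grass_isOpen.1 hO, fun v f hf => ?_⟩
  obtain ⟨O, h1, h2, h3⟩ := grass_reg.1 hf
  exact h3 v h2

variable [FiniteDimensional ℂ V]

theorem exists_frame (U : grass k V) : ∃ v, frameSpan v = U := by
  have hk := finrank_space U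
  let b := (Module.finBasis ℂ (grass.space U)).reindex (finCongr hk)
  have hv : LinearIndependent ℂ ((grass.space U).subtype ∘ b) :=
    b.linearIndependent.map' _ (Submodule.ker_subtype _)
  refine ⟨⟨(grass.space U).subtype ∘ b, hv⟩, grass_ext ?_⟩
  rw [frameSpan_space, Set.range_comp, ← Submodule.map_span, b.span_eq, Submodule.map_top,
    Submodule.range_subtype]

/-- A family of `k`-dimensional subspaces that has a regular frame near `x`. -/
def RegFamAt (X : FunSpace.{u}) (k : ℕ) (K : X → Submodule ℂ V) (x : X) : Prop :=
  ∃ u : X → Fin k → V, RegAt X u x ∧ LinearIndependent ℂ (u x) ∧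
    ∀ᶠ y in 𝓝 x, Submodule.span ℂ (Set.range (u y)) = K y

/-- The subspaces that have a basis dual to `B`. -/
def dualChart (B : V →ₗ[ℂ] (Fin k → ℂ)) : Set (grass k V) :=
  {U | ∃ v : Fin k → V, B ∘ₗ tupleMap _ V v = LinearMap.id ∧
    Submodule.span ℂ (Set.range v) = grass.space U}

open Classical in
/-- The basis of `U` dual to `B`. -/
noncomputable def dualFrame (B : V →ₗ[ℂ] (Fin k → ℂ)) (U : grass k V) : Fin k → V :=
  if h : U ∈ dualChart B then h.choose else 0

theorem comp_dualFrame {B : V →ₗ[ℂ] (Fin k → ℂ)} {U : grass k V} (h : U ∈ dualChart B) :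
    B ∘ₗ tupleMap _ V (dualFrame B U) = LinearMap.id := by
  rw [dualFrame, dif_pos h]
  exact h.choose_spec.1

theorem span_dualFrame {B : V →ₗ[ℂ] (Fin k → ℂ)} {U : grass k V} (h : U ∈ dualChart B) :
    Submodule.span ℂ (Set.range (dualFrame B U)) = grass.space U := by
  rw [dualFrame, dif_pos h]
  exact h.choose_spec.2

/-- `B` restricts to an isomorphism on `U`, so the basis of `U` dual to `B` is determined. -/
theorem dualFrame_unique {B : V →ₗ[ℂ] (Fin k → ℂ)} {U : grass k V} {v : Fin k → V}
    (hv : B ∘ₗ tupleMap _ V v = LinearMap.id)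
    (hs : Submodule.span ℂ (Set.range v) = grass.space U) : dualFrame B U = v := by
  have h : U ∈ dualChart B := ⟨v, hv, hs⟩
  ext i
  have h1 : dualFrame B U i ∈ LinearMap.range (tupleMap _ V v) := by
    rw [range_tupleMap, hs, ← span_dualFrame h]
    exact Submodule.subset_span ⟨i, rfl⟩
  obtain ⟨c, hc⟩ := h1
  have h2 := LinearMap.congr_fun (comp_dualFrame h) (Pi.single i 1)
  have h3 := LinearMap.congr_fun hv c
  simp only [LinearMap.comp_apply, tupleMap_single, LinearMap.id_apply] at h2 h3
  rw [← hc, h3] at h2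
  rw [← hc, h2, tupleMap_single]

theorem tupleMap_comp {ι κ : Type*} [Finite ι] [Finite κ] [DecidableEq κ] (v : ι → V)
    (A : (κ → ℂ) →ₗ[ℂ] (ι → ℂ)) :
    tupleMap _ V (fun i => tupleMap _ V v (A (Pi.single i 1))) = tupleMap _ V v ∘ₗ A := by
  refine (Pi.basisFun ℂ κ).ext fun i => ?_
  rw [Pi.basisFun_apply, tupleMap_single]
  rfl

/-- Any frame becomes the dual frame after a change of basis by the inverse of the matrix `B ∘ v`.
The dual frame is thus a rational function of the frame. -/
theorem dualFrame_frameSpan (B : V →ₗ[ℂ] (Fin k → ℂ)) (v : {v : Fin k → V // LinearIndependent ℂ v})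
    (hv : LinearMap.det (B ∘ₗ tupleMap _ V v.1) ≠ 0) :
    frameSpan v ∈ dualChart B ∧ dualFrame B (frameSpan v) =
      fun i => tupleMap _ V v.1 (Ring.inverse (B ∘ₗ tupleMap _ V v.1) (Pi.single i 1)) := by
  have h1 : B ∘ₗ tupleMap _ V (fun i => tupleMap _ V v.1
      (Ring.inverse (B ∘ₗ tupleMap _ V v.1) (Pi.single i 1))) = LinearMap.id := by
    rw [tupleMap_comp]
    exact LinearMap.ext fun d => apply_inverse_apply hv d
  have h2 : Submodule.span ℂ (Set.range fun i => tupleMap _ V v.1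
      (Ring.inverse (B ∘ₗ tupleMap _ V v.1) (Pi.single i 1))) = grass.space (frameSpan v) := by
    rw [frameSpan_space, ← range_tupleMap, tupleMap_comp, LinearMap.range_comp, ← range_tupleMap,
      LinearMap.range_eq_top.2, Submodule.map_top]
    intro c
    exact ⟨_, inverse_apply_apply hv c⟩
  exact ⟨⟨_, h1, h2⟩, dualFrame_unique h1 h2⟩

/-- In terms of frames the chart is the nonvanishing locus of a minor; its openness follows. -/
theorem frameSpan_mem_dualChart (B : V →ₗ[ℂ] (Fin k → ℂ))
    (v : {v : Fin k → V // LinearIndependent ℂ v}) :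
    frameSpan v ∈ dualChart B ↔ LinearMap.det (B ∘ₗ tupleMap _ V v.1) ≠ 0 := by
  refine ⟨fun h => ?_, fun h => (dualFrame_frameSpan B v h).1⟩
  rw [det_ne_zero_iff_injective, LinearMap.injective_iff_surjective]
  intro c
  have h1 : tupleMap _ V (dualFrame B (frameSpan v)) c ∈ LinearMap.range (tupleMap _ V v.1) := by
    rw [range_tupleMap, ← frameSpan_space, ← span_dualFrame h, ← range_tupleMap]
    exact ⟨c, rfl⟩
  obtain ⟨d, hd⟩ := h1
  exact ⟨d, by
    rw [LinearMap.comp_apply, hd]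
    exact LinearMap.congr_fun (comp_dualFrame h) c⟩

theorem regAt_frames_val (v : frames k V) :
    RegAt (frames k V) (fun v : {v : Fin k → V // LinearIndependent ℂ v} => v.1) v :=
  morphAt_vec.1 (morphAt_val v)

theorem isOpen_dualChart (B : V →ₗ[ℂ] (Fin k → ℂ)) : IsOpen (dualChart B : Set (grass k V)) := by
  rw [grass_isOpen]
  refine isOpen_iff_mem_nhds.2 fun v hv => ?_
  have h : LinearMap.det (B ∘ₗ tupleMap _ V _) ≠ 0 := (frameSpan_mem_dualChart B v).1 hv
  have h1 : RegAt (frames k V)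
      (fun v : {v : Fin k → V // LinearIndependent ℂ v} => B ∘ₗ tupleMap _ V v.1) v :=
    (regAt_const B v).lcomp ((regAt_frames_val v).linear _)
  exact (eventually_ne h1.det h).mono fun w hw => (frameSpan_mem_dualChart B w).2 hw

/-- Regularity on the quotient is regularity of the pull-back to frames, where the explicit formula
with the inverse matrix applies. -/
theorem regAt_dualFrame {B : V →ₗ[ℂ] (Fin k → ℂ)} {U : grass k V} (hU : U ∈ dualChart B) :
    RegAt (grass k V) (dualFrame B) U := by
  intro l
  rw [grass_reg]
  refine ⟨dualChart B, isOpen_dualChart B, hU, fun v hv => ?_⟩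
  have h : LinearMap.det (B ∘ₗ tupleMap _ V _) ≠ 0 := (frameSpan_mem_dualChart B v).1 hv
  have h0 := (regAt_frames_val v).linear (tupleMap (Fin k) V)
  have h1 : RegAt (frames k V)
      (fun v : {v : Fin k → V // LinearIndependent ℂ v} => B ∘ₗ tupleMap _ V v.1) v :=
    RegAt.lcomp (regAt_const (X := frames k V) B v) h0
  have h2 : RegAt (frames k V) (fun v : {v : Fin k → V // LinearIndependent ℂ v} => fun i =>
      tupleMap _ V v.1 (Ring.inverse (B ∘ₗ tupleMap _ V v.1) (Pi.single i 1))) v :=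
    regAt_pi.2 fun i => h0.apply ((h1.ringInverse h).apply (regAt_const (X := frames k V) _ v))
  refine (h2.congr ?_ : RegAt (frames k V) (fun v => dualFrame B (frameSpan v)) v) l
  filter_upwards [eventually_ne h1.det h] with w hw
  exact (dualFrame_frameSpan B w hw).2.symm

theorem exists_mem_dualChart (U : grass k V) : ∃ B, U ∈ dualChart B := by
  obtain ⟨v, rfl⟩ := exists_frame U
  obtain ⟨B, hB⟩ := (tupleMap _ V v.1).exists_leftInverse_of_injective
    (LinearMap.ker_eq_bot.2 ((linearIndependent_iff_tupleMap _).1 v.2))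
  exact ⟨B, (frameSpan_mem_dualChart B v).2 (by simp [hB])⟩

theorem linearIndependent_dualFrame {B : V →ₗ[ℂ] (Fin k → ℂ)} {U : grass k V}
    (h : U ∈ dualChart B) : LinearIndependent ℂ (dualFrame B U) := by
  rw [linearIndependent_iff_tupleMap]
  refine Function.LeftInverse.injective (g := B) fun c => ?_
  exact LinearMap.congr_fun (comp_dualFrame h) c

variable {X : FunSpace.{u}} {Y : FunSpace.{w}}

theorem regFamAt_space (U : grass k V) : RegFamAt (grass k V) k grass.space U := by
  obtain ⟨B, hB⟩ := exists_mem_dualChart U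
  exact ⟨dualFrame B, regAt_dualFrame hB, linearIndependent_dualFrame hB,
    ((isOpen_dualChart B).eventually_mem hB).mono fun U' h => span_dualFrame h⟩

theorem RegFamAt.comp {K : Y → Submodule ℂ V} {g : X → Y} {x : X} (h : RegFamAt Y k K (g x))
    (hg : MorphAt X Y g x) : RegFamAt X k (fun y => K (g y)) x := by
  obtain ⟨u, h1, h2, h3⟩ := h
  exact ⟨fun y => u (g y), h1.comp hg, h2, hg.1.eventually h3⟩

theorem RegFamAt.eventually_finrank {K : X → Submodule ℂ V} {x : X} (h : RegFamAt X k K x) :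
    ∀ᶠ y in 𝓝 x, Module.finrank ℂ (K y) = k := by
  obtain ⟨u, h1, h2, h3⟩ := h
  filter_upwards [h3, eventually_linearIndependent h1 h2] with y hy hli
  rw [← hy, finrank_span_eq_card hli, Fintype.card_fin]

/-- The working description of morphisms to the Grassmannian. The dual charts provide frames of the
tautological family; conversely a regular frame lifts the map to the space of frames near `x`. -/
theorem morphAt_grass {φ : X → grass k V} {x : X} :
    MorphAt X (grass k V) φ x ↔ RegFamAt X k (fun y => grass.space (φ y)) x := by
  refine ⟨fun h => (regFamAt_space (φ x)).comp h, ?_⟩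
  rintro ⟨u, h1, h2, h3⟩
  -- A global lift to frames: equal to `u y` wherever `u y` is a frame of `φ y`, and an arbitrary
  -- frame elsewhere.
  have hex : ∀ y, ∃ v : {v : Fin k → V // LinearIndependent ℂ v}, frameSpan v = φ y ∧
      (LinearIndependent ℂ (u y) → Submodule.span ℂ (Set.range (u y)) = grass.space (φ y) →
        v.1 = u y) := by
    intro y
    by_cases hy : LinearIndependent ℂ (u y) ∧
      Submodule.span ℂ (Set.range (u y)) = grass.space (φ y)
    · exact ⟨⟨u y, hy.1⟩, grass_ext hy.2, fun _ _ => rfl⟩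
    · obtain ⟨v, hv⟩ := exists_frame (φ y)
      exact ⟨v, hv, fun a b => absurd ⟨a, b⟩ hy⟩
  choose g hg hgu using hex
  have hm : MorphAt X (frames k V) g x := by
    refine morphAt_sub.2 (morphAt_vec.2 (h1.congr ?_))
    filter_upwards [h3, eventually_linearIndependent h1 h2] with y hy hli
    exact (hgu y hli hy).symm
  have : φ = frameSpan ∘ g := funext fun y => (hg y).symm
  rw [this]
  exact (isMorphism_frameSpan.morphAt (g x)).comp hm

/-- The span of a regular tuple is a regular family if its dimension is constant. -/
theorem regFamAt_span {ι : Type*} [Finite ι] {K : X → Submodule ℂ V} {u : X → ι → V} {x : X}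
    (hu : RegAt X u x) (hK : ∀ᶠ y in 𝓝 x, Submodule.span ℂ (Set.range (u y)) = K y)
    (hk : ∀ᶠ y in 𝓝 x, Module.finrank ℂ (K y) = k) : RegFamAt X k K x := by
  have hs := hK.self_of_nhds
  -- Indices that give a basis at `x` stay independent nearby, and the constant dimension makes them
  -- span there as well.
  obtain ⟨s, hsu, hss, hsl⟩ := exists_linearIndependent ℂ (Set.range (u x))
  have hcard : Nat.card s = k := by
    have : Finite s := (Set.finite_range (u x)).subset hsu
    have := Fintype.ofFinite s
    have h := finrank_span_eq_card hsl
    rw [Subtype.range_coe, hss, hs, hk.self_of_nhds] at h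
    rw [Nat.card_eq_fintype_card, h]
  have : Finite s := (Set.finite_range (u x)).subset hsu
  let e : Fin k ≃ s := (Finite.equivFinOfCardEq hcard).symm
  choose f hf using fun i : Fin k => hsu (e i).2
  have hr : RegAt X (fun y i => u y (f i)) x := regAt_pi.2 fun i => regAt_pi.1 hu (f i)
  have hl : LinearIndependent ℂ (fun i => u x (f i)) := by
    have : (fun i => u x (f i)) = (Subtype.val : s → V) ∘ e := funext hf
    rw [this]
    exact hsl.comp _ e.injective
  refine ⟨fun y i => u y (f i), hr, hl, ?_⟩
  filter_upwards [eventually_linearIndependent hr hl, hK, hk] with y h1 h2 h3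
  apply Submodule.eq_of_le_of_finrank_eq
  · rw [← h2]
    exact Submodule.span_mono (by rintro _ ⟨i, rfl⟩; exact ⟨_, rfl⟩)
  · rw [finrank_span_eq_card h1, h3, Fintype.card_fin]

/-- The image of a regular family under a regular linear map, if its dimension is constant. -/
theorem RegFamAt.map {W : Type*} [AddCommGroup W] [Module ℂ W] [FiniteDimensional ℂ W] {d : ℕ}
    {K : X → Submodule ℂ V} {A : X → V →ₗ[ℂ] W} {x : X} (hK : RegFamAt X k K x)
    (hA : RegAt X A x) (hd : ∀ᶠ y in 𝓝 x, Module.finrank ℂ ((K y).map (A y)) = d) :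
    RegFamAt X d (fun y => (K y).map (A y)) x := by
  obtain ⟨u, h1, h2, h3⟩ := hK
  refine regFamAt_span (u := fun y i => A y (u y i))
    (regAt_pi.2 fun i => hA.apply (regAt_pi.1 h1 i)) (h3.mono fun y hy => ?_) hd
  rw [← hy, Submodule.map_span, ← Set.range_comp]
  rfl

theorem RegFamAt.sup {k' d : ℕ} {K K' : X → Submodule ℂ V} {x : X} (hK : RegFamAt X k K x)
    (hK' : RegFamAt X k' K' x) (hd : ∀ᶠ y in 𝓝 x, Module.finrank ℂ ↥(K y ⊔ K' y) = d) :
    RegFamAt X d (fun y => K y ⊔ K' y) x := by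
  obtain ⟨u, h1, h2, h3⟩ := hK
  obtain ⟨u', h1', h2', h3'⟩ := hK'
  refine regFamAt_span (u := fun y => Sum.elim (u y) (u' y)) (regAt_pi.2 ?_) ?_ hd
  · rintro (i | i)
    exacts [regAt_pi.1 h1 i, regAt_pi.1 h1' i]
  · filter_upwards [h3, h3'] with y hy hy'
    rw [Set.Sum.elim_range, Submodule.span_union, hy, hy']

/-- The incidence condition `A (K y) ≤ K' y` is closed. -/
theorem isClosed_map_le {V' : Type*} [AddCommGroup V'] [Module ℂ V'] [FiniteDimensional ℂ V']
    {k' : ℕ} {K : X → Submodule ℂ V} {K' : X → Submodule ℂ V'} (A : V →ₗ[ℂ] V')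
    (hK : ∀ x, RegFamAt X k K x) (hK' : ∀ x, RegFamAt X k' K' x) :
    IsClosed {x | (K x).map A ≤ K' x} := by
  rw [← isOpen_compl_iff, isOpen_iff_mem_nhds]
  intro x hx
  obtain ⟨u, h1, -, h3⟩ := hK x
  obtain ⟨u', h1', h2', h3'⟩ := hK' x
  obtain ⟨B, hB⟩ := (tupleMap _ V' (u' x)).exists_leftInverse_of_injective
    (LinearMap.ker_eq_bot.2 ((linearIndependent_iff_tupleMap _).1 h2'))
  have hC : RegAt X (fun y => B ∘ₗ tupleMap _ V' (u' y)) x :=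
    (regAt_const B x).lcomp (h1'.linear _)
  have hdet : LinearMap.det (B ∘ₗ tupleMap _ V' (u' x)) ≠ 0 := by simp [hB]
  have hinv := hC.ringInverse hdet
  -- the projection onto `K' y`
  have hP : RegAt X (fun y => tupleMap _ V' (u' y) ∘ₗ
      (Ring.inverse (B ∘ₗ tupleMap _ V' (u' y)) ∘ₗ B)) x :=
    (h1'.linear _).lcomp (hinv.lcomp (regAt_const B x))
  have hP1 : ∀ y, LinearMap.det (B ∘ₗ tupleMap _ V' (u' y)) ≠ 0 →
      Submodule.span ℂ (Set.range (u' y)) = K' y → ∀ v, v ∈ K' y ↔ (tupleMap _ V' (u' y) ∘ₗ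
      (Ring.inverse (B ∘ₗ tupleMap _ V' (u' y)) ∘ₗ B)) v = v := by
    intro y hy hs v
    rw [← hs, ← range_tupleMap]
    constructor
    · rintro ⟨c, rfl⟩
      exact congrArg (tupleMap _ V' (u' y)) (inverse_apply_apply hy c)
    · intro h
      exact ⟨_, h⟩
  obtain ⟨i, hi⟩ : ∃ i, A (u x i) ∉ K' x := by
    by_contra! h
    apply hx
    show (K x).map A ≤ K' x
    rw [← h3.self_of_nhds, Submodule.map_span, Submodule.span_le]
    rintro _ ⟨_, ⟨i, rfl⟩, rfl⟩
    exact h i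
  have hv := ((regAt_pi.1 h1 i).linear A)
  rw [hP1 x hdet h3'.self_of_nhds] at hi
  have hD := (hP.apply hv).sub hv
  -- For the projection `P` onto `K' y`, membership means `P v = v`. A functional that detects `P v
  -- - v` at `x` turns failure of the inclusion into the nonvanishing of one regular function, an
  -- open condition.
  obtain ⟨l, hl⟩ : ∃ l : Module.Dual ℂ V', l ((tupleMap _ V' (u' x) ∘ₗ
      (Ring.inverse (B ∘ₗ tupleMap _ V' (u' x)) ∘ₗ B)) (A (u x i)) - A (u x i)) ≠ 0 := by
    by_contra! h
    exact hi (sub_eq_zero.1 ((Module.forall_dual_apply_eq_zero_iff ℂ _).1 h))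
  filter_upwards [eventually_ne (hD l) hl, eventually_ne hC.det hdet, h3, h3'] with y e1 e2 e3 e4 h
  apply e1
  have : A (u y i) ∈ K' y := h ⟨_, by rw [← e3]; exact Submodule.subset_span ⟨i, rfl⟩, rfl⟩
  rw [hP1 y e2 e4] at this
  rw [this, sub_self, map_zero]

/-- The rank of a linear map on a regular family can only drop on closed sets. -/
theorem isOpen_le_finrank_map {V' : Type*} [AddCommGroup V'] [Module ℂ V'] [FiniteDimensional ℂ V']
    {K : X → Submodule ℂ V} (A : V →ₗ[ℂ] V') (hK : ∀ x, RegFamAt X k K x) (r : ℕ) :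
    IsOpen {x | r ≤ Module.finrank ℂ ((K x).map A)} := by
  rw [isOpen_iff_mem_nhds]
  intro x hx
  -- Take `r` independent vectors of `A (K x)`, write preimages in the frame `u x`, and keep the
  -- coordinates while the frame moves: independence persists near `x`.
  obtain ⟨b, hb⟩ := exists_linearIndependent_of_le_finrank (R := ℂ) (n := r) hx
  obtain ⟨u, h1, -, h3⟩ := hK x
  choose a ha ha' using fun i => (b i).2
  have : ∀ i, ∃ c, tupleMap _ V (u x) c = a i := fun i => by
    have := ha i
    rw [← h3.self_of_nhds, SetLike.mem_coe, ← range_tupleMap] at this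
    exact this
  choose c hc using this
  have hr : RegAt X (fun y i => A (tupleMap _ V (u y) (c i))) x := regAt_pi.2 fun i =>
    ((h1.linear (tupleMap _ V)).apply (regAt_const (c i) x)).linear A
  have hl : LinearIndependent ℂ (fun i => A (tupleMap _ V (u x) (c i))) := by
    simp only [hc, ha']
    exact hb.map' _ (Submodule.ker_subtype _)
  filter_upwards [eventually_linearIndependent hr hl, h3] with y hy hy'
  have hle : Submodule.span ℂ (Set.range fun i => A (tupleMap _ V (u y) (c i))) ≤ (K y).map A := by
    rw [Submodule.span_le]
    rintro _ ⟨i, rfl⟩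
    refine ⟨_, ?_, rfl⟩
    rw [← hy', SetLike.mem_coe, ← range_tupleMap]
    exact ⟨_, rfl⟩
  have := Submodule.finrank_mono hle
  rwa [finrank_span_eq_card hy, Fintype.card_fin] at this

end Grass

end FunSpace

namespace FunSpace

universe u v w

set_option linter.unusedSectionVars false

/-! ### Affine space: irreducibility and dimension -/

section AffineSpace

/-- Affine space. -/
noncomputable abbrev aff (n : ℕ) : FunSpace.{0} := vec (Fin n → ℂ)

variable {n : ℕ} {X : FunSpace.{u}}

theorem eval_reg {c : X → Fin n → ℂ} {x : X} (hc : RegAt X c x) (p : MvPolynomial (Fin n) ℂ) :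
    (fun y => MvPolynomial.eval (c y) p) ∈ X.reg x := by
  induction p using MvPolynomial.induction_on with
  | C a => simpa using const_reg x a
  | add p q hp hq =>
    simp only [map_add]
    exact add_mem hp hq
  | mul_X p i hp =>
    simp only [map_mul, MvPolynomial.eval_X]
    exact mul_mem hp (regAt_complex.1 (regAt_pi.1 hc i))

theorem exists_mvPolynomial {b : Set (Set (Fin n → ℂ) × ((Fin n → ℂ) → ℂ))}
    (hb : b ⊆ {p | ∃ l : Module.Dual ℂ (Fin n → ℂ), p = (Set.univ, fun v => l v)})
    {h : (Fin n → ℂ) → ℂ} (hh : h ∈ polys b) :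
    ∃ p : MvPolynomial (Fin n) ℂ, ∀ v, h v = MvPolynomial.eval v p := by
  induction hh using Algebra.adjoin_induction with
  | mem h hp =>
    obtain ⟨p, hp, rfl⟩ := hp
    obtain ⟨l, rfl⟩ := hb hp
    refine ⟨∑ i, MvPolynomial.C (l (Pi.single i 1)) * MvPolynomial.X i, fun v => ?_⟩
    conv_lhs => rw [← (Pi.basisFun ℂ (Fin n)).sum_repr v]
    simp [mul_comm]
  | algebraMap r => exact ⟨MvPolynomial.C r, fun v => by simp⟩
  | add p q _ _ hp hq =>
    obtain ⟨p', hp⟩ := hp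
    obtain ⟨q', hq⟩ := hq
    exact ⟨p' + q', fun v => by simp [hp, hq]⟩
  | mul p q _ _ hp hq =>
    obtain ⟨p', hp⟩ := hp
    obtain ⟨q', hq⟩ := hq
    exact ⟨p' * q', fun v => by simp [hp, hq]⟩

theorem aff_nhds {x : Fin n → ℂ} {A : Set (Fin n → ℂ)} (hA : A ∈ @nhds (aff n) _ x) :
    ∃ p : MvPolynomial (Fin n) ℂ, MvPolynomial.eval x p ≠ 0 ∧
      ∀ v, MvPolynomial.eval v p ≠ 0 → v ∈ A := by
  obtain ⟨V, hV, hVo, hx⟩ := mem_nhds_iff.1 hA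
  obtain ⟨b, hbL, hbf, hxb, q, hq, hqx, hb⟩ := hVo x hx
  obtain ⟨p, hp⟩ := exists_mvPolynomial hbL hq
  refine ⟨p, by rwa [← hp], fun v hv => hV (hb v ?_ (by rwa [hp]))⟩
  intro q hq
  obtain ⟨l, rfl⟩ := hbL hq
  trivial

theorem aff_reg {x : Fin n → ℂ} {f : (Fin n → ℂ) → ℂ} (hf : f ∈ (aff n).reg x) :
    ∃ p q : MvPolynomial (Fin n) ℂ, MvPolynomial.eval x q ≠ 0 ∧
      ∀ v, MvPolynomial.eval v q ≠ 0 → f v = MvPolynomial.eval v p / MvPolynomial.eval v q := by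
  obtain ⟨b, hbL, hbf, hxb, p, hp, q, hq, hqx, h⟩ := hf
  obtain ⟨p', hp'⟩ := exists_mvPolynomial hbL hp
  obtain ⟨q', hq'⟩ := exists_mvPolynomial hbL hq
  refine ⟨p', q', by rwa [← hq'], fun v hv => ?_⟩
  rw [h v ?_ (by rwa [hq']), hp', hq']
  intro q hq
  obtain ⟨l, rfl⟩ := hbL hq
  trivial

theorem eventually_eval_ne (x : Fin n → ℂ) (p : MvPolynomial (Fin n) ℂ)
    (h : MvPolynomial.eval x p ≠ 0) :
    ∀ᶠ v in @nhds (aff n) _ x, MvPolynomial.eval (show Fin n → ℂ from v) p ≠ 0 :=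
  eventually_ne (X := aff n) (eval_reg (X := aff n) (regAt_id x) p) h

/-- Nonempty open sets contain nonvanishing loci of nonzero polynomials. The product of two such
polynomials is nonzero, hence nonzero somewhere because `ℂ` is infinite. -/
instance : IrreducibleSpace (aff n) where
  toNonempty := ⟨(0 : Fin n → ℂ)⟩
  isPreirreducible_univ := by
    rintro U V hU hV ⟨x, -, hx⟩ ⟨y, -, hy⟩
    obtain ⟨p, hp, hpU⟩ := aff_nhds (hU.mem_nhds hx)
    obtain ⟨q, hq, hqV⟩ := aff_nhds (hV.mem_nhds hy)
    have hpq : p * q ≠ 0 := by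
      apply mul_ne_zero <;> rintro rfl <;> simp at hp hq
    obtain ⟨v, hv⟩ : ∃ v, MvPolynomial.eval v (p * q) ≠ 0 := by
      by_contra! h
      exact hpq (MvPolynomial.funext fun v => by simpa using h v)
    rw [map_mul] at hv
    exact ⟨v, trivial, hpU v (left_ne_zero_of_mul hv), hqV v (right_ne_zero_of_mul hv)⟩

/-- Vanishing ideals embed the irreducible closed sets, with order reversed, into the spectrum of a
polynomial ring of dimension `n`. Strictness needs no Nullstellensatz: a point outside a closed set
is separated from it by a polynomial. -/
theorem topologicalKrullDim_aff_le : topologicalKrullDim (aff n) ≤ n := by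
  have h := MvPolynomial.ringKrullDim_of_isNoetherianRing (R := ℂ) (ι := Fin n)
  rw [ringKrullDim_eq_zero_of_field, Nat.card_eq_fintype_card, Fintype.card_fin, zero_add] at h
  rw [← h, ringKrullDim, ← Order.krullDim_orderDual, topologicalKrullDim]
  let I : TopologicalSpace.IrreducibleCloseds (aff n) → (PrimeSpectrum (MvPolynomial (Fin n) ℂ))ᵒᵈ :=
    fun Z => OrderDual.toDual ⟨MvPolynomial.vanishingIdeal ℂ (K := ℂ) Z.carrier, by
      refine Ideal.isPrime_iff.2 ⟨fun h => ?_, fun {p q} hpq => ?_⟩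
      · obtain ⟨x, hx⟩ := Z.isIrreducible.nonempty
        have : (1 : MvPolynomial (Fin n) ℂ) ∈ MvPolynomial.vanishingIdeal ℂ (K := ℂ)
          Z.carrier := h ▸ Submodule.mem_top
        simpa using this x hx
      · by_contra! hne
        obtain ⟨hp, hq⟩ := hne
        obtain ⟨x, hx, hpx⟩ : ∃ x ∈ Z.carrier, MvPolynomial.aeval (show Fin n → ℂ from x) p ≠ 0 := by
          by_contra! h
          exact hp h
        obtain ⟨y, hy, hqy⟩ : ∃ x ∈ Z.carrier, MvPolynomial.aeval (show Fin n → ℂ from x) q ≠ 0 := by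
          by_contra! h
          exact hq h
        have ho : ∀ p : MvPolynomial (Fin n) ℂ,
            @IsOpen (aff n) _ {v : Fin n → ℂ | MvPolynomial.aeval v p ≠ 0} := fun p =>
          isOpen_iff_mem_nhds.2 fun v hv => eventually_eval_ne v p hv
        obtain ⟨z, hz, hz1, hz2⟩ := Z.isIrreducible.isPreirreducible _ _ (ho p) (ho q)
          ⟨x, hx, hpx⟩ ⟨y, hy, hqy⟩
        have := hpq z hz
        rw [map_mul] at this
        exact mul_ne_zero hz1 hz2 this⟩
  refine Order.krullDim_le_of_strictMono I fun Z Z' hlt => ?_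
  refine lt_of_le_of_ne (MvPolynomial.vanishingIdeal_anti_mono hlt.le) fun heq => hlt.not_ge ?_
  intro x hx
  by_contra hxZ
  obtain ⟨p, hp, hpZ⟩ := aff_nhds (Z.isClosed.isOpen_compl.mem_nhds hxZ)
  have h1 : p ∈ MvPolynomial.vanishingIdeal ℂ (K := ℂ) Z.carrier := by
    intro v hv
    by_contra hne
    exact hpZ v (by simpa using hne) hv
  have h2 : MvPolynomial.vanishingIdeal ℂ (K := ℂ) Z.carrier =
      MvPolynomial.vanishingIdeal ℂ (K := ℂ) Z'.carrier :=
    congrArg PrimeSpectrum.asIdeal (OrderDual.toDual_inj.1 heq)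
  rw [h2] at h1
  exact hp (h1 x hx)

theorem isClosed_eq_of_reg {f g : X → ℂ} (hf : ∀ x, f ∈ X.reg x) (hg : ∀ x, g ∈ X.reg x) :
    IsClosed {x | f x = g x} := by
  rw [← isOpen_compl_iff, isOpen_iff_mem_nhds]
  intro x hx
  filter_upwards [eventually_ne (sub_mem (hf x) (hg x)) (sub_ne_zero.2 hx)] with y hy
  exact sub_ne_zero.1 hy

/-- A nonempty open subset of affine `n`-space has dimension at least `n`. -/
theorem le_topologicalKrullDim_open {V : Set (aff n)} (hV : IsOpen V) (hne : V.Nonempty) :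
    (n : WithBot ℕ∞) ≤ topologicalKrullDim V := by
  obtain ⟨x, hx⟩ := hne
  have hcoord : ∀ (j : Fin n) (v : aff n), (fun v : Fin n → ℂ => v j) ∈ (aff n).reg v :=
    fun j v => regAt_complex.1 (regAt_pi.1 (regAt_id (E := Fin n → ℂ) v) j)
  let x' : Fin n → ℂ := x
  -- `g i` keeps the first `i` coordinates and replaces the others by those of `x`: a retraction
  -- onto the coordinate subspace `S i` through `x`.
  let g : ℕ → (Fin n → ℂ) → (Fin n → ℂ) := fun i v j => if (j : ℕ) < i then v j else x' j
  have hg : ∀ i, IsMorphism (aff n) (aff n) (g i) := fun i =>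
    isMorphism_iff.2 fun v => morphAt_vec.2 (regAt_pi.2 fun j => by
      by_cases h : (j : ℕ) < i
      · simp only [g, h, if_true]
        exact regAt_complex.2 (hcoord j v)
      · simp only [g, h, if_false]
        exact regAt_const _ _)
  have hgx : ∀ i, g i x' = x' := fun i => funext fun j => by simp [g]
  let S : ℕ → Set (aff n) := fun i => {v : Fin n → ℂ | ∀ j : Fin n, i ≤ j → v j = x' j}
  have hS : ∀ i, IsClosed (S i) := fun i => by
    have : S i = ⋂ j : Fin n, ⋂ _ : i ≤ j, {v : aff n | (show Fin n → ℂ from v) j = x' j} := by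
      ext v; simp only [S, Set.mem_iInter]; rfl
    rw [this]
    exact isClosed_iInter fun j => isClosed_iInter fun _ =>
      isClosed_eq_of_reg (hcoord j) fun v => const_reg v _
  -- As the image of a nonempty open subset of affine space, `S i ∩ V` is irreducible.
  have hSV : ∀ i, S i ∩ V = g i '' (g i ⁻¹' V) := fun i => by
    ext v
    constructor
    · rintro ⟨h1, h2⟩
      have : g i v = v := funext fun j => by
        by_cases h : (j : ℕ) < i
        · simp [g, h]
        · simp only [g, h, if_false]
          exact (h1 j (by omega)).symm
      exact ⟨v, show g i v ∈ V by rw [this]; exact h2, this⟩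
    · rintro ⟨w, hw, rfl⟩
      exact ⟨fun j hj => by simp [g, not_lt.2 hj], hw⟩
  have hirr : ∀ i, IsIrreducible (S i ∩ V) := fun i => by
    rw [hSV]
    refine IsIrreducible.image (X := aff n) ⟨⟨x', show g i x' ∈ V by rw [hgx]; exact hx⟩, ?_⟩ _
      (hg i).1.continuousOn
    exact (PreirreducibleSpace.isPreirreducible_univ (X := aff n)).open_subset
      (hV.preimage (hg i).1) (Set.subset_univ _)
  let Z : Fin (n + 1) → TopologicalSpace.IrreducibleCloseds V := fun i =>
    { carrier := Subtype.val ⁻¹' S i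
      isIrreducible' := by
        refine ⟨⟨⟨x, hx⟩, fun j _ => rfl⟩, ?_⟩
        have := (hirr i).isPreirreducible.preimage hV.isOpenEmbedding_subtypeVal
        convert this using 1
        ext v
        exact ⟨fun h => ⟨h, v.2⟩, fun h => h.1⟩
      isClosed' := (hS i).preimage continuous_subtype_val }
  have hZ : StrictMono Z := by
    rw [Fin.strictMono_iff_lt_succ]
    intro i
    refine lt_of_le_of_ne ?_ ?_
    · intro v hv j hj
      exact hv j (le_trans (by simp) hj)
    · intro heq
      have hO : IsOpen {v : aff n | (show Fin n → ℂ from v) i ≠ x' i} :=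
        (isClosed_eq_of_reg (hcoord i) fun v => const_reg v (x' i)).isOpen_compl
      -- By irreducibility some `v` has `g (i + 1) v ∈ V` and `i`-th coordinate different from that
      -- of `x`; then `g (i + 1) v` separates the two members of the chain.
      obtain ⟨v, -, hv1, hv2⟩ := (PreirreducibleSpace.isPreirreducible_univ (X := aff n)) _ _
        (hV.preimage (hg (i + 1)).1) hO ⟨x, trivial, show g (i + 1) x' ∈ V by rw [hgx]; exact hx⟩
        ⟨(fun j => x' j + 1 : Fin n → ℂ), trivial, show x' i + 1 ≠ x' i by simp⟩
      have h1 : (⟨g (i + 1) v, hv1⟩ : V) ∈ Z i.succ := fun j hj => by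
        have : ¬ (j : ℕ) < i + 1 := by simpa using hj
        simp [g, this]
      rw [← heq] at h1
      have h2 := h1 i (by simp)
      simp [g] at h2
      exact hv2 h2
  exact Order.LTSeries.length_le_krullDim ⟨n, Z, fun i => hZ (Fin.castSucc_lt_succ (i := i))⟩

end AffineSpace

end FunSpace

namespace FunSpace

universe u v w

set_option linter.unusedSectionVars false

/-! ### Spaces locally isomorphic to affine space -/

section Charts

variable {X : FunSpace.{u}} {Y : FunSpace.{v}} {n m : ℕ}

/-- Near `x`, the space `X` is isomorphic to an open subset of the vector space `E`. -/
def HasChartAt (X : FunSpace.{u}) (E : Type w) [AddCommGroup E] [Module ℂ E] (x : X) : Prop :=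
  ∃ (c : X → E) (d : E → X) (U : Set X) (V : Set E), IsOpen U ∧ x ∈ U ∧ @IsOpen (vec E) _ V ∧
    (∀ y ∈ U, c y ∈ V ∧ d (c y) = y ∧ RegAt X c y) ∧
    ∀ v : E, v ∈ V → d v ∈ U ∧ c (d v) = v ∧ MorphAt (vec E) X d v

/-- `X` is locally isomorphic to open subsets of affine `n`-space. -/
def LocallyAffine (X : FunSpace.{u}) (n : ℕ) : Prop := ∀ x, HasChartAt X (Fin n → ℂ) x

theorem isMorphism_linearMap {E F : Type*} [AddCommGroup E] [Module ℂ E] [AddCommGroup F]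
    [Module ℂ F] (A : E →ₗ[ℂ] F) : IsMorphism (vec E) (vec F) (fun e : E => A e) :=
  isMorphism_iff.2 fun e => morphAt_vec.2 ((regAt_id (E := E) e).linear A)

theorem HasChartAt.congr_linearEquiv {E F : Type*} [AddCommGroup E] [Module ℂ E]
    [AddCommGroup F] [Module ℂ F] (e : E ≃ₗ[ℂ] F) {x : X} (h : HasChartAt X E x) :
    HasChartAt X F x := by
  obtain ⟨c, d, U, V, hU, hx, hV, h1, h2⟩ := h
  refine ⟨fun y => e (c y), fun f => d (e.symm f), U, (fun f : F => e.symm f) ⁻¹' V, hU, hx,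
    hV.preimage (isMorphism_linearMap e.symm.toLinearMap).1, fun y hy => ?_, fun f hf => ?_⟩
  · obtain ⟨a, b, c⟩ := h1 y hy
    exact ⟨by simpa using a, by simpa using b, c.linear e.toLinearMap⟩
  · obtain ⟨a, b, c⟩ := h2 _ hf
    exact ⟨a, by simp [b], c.comp ((isMorphism_linearMap e.symm.toLinearMap).morphAt f)⟩

theorem LocallyAffine.of_hasChartAt {E : Type*} [AddCommGroup E] [Module ℂ E]
    [FiniteDimensional ℂ E] (hE : Module.finrank ℂ E = n) (h : ∀ x, HasChartAt X E x) :
    LocallyAffine X n := fun x =>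
  (h x).congr_linearEquiv (LinearEquiv.ofFinrankEq E (Fin n → ℂ) (by simp [hE]))

theorem HasChartAt.prod {E F : Type*} [AddCommGroup E] [Module ℂ E]
    [AddCommGroup F] [Module ℂ F] {x : X} {y : Y} (hx : HasChartAt X E x) (hy : HasChartAt Y F y) :
    HasChartAt (X.prod Y) (E × F) (x, y) := by
  obtain ⟨c, d, U, V, hU, hx, hV, h1, h2⟩ := hx
  obtain ⟨c', d', U', V', hU', hy, hV', h1', h2'⟩ := hy
  have hfst : IsMorphism (vec (E × F)) (vec E) (Prod.fst : E × F → E) :=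
    isMorphism_linearMap (LinearMap.fst ℂ E F)
  have hsnd : IsMorphism (vec (E × F)) (vec F) (Prod.snd : E × F → F) :=
    isMorphism_linearMap (LinearMap.snd ℂ E F)
  refine ⟨fun z : X × Y => (c z.1, c' z.2), fun v => (d v.1, d' v.2),
    {z : X × Y | z.1 ∈ U ∧ z.2 ∈ U'}, {z : E × F | z.1 ∈ V ∧ z.2 ∈ V'},
    (hU.preimage isMorphism_fst.1).inter (hU'.preimage isMorphism_snd.1), ⟨hx, hy⟩,
    (hV.preimage hfst.1).inter (hV'.preimage hsnd.1), ?_, ?_⟩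
  · rintro ⟨z, z'⟩ ⟨hz, hz'⟩
    obtain ⟨a1, a2, a3⟩ := h1 z hz
    obtain ⟨b1, b2, b3⟩ := h1' z' hz'
    exact ⟨⟨a1, b1⟩, Prod.ext a2 b2, regAt_prod
      (a3.comp (isMorphism_fst.morphAt (X := X.prod Y) ((z, z') : X × Y)))
      (b3.comp (isMorphism_snd.morphAt (X := X.prod Y) ((z, z') : X × Y)))⟩
  · rintro ⟨z, z'⟩ ⟨hz, hz'⟩
    obtain ⟨a1, a2, a3⟩ := h2 z hz
    obtain ⟨b1, b2, b3⟩ := h2' z' hz'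
    exact ⟨⟨a1, b1⟩, Prod.ext a2 b2, morphAt_prod.2
      ⟨a3.comp (hfst.morphAt (X := vec (E × F)) ((z, z') : E × F)),
        b3.comp (hsnd.morphAt (X := vec (E × F)) ((z, z') : E × F))⟩⟩

theorem LocallyAffine.prod (hX : LocallyAffine X n) (hY : LocallyAffine Y m) :
    LocallyAffine (X.prod Y) (n + m) :=
  LocallyAffine.of_hasChartAt (E := (Fin n → ℂ) × (Fin m → ℂ)) (by simp)
    fun z : X × Y => (hX z.1).prod (hY z.2)

theorem isOpen_morphAt_preimage {φ : X → Y} {U : Set X} {T : Set Y} (hU : IsOpen U)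
    (hT : IsOpen T) (h : ∀ x ∈ U, MorphAt X Y φ x) : IsOpen {x | x ∈ U ∧ φ x ∈ T} :=
  isOpen_iff_mem_nhds.2 fun x hx => Filter.inter_mem (hU.mem_nhds hx.1)
    ((h x hx.1).1 (hT.mem_nhds hx.2))

theorem LocallyAffine.sub_open (hX : LocallyAffine X n) {T : Set X} (hT : IsOpen T) :
    LocallyAffine (X.sub T) n := by
  classical
  rintro ⟨x, hxT⟩
  obtain ⟨c, d, U, V, hU, hx, hV, h1, h2⟩ := hX x
  -- Where `d` leaves `T` the base point is used as a junk value; the new chart domain excludes this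
  -- locus.
  let d' : (Fin n → ℂ) → T := fun v => if h : d v ∈ T then ⟨d v, h⟩ else ⟨x, hxT⟩
  have hd' : ∀ v, d v ∈ T → (d' v).1 = d v := fun v hv => by simp [d', hv]
  have hV' := isOpen_morphAt_preimage (X := aff n) hV hT fun v hv => (h2 v hv).2.2
  refine ⟨fun y : T => c y.1, d', (Subtype.val : T → X) ⁻¹' U, {v | v ∈ V ∧ d v ∈ T},
    hU.preimage isMorphism_val.1, hx, hV', ?_, ?_⟩
  · rintro ⟨y, hyT⟩ hy
    obtain ⟨a1, a2, a3⟩ := h1 y hy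
    have hdT : d (c y) ∈ T := by rwa [a2]
    exact ⟨⟨a1, hdT⟩, Subtype.ext ((hd' _ hdT).trans a2),
      a3.comp (morphAt_val (X := X) (S := T) ⟨y, hyT⟩)⟩
  · rintro v ⟨hv, hvT⟩
    obtain ⟨a1, a2, a3⟩ := h2 v hv
    refine ⟨show (d' v).1 ∈ U by rwa [hd' v hvT], (congrArg c (hd' v hvT)).trans a2, morphAt_sub.2 ?_⟩
    refine a3.congr ?_
    filter_upwards [hV'.mem_nhds ⟨hv, hvT⟩] with w hw
    exact (hd' w hw.2).symm

theorem LocallyAffine.of_isIso (hY : LocallyAffine Y n) {φ : X → Y} (hφ : IsIso X Y φ) :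
    LocallyAffine X n := by
  obtain ⟨hφ, ψ, hψ, h3, h4⟩ := hφ
  have h3 : ∀ x, ψ (φ x) = x := congrFun h3
  have h4 : ∀ x, φ (ψ x) = x := congrFun h4
  intro x
  obtain ⟨c, d, U, V, hU, hx, hV, h1, h2⟩ := hY (φ x)
  refine ⟨fun y => c (φ y), fun v => ψ (d v), φ ⁻¹' U, V, hU.preimage hφ.1, hx, hV,
    fun y hy => ?_, fun v hv => ?_⟩
  · obtain ⟨a1, a2, a3⟩ := h1 _ hy
    exact ⟨a1, (congrArg ψ a2).trans (h3 y), a3.comp (hφ.morphAt y)⟩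
  · obtain ⟨a1, a2, a3⟩ := h2 _ hv
    exact ⟨show φ (ψ (d v)) ∈ U by rwa [h4], (congrArg c (h4 _)).trans a2, (hψ.morphAt _).comp a3⟩

theorem LocallyAffine.of_open_cover
    (h : ∀ x : X, ∃ T : Set X, IsOpen T ∧ x ∈ T ∧ LocallyAffine (X.sub T) n) :
    LocallyAffine X n := by
  intro x
  obtain ⟨T, hT, hxT, h⟩ := h x
  obtain ⟨c, d, U, V, hU, hx, hV, h1, h2⟩ := h ⟨x, hxT⟩
  classical
  let c' : X → Fin n → ℂ := fun y => if h : y ∈ T then c ⟨y, h⟩ else 0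
  have hc' : ∀ y : T, c' y.1 = c y := fun y => by simp [c']
  obtain ⟨B, hB, rfl⟩ := sub_isOpen.1 hU
  refine ⟨c', fun v => (show T from d v).1, B ∩ T, V, hB.inter hT, ⟨hx, hxT⟩, hV, ?_, ?_⟩
  · rintro y ⟨hyB, hyT⟩
    obtain ⟨a1, a2, a3⟩ := h1 ⟨y, hyT⟩ hyB
    rw [← hc'] at a1 a2
    refine ⟨a1, congrArg Subtype.val a2, morphAt_vec.1 ((morphAt_sub_open hT (x := ⟨y, hyT⟩)).1 ?_)⟩
    refine morphAt_vec.2 ?_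
    have : (fun y : T => c' y.1) = c := funext hc'
    rw [this]
    exact a3
  · intro v hv
    obtain ⟨a1, a2, a3⟩ := h2 v hv
    exact ⟨⟨a1, (show T from d v).2⟩, (hc' _).trans a2, (morphAt_val (d v)).comp a3⟩

end Charts

/-! ### Dimension of locally affine spaces -/

section Dimension

variable {X : FunSpace.{u}} {n : ℕ}

/-- All members of a chain of irreducible closed sets contain any point of the smallest one, so they
meet a chart domain around it. Intersecting with this open set keeps the chain strict, and the chart
domain embeds in affine space. -/
theorem LocallyAffine.topologicalKrullDim_le (hX : LocallyAffine X n) :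
    topologicalKrullDim X ≤ n := by
  rw [topologicalKrullDim, Order.krullDim]
  refine iSup_le fun p => ?_
  obtain ⟨x, hx⟩ := p.head.isIrreducible.nonempty
  obtain ⟨c, d, U, V, hU, hxU, hV, h1, h2⟩ := hX x
  let V' : Set (aff n) := V
  let c' : X → aff n := c
  let d' : aff n → X := d
  have hco : Continuous (fun y : U => c' y.1) := continuous_iff_continuousAt.2 fun y =>
    (morphAt_vec.2 (h1 y.1 y.2).2.2).1.comp continuous_subtype_val.continuousAt
  -- The chart followed by its inverse is the inclusion of `U`, which is inducing; hence so is the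
  -- chart.
  have hind : Topology.IsInducing (fun y : U => c' y.1) := by
    have hcomp : Topology.IsInducing
        ((fun v : V' => d' v.1) ∘ fun y : U => (⟨c' y.1, (h1 y.1 y.2).1⟩ : V')) := by
      have : ((fun v : V' => d' v.1) ∘ fun y : U => (⟨c' y.1, (h1 y.1 y.2).1⟩ : V')) =
          Subtype.val := funext fun y => (h1 y.1 y.2).2.1
      rw [this]
      exact Topology.IsInducing.subtypeVal
    exact Topology.IsInducing.subtypeVal.comp (Topology.IsInducing.of_comp
      (hco.subtype_mk _) (continuous_iff_continuousAt.2 fun v =>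
        (h2 v.1 v.2).2.2.1.comp (f := Subtype.val) continuous_subtype_val.continuousAt) hcomp)
  have hdim : Order.krullDim (TopologicalSpace.IrreducibleCloseds U) ≤ n :=
    hind.topologicalKrullDim_le.trans topologicalKrullDim_aff_le
  rw [Order.krullDim_eq_of_orderIso (TopologicalSpace.IrreducibleCloseds.orderIsoOfIsOpenEmbedding
    _ hU.isOpenEmbedding_subtypeVal)] at hdim
  have hmem : ∀ i, ((Subtype.val : U → X) ⁻¹' (p i : Set X)).Nonempty := fun i =>
    ⟨⟨x, hxU⟩, p.head_le i hx⟩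
  let q : LTSeries {Z : TopologicalSpace.IrreducibleCloseds X |
      ((Subtype.val : U → X) ⁻¹' (Z : Set X)).Nonempty} :=
    ⟨p.length, fun i => ⟨p i, hmem i⟩, fun i => p.step i⟩
  exact le_trans (Order.LTSeries.length_le_krullDim q) hdim

/-- The inverse chart embeds a nonempty open piece of affine space in `O`. -/
theorem LocallyAffine.le_topologicalKrullDim_open (hX : LocallyAffine X n) {O : Set X}
    (hO : IsOpen O) (hne : O.Nonempty) : (n : WithBot ℕ∞) ≤ topologicalKrullDim O := by
  obtain ⟨x, hx⟩ := hne
  obtain ⟨c, d, U, V, hU, hxU, hV, h1, h2⟩ := hX x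
  let c' : X → aff n := c
  let d' : aff n → X := d
  let V' : Set (aff n) := {v | v ∈ V ∧ d' v ∈ O}
  have hV' : IsOpen V' := isOpen_morphAt_preimage hV hO fun v hv => (h2 v hv).2.2
  have hxV : c' x ∈ V' := ⟨(h1 x hxU).1, show d (c x) ∈ O by rw [(h1 x hxU).2.1]; exact hx⟩
  refine (FunSpace.le_topologicalKrullDim_open hV' ⟨_, hxV⟩).trans ?_
  let f : V' → O := fun v => ⟨d' v.1, v.2.2⟩
  have hf : Continuous f := Continuous.subtype_mk (continuous_iff_continuousAt.2 fun v =>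
    (h2 v.1 v.2.1).2.2.1.comp (f := Subtype.val) continuous_subtype_val.continuousAt) _
  refine Topology.IsInducing.topologicalKrullDim_le (f := f) ⟨?_⟩
  refine le_antisymm hf.le_induced ?_
  intro A hA
  obtain ⟨B, hB, rfl⟩ := isOpen_induced_iff.1 hA
  refine isOpen_induced_iff.2 ⟨{y | y.1 ∈ U ∧ c' y.1 ∈ B}, ?_, ?_⟩
  · exact (isOpen_morphAt_preimage (Y := aff n) hU hB fun y hy =>
      morphAt_vec.2 (h1 y hy).2.2).preimage continuous_subtype_val
  · ext v
    have hv := h2 v.1 v.2.1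
    have : c' (d' v.1) = v.1 := hv.2.1
    constructor
    · rintro ⟨-, h⟩
      show v.1 ∈ B
      rw [← this]
      exact h
    · intro h
      exact ⟨hv.1, show c' (d' v.1) ∈ B by rw [this]; exact h⟩

theorem LocallyAffine.topologicalKrullDim_open (hX : LocallyAffine X n) {O : Set X}
    (hO : IsOpen O) (hne : O.Nonempty) : topologicalKrullDim O = n :=
  le_antisymm ((topologicalKrullDim_subspace_le X O).trans hX.topologicalKrullDim_le)
    (hX.le_topologicalKrullDim_open hO hne)

theorem LocallyAffine.topologicalKrullDim_eq (hX : LocallyAffine X n) [h : Nonempty X] :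
    topologicalKrullDim X = n :=
  le_antisymm hX.topologicalKrullDim_le ((hX.le_topologicalKrullDim_open isOpen_univ
    Set.univ_nonempty).trans (topologicalKrullDim_subspace_le X _))

theorem LocallyAffine.localDim_eq (hX : LocallyAffine X n) (x : X) : X.localDim x = n := by
  have : Nonempty {U : Set X // IsOpen U ∧ x ∈ U} := ⟨⟨Set.univ, isOpen_univ, trivial⟩⟩
  rw [localDim, iInf_congr fun U : {U : Set X // IsOpen U ∧ x ∈ U} =>
    hX.topologicalKrullDim_open U.2.1 ⟨x, U.2.2⟩, ciInf_const]

end Dimension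

/-! ### Tangent spaces and smoothness -/

section Tangent

variable {X : FunSpace.{u}} {n : ℕ}

/-- Elements of `reg x` are functions on all of `X`, not germs. A derivation still sees only the
germ: if `e` is the indicator of `f ≠ 0`, then `f = f * e` with both factors zero at `x`. -/
theorem tangent_eq_zero {x : X} {D : X.reg x →ₗ[ℂ] ℂ} (hD : D ∈ X.zariskiTangent x)
    {f : X → ℂ} (hf : f ∈ X.reg x) (h0 : ∀ᶠ y in 𝓝 x, f y = 0) : D ⟨f, hf⟩ = 0 := by
  classical
  let e : X → ℂ := fun y => if f y = 0 then 0 else 1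
  have he0 : ∀ᶠ y in 𝓝 x, e y = 0 := h0.mono fun y hy => by simp [e, hy]
  have he : e ∈ X.reg x := reg_of_eventuallyEq (he0.mono fun y hy => hy.symm) (zero_mem _)
  have hfe : (⟨f, hf⟩ : X.reg x) = ⟨f, hf⟩ * ⟨e, he⟩ := by
    ext y
    by_cases hy : f y = 0 <;> simp [e, hy]
  rw [hfe, hD]
  simp [h0.self_of_nhds, he0.self_of_nhds]

theorem tangent_congr {x : X} {D : X.reg x →ₗ[ℂ] ℂ} (hD : D ∈ X.zariskiTangent x)
    {f g : X → ℂ} (hf : f ∈ X.reg x) (hg : g ∈ X.reg x) (h : ∀ᶠ y in 𝓝 x, f y = g y) :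
    D ⟨f, hf⟩ = D ⟨g, hg⟩ := by
  rw [← sub_eq_zero, ← map_sub]
  exact tangent_eq_zero hD (sub_mem hf hg) (h.mono fun y hy => sub_eq_zero.2 hy)

theorem tangent_const {x : X} {D : X.reg x →ₗ[ℂ] ℂ} (hD : D ∈ X.zariskiTangent x) (c : ℂ) :
    D (algebraMap ℂ _ c) = 0 := by
  have h1 : D 1 = 0 := by
    have := hD 1 1
    simp only [mul_one] at this
    have h : D 1 = D 1 + D 1 := by simpa using this
    simpa using h
  rw [Algebra.algebraMap_eq_smul_one, map_smul, h1, smul_zero]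

theorem tangent_eval {x : X} {D : X.reg x →ₗ[ℂ] ℂ} (hD : D ∈ X.zariskiTangent x)
    {c : X → Fin n → ℂ} (hc : RegAt X c x)
    (h0 : ∀ i, D ⟨fun y => c y i, regAt_complex.1 (regAt_pi.1 hc i)⟩ = 0)
    (p : MvPolynomial (Fin n) ℂ) : D ⟨fun y => MvPolynomial.eval (c y) p, eval_reg hc p⟩ = 0 := by
  induction p using MvPolynomial.induction_on with
  | C a =>
    simp only [MvPolynomial.eval_C]
    exact tangent_const hD a
  | add p q hp hq =>
    have : (⟨fun y => MvPolynomial.eval (c y) (p + q), eval_reg hc (p + q)⟩ : X.reg x) =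
        ⟨_, eval_reg hc p⟩ + ⟨_, eval_reg hc q⟩ := by
      ext y; simp
    rw [this, map_add, hp, hq, add_zero]
  | mul_X p i hp =>
    have : (⟨fun y => MvPolynomial.eval (c y) (p * MvPolynomial.X i), eval_reg hc _⟩ : X.reg x) =
        ⟨_, eval_reg hc p⟩ * ⟨fun y => c y i, regAt_complex.1 (regAt_pi.1 hc i)⟩ := by
      ext y; simp
    rw [this, hD, hp, h0, mul_zero, mul_zero, add_zero]

/-- Along a line a regular function is a rational function of one variable whose denominator does
not vanish at `0`. -/
theorem differentiableAt_line {x w : Fin n → ℂ} {f : (Fin n → ℂ) → ℂ} (hf : f ∈ (aff n).reg x) :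
    DifferentiableAt ℂ (fun s : ℂ => f (x + s • w)) 0 := by
  obtain ⟨p, q, hq, hfpq⟩ := aff_reg hf
  have hpol : ∀ p : MvPolynomial (Fin n) ℂ,
      Differentiable ℂ (fun s : ℂ => MvPolynomial.eval (x + s • w) p) := by
    intro p
    induction p using MvPolynomial.induction_on with
    | C a => simp
    | add p q hp hq =>
      simp only [map_add]
      exact hp.add hq
    | mul_X p i hp =>
      simp only [map_mul, MvPolynomial.eval_X, Pi.add_apply, Pi.smul_apply, smul_eq_mul]
      exact hp.mul (by fun_prop)
  have hq0 : MvPolynomial.eval (x + (0 : ℂ) • w) q ≠ 0 := by simpa using hq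
  refine ((hpol p 0).div (hpol q 0) hq0).congr_of_eventuallyEq ?_
  filter_upwards [(hpol q).continuous.continuousAt.eventually_ne hq0] with s hs
  exact hfpq _ hs

/-- The tangent space of a space that is locally affine has the expected dimension. -/
theorem LocallyAffine.isSmooth (hX : LocallyAffine X n) : IsSmooth X := by
  intro x
  rw [hX.localDim_eq x]
  obtain ⟨c, d, U, V, hU, hxU, hV, h1, h2⟩ := hX x
  obtain ⟨hcV, hdc, hc⟩ := h1 x hxU
  obtain ⟨-, -, hd⟩ := h2 _ hcV
  have hci : ∀ i, (fun y => c y i) ∈ X.reg x := fun i => regAt_complex.1 (regAt_pi.1 hc i)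
  have hfd : ∀ f ∈ X.reg x, f ∘ d ∈ (aff n).reg (c x) := fun f hf =>
    hd.2 f (by rwa [hdc])
  -- A derivation is recorded by its values on the `n` chart coordinates; this is shown to be an
  -- isomorphism.
  let Φ : X.zariskiTangent x →ₗ[ℂ] (Fin n → ℂ) :=
    { toFun := fun D i => D.1 ⟨_, hci i⟩
      map_add' := fun _ _ => rfl
      map_smul' := fun _ _ => rfl }
  have hinj : Function.Injective Φ := by
    rw [injective_iff_map_eq_zero]
    rintro ⟨D, hD⟩ h0
    have h0 : ∀ i, D ⟨fun y => c y i, hci i⟩ = 0 := congrFun h0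
    ext f
    obtain ⟨f, hf⟩ := f
    obtain ⟨p, q, hq, hpq⟩ := aff_reg (hfd f hf)
    have hp' := tangent_eval hD hc h0 p
    have hq' := tangent_eval hD hc h0 q
    -- Near `x` one has `f * q(c) = p(c)`. If `D` kills the coordinates it kills `p(c)` and `q(c)`,
    -- so only `q(c x) * D f = 0` is left.
    have hmul : D (⟨f, hf⟩ * ⟨_, eval_reg hc q⟩) = D ⟨_, eval_reg hc p⟩ := by
      refine tangent_congr hD (mul_mem hf (eval_reg hc q)) (eval_reg hc p) ?_
      filter_upwards [hU.mem_nhds hxU, eventually_ne (eval_reg hc q) hq] with y hy hqy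
      have := hpq (c y) hqy
      simp only [Function.comp, (h1 y hy).2.1] at this
      rw [Pi.mul_apply, this, div_mul_cancel₀ _ hqy]
    rw [hD, hp', hq', mul_zero, zero_add] at hmul
    exact (mul_eq_zero.1 hmul).resolve_left hq
  have hdiff : ∀ (w : Fin n → ℂ) (f : X.reg x),
      DifferentiableAt ℂ (fun s : ℂ => f.1 (d (c x + s • w))) 0 := fun w f =>
    differentiableAt_line (hfd f.1 f.2)
  have hsurj : Function.Surjective Φ := by
    intro w
    -- The derivation with prescribed values `w` is the complex derivative along the line through `c
    -- x` in direction `w`.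
    let D : X.reg x →ₗ[ℂ] ℂ :=
      { toFun := fun f => deriv (fun s : ℂ => f.1 (d (c x + s • w))) 0
        map_add' := fun f g => deriv_add (hdiff w f) (hdiff w g)
        map_smul' := fun a f => deriv_const_mul a (hdiff w f) }
    refine ⟨⟨D, fun f g => ?_⟩, funext fun i => ?_⟩
    · have := deriv_mul (hdiff w f) (hdiff w g)
      simp only [zero_smul, add_zero, hdc] at this
      refine Eq.trans this ?_
      rw [add_comm, mul_comm (deriv _ _)]
      rfl
    -- The line stays in the Zariski open set `V` for small `s`, since `V` contains the nonvanishing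
    -- locus of a polynomial, and that is open in the usual topology.
    · obtain ⟨p, hp, hpV⟩ := aff_nhds (hV.mem_nhds hcV)
      have hpol : Continuous (fun s : ℂ => MvPolynomial.eval (c x + s • w) p) :=
        (MvPolynomial.continuous_eval p).comp (by fun_prop)
      have : deriv (fun s : ℂ => c (d (c x + s • w)) i) 0 = deriv (fun s : ℂ => c x i + s * w i) 0 := by
        refine Filter.EventuallyEq.deriv_eq ?_
        filter_upwards [hpol.continuousAt.eventually_ne (by simpa using hp)] with s hs
        rw [(h2 _ (hpV _ hs)).2.1]
        rfl
      refine Eq.trans this ?_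
      simp
  let e := LinearEquiv.ofBijective Φ ⟨hinj, hsurj⟩
  exact ⟨Module.Finite.equiv e.symm, by rw [e.finrank_eq]; simp⟩

end Tangent

/-! ### Charts and irreducibility of the Grassmannian -/

section GrassChart

variable {V : Type v} [AddCommGroup V] [Module ℂ V] [FiniteDimensional ℂ V] {k : ℕ}

/-- The Grassmannian is locally isomorphic to an affine space. -/
theorem grass_locallyAffine (k : ℕ) (V : Type v) [AddCommGroup V] [Module ℂ V]
    [FiniteDimensional ℂ V] {r : ℕ} (hr : k + r = Module.finrank ℂ V) :
    LocallyAffine (grass k V) (k * r) := by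
  intro U₀
  obtain ⟨B, hB⟩ := exists_mem_dualChart U₀
  set v₀ := dualFrame B U₀ with hv₀
  -- `s` splits `B` with image `U₀`, so `V = U₀ ⊕ ker B`. The subspaces in the chart are the graphs
  -- of linear maps `U₀ → ker B`, and `k` vectors of `ker B` serve as coordinates.
  let s : (Fin k → ℂ) →ₗ[ℂ] V := tupleMap _ V v₀
  have hBs : ∀ c, B (s c) = c := fun c => LinearMap.congr_fun (comp_dualFrame hB) c
  have hsurj : LinearMap.range B = ⊤ := LinearMap.range_eq_top.2 fun c => ⟨s c, hBs c⟩
  have hker : Module.finrank ℂ (LinearMap.ker B) = r := by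
    have := B.finrank_range_add_finrank_ker
    rw [hsurj, finrank_top, Module.finrank_fin_fun] at this
    omega
  let P : V →ₗ[ℂ] LinearMap.ker B := LinearMap.codRestrict _ (LinearMap.id - s ∘ₗ B) fun v => by
    simp [hBs]
  have hP : ∀ v, (P v : V) = v - s (B v) := fun v => rfl
  let E := Fin k → LinearMap.ker B
  refine HasChartAt.congr_linearEquiv (E := E)
    (LinearEquiv.ofFinrankEq E (Fin (k * r) → ℂ) (by simp [E, Module.finrank_pi_fintype, hker])) ?_
  let t : E → Fin k → V := fun w i => v₀ i + (w i : V)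
  have ht : ∀ w, B ∘ₗ tupleMap _ V (t w) = LinearMap.id := fun w => by
    refine (Pi.basisFun ℂ (Fin k)).ext fun i => ?_
    rw [Pi.basisFun_apply, LinearMap.comp_apply, tupleMap_single, map_add, (w i).2, add_zero,
      LinearMap.id_apply]
    have := hBs (Pi.single i 1)
    rwa [tupleMap_single] at this
  have hli : ∀ w, LinearIndependent ℂ (t w) := fun w => by
    rw [linearIndependent_iff_tupleMap]
    exact Function.LeftInverse.injective (g := B) fun c => LinearMap.congr_fun (ht w) c
  let d : E → grass k V := fun w => frameSpan ⟨t w, hli w⟩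
  have hdmem : ∀ w, d w ∈ dualChart B := fun w => ⟨t w, ht w, rfl⟩
  have hdframe : ∀ w, dualFrame B (d w) = t w := fun w => dualFrame_unique (ht w) rfl
  have hBd : ∀ U ∈ dualChart B, ∀ i, B (dualFrame B U i) = Pi.single i 1 := fun U hU i => by
    have := LinearMap.congr_fun (comp_dualFrame hU) (Pi.single i 1)
    rwa [LinearMap.comp_apply, tupleMap_single] at this
  refine ⟨fun U i => P (dualFrame B U i), d, dualChart B, Set.univ, isOpen_dualChart B, hB,
    isOpen_univ, fun U hU => ⟨trivial, ?_, ?_⟩, fun (w : E) _ => ⟨hdmem w, ?_, ?_⟩⟩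
  · apply grass_ext
    rw [← span_dualFrame hU]
    show Submodule.span ℂ (Set.range (t _)) = _
    congr 2
    ext i
    simp only [t, hP, hBd U hU, s, tupleMap_single]
    abel
  · exact regAt_pi.2 fun i => (regAt_pi.1 (regAt_dualFrame hU) i).linear P
  · ext i
    show (P (dualFrame B (d w) i) : V) = w i
    rw [hdframe, hP]
    have hBt : B (t w i) = Pi.single i 1 := by rw [← hdframe]; exact hBd _ (hdmem w) i
    rw [hBt]
    simp only [s, tupleMap_single, t]
    abel
  · let f : vec E → frames k V := fun w : E => (⟨t w, hli w⟩ : {v : Fin k → V // LinearIndependent ℂ v})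
    refine (isMorphism_frameSpan.morphAt (f w)).comp (φ := f) (morphAt_sub.2 ?_)
    refine morphAt_vec.2 (regAt_pi.2 fun i => (regAt_const (v₀ i) _).add ?_)
    exact (regAt_pi.1 (regAt_id (E := E) w) i).linear (LinearMap.ker B).subtype

theorem irreducibleSpace_of_surjective {X : FunSpace.{u}} {Y : FunSpace.{v}} [IrreducibleSpace X]
    {φ : X → Y} (hφ : Continuous φ) (hs : Function.Surjective φ) : IrreducibleSpace Y where
  toNonempty := (inferInstance : Nonempty X).map φ
  isPreirreducible_univ := by
    rw [← Set.range_eq_univ.2 hs, ← Set.image_univ]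
    exact PreirreducibleSpace.isPreirreducible_univ.image _ hφ.continuousOn

instance vec_irreducibleSpace (E : Type*) [AddCommGroup E] [Module ℂ E] [FiniteDimensional ℂ E] :
    IrreducibleSpace (vec E) :=
  irreducibleSpace_of_surjective (X := aff (Module.finrank ℂ E)) (Y := vec E)
    (isMorphism_linearMap (LinearEquiv.ofFinrankEq (Fin (Module.finrank ℂ E) → ℂ) E
      (by simp)).toLinearMap).1
    (LinearEquiv.ofFinrankEq (Fin (Module.finrank ℂ E) → ℂ) E (by simp)).surjective

/-- The frames form a nonempty open subset of a vector space, and they map onto the Grassmannian. -/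
theorem grass_irreducibleSpace (hk : k ≤ Module.finrank ℂ V) : IrreducibleSpace (grass k V) := by
  have hne : {v : vec (Fin k → V) | LinearIndependent ℂ (show Fin k → V from v)}.Nonempty :=
    exists_linearIndependent_of_le_finrank hk
  have hop : IsOpen {v : vec (Fin k → V) | LinearIndependent ℂ (show Fin k → V from v)} :=
    isOpen_iff_mem_nhds.2 fun v hv => eventually_linearIndependent (regAt_id (E := Fin k → V) v) hv
  have hirr : IsPreirreducible {v : vec (Fin k → V) | LinearIndependent ℂ (show Fin k → V from v)} :=
    (PreirreducibleSpace.isPreirreducible_univ (X := vec (Fin k → V))).open_subset hop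
      (Set.subset_univ _)
  have : IrreducibleSpace (frames k V) :=
    { toNonempty := hne.to_subtype
      isPreirreducible_univ := by
        rintro A A' hA hA' ⟨v, -, hv⟩ ⟨w, -, hw⟩
        obtain ⟨B, hB, rfl⟩ := sub_isOpen.1 hA
        obtain ⟨B', hB', rfl⟩ := sub_isOpen.1 hA'
        obtain ⟨z, hz, hz'⟩ := hirr B B' hB hB' ⟨_, v.2, hv⟩ ⟨_, w.2, hw⟩
        exact ⟨⟨z, hz⟩, trivial, hz'⟩ }
  exact irreducibleSpace_of_surjective (X := frames k V) (φ := frameSpan) isMorphism_frameSpan.1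
    exists_frame

end GrassChart

end FunSpace

namespace FunSpace

universe u v w

set_option linter.unusedSectionVars false

/-! ### Affine varieties, closed subsets and products -/

section Varieties

variable {X : FunSpace.{u}} {Y : FunSpace.{v}}

/-- A coordinate-free criterion, so that spaces of tuples and of families need no identification
with some `ℂⁿ` each time. -/
theorem isAffineVariety_of_closed_embedding {E : Type*} [AddCommGroup E] [Module ℂ E]
    [FiniteDimensional ℂ E] {S : Set E} (hS : @IsClosed (vec E) _ S) {φ : X → E}
    (hφ : ∀ x, RegAt X φ x) (hφS : ∀ x, φ x ∈ S) {ψ : S → X}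
    (hψ : IsMorphism ((vec E).sub S) X ψ) (h1 : ∀ x, ψ ⟨φ x, hφS x⟩ = x)
    (h2 : ∀ s : S, φ (ψ s) = s.1) : IsAffineVariety X := by
  let e : E ≃ₗ[ℂ] (Fin (Module.finrank ℂ E) → ℂ) := LinearEquiv.ofFinrankEq _ _ (by simp)
  let S' : Set (Fin (Module.finrank ℂ E) → ℂ) := {w | e.symm w ∈ S}
  have he : ∀ x, e (φ x) ∈ S' := fun x => by
    show e.symm (e (φ x)) ∈ S
    rw [e.symm_apply_apply]
    exact hφS x
  refine ⟨Module.finrank ℂ E, S', hS.preimage (isMorphism_linearMap e.symm.toLinearMap).1,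
    fun x => (⟨e (φ x), he x⟩ : S'), ?_⟩
  refine IsIso.of_inverse (ψ := fun w : S' => ψ ⟨e.symm w.1, w.2⟩) ?_ ?_ ?_ ?_
  · exact isMorphism_iff.2 fun x => morphAt_sub.2 (morphAt_vec.2 ((hφ x).linear e.toLinearMap))
  · let f : (vec (Fin (Module.finrank ℂ E) → ℂ)).sub S' → (vec E).sub S :=
      fun w : S' => (⟨e.symm w.1, w.2⟩ : S)
    exact isMorphism_iff.2 fun w => (hψ.morphAt (f w)).comp (φ := f) (morphAt_sub.2
      (((isMorphism_linearMap e.symm.toLinearMap).comp isMorphism_val).morphAt w))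
  · intro x
    have : (⟨e.symm (e (φ x)), he x⟩ : S) = ⟨φ x, hφS x⟩ := by simp
    exact (congrArg ψ this).trans (h1 x)
  · intro w
    exact Subtype.ext ((congrArg e (h2 _)).trans (e.apply_symm_apply _))

theorem IsAffineVariety.of_isIso (hY : IsAffineVariety Y) {φ : X → Y} (hφ : IsIso X Y φ) :
    IsAffineVariety X := by
  obtain ⟨n, S, hS, ψ, hψ⟩ := hY
  exact ⟨n, S, hS, ψ ∘ φ, hψ.comp hφ⟩

theorem IsAffineVariety.sub_closed (hX : IsAffineVariety X) {C : Set X} (hC : IsClosed C) :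
    IsAffineVariety (X.sub C) := by
  obtain ⟨n, S, hS, φ, hφ, ψ, hψ, h1, h2⟩ := hX
  have h1 : ∀ x, ψ (φ x) = x := congrFun h1
  have h2 : ∀ x, φ (ψ x) = x := congrFun h2
  obtain ⟨B, hB, hBC⟩ := sub_isClosed.1 (hC.preimage hψ.1)
  have hBC : ∀ s : S, s.1 ∈ B ↔ ψ s ∈ C := fun s => Set.ext_iff.1 hBC s
  refine isAffineVariety_of_closed_embedding (E := Fin n → ℂ) (S := S ∩ B) (hS.inter hB)
    (φ := fun x : C => (show S from φ x.1).1) (ψ := fun s : ↥(S ∩ B) =>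
      (⟨ψ (⟨s.1, s.2.1⟩ : S), (hBC ⟨s.1, s.2.1⟩).1 s.2.2⟩ : C)) ?_ ?_ ?_ ?_ ?_
  · intro x
    exact morphAt_vec.1 (((morphAt_val (φ x.1)).comp (hφ.morphAt x.1)).comp (morphAt_val x))
  · rintro ⟨x, hx⟩
    exact ⟨(show S from φ x).2, (hBC _).2 (by rw [h1]; exact hx)⟩
  · let f : (vec (Fin n → ℂ)).sub (S ∩ B) → (vec (Fin n → ℂ)).sub S :=
      fun s : ↥(S ∩ B) => (⟨s.1, s.2.1⟩ : S)
    exact isMorphism_iff.2 fun s => morphAt_sub.2 ((hψ.morphAt (f s)).comp (φ := f)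
      (morphAt_sub.2 (morphAt_val s)))
  · rintro ⟨x, hx⟩
    exact Subtype.ext (h1 x)
  · rintro ⟨s, hs⟩
    exact congrArg Subtype.val (h2 ⟨s, hs.1⟩)

/-- Lets an affine open cover of `X` be restricted to a closed subset `C`: the piece of `C` in `U`
becomes a closed subset of the affine variety `U`. -/
theorem isIso_sub_sub (C U : Set X) :
    IsIso ((X.sub C).sub ((Subtype.val : C → X) ⁻¹' U)) ((X.sub U).sub ((Subtype.val : U → X) ⁻¹' C))
      (fun x : ↥((Subtype.val : C → X) ⁻¹' U) =>
        (⟨⟨x.1.1, x.2⟩, x.1.2⟩ : ↥((Subtype.val : U → X) ⁻¹' C))) := by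
  refine IsIso.of_inverse (ψ := fun x : ↥((Subtype.val : U → X) ⁻¹' C) =>
        (⟨⟨x.1.1, x.2⟩, x.1.2⟩ : ↥((Subtype.val : C → X) ⁻¹' U))) ?_ ?_ (fun _ => rfl) fun _ => rfl
  · exact isMorphism_iff.2 fun x => morphAt_sub.2 (morphAt_sub.2
      ((morphAt_val (X := X) x.1).comp (morphAt_val x)))
  · exact isMorphism_iff.2 fun x => morphAt_sub.2 (morphAt_sub.2
      ((morphAt_val (X := X) x.1).comp (morphAt_val x)))

theorem isVariety_of_cover {ι : Type*} [Finite ι] (U : ι → Set X)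
    (h : ∀ i, IsOpen (U i) ∧ IsAffineVariety (X.sub (U i))) (hc : ∀ x, ∃ i, x ∈ U i)
    (hs : IsClosed {z : X.prod X | (show X × X from z).1 = (show X × X from z).2}) :
    IsVariety X := by
  obtain ⟨n, ⟨e⟩⟩ := Finite.exists_equiv_fin ι
  refine ⟨⟨n, fun i => U (e.symm i), fun i => h _, fun x => ?_⟩, hs⟩
  obtain ⟨i, hi⟩ := hc x
  exact ⟨e i, by simpa using hi⟩

/-- The locus where two morphisms to a separated space agree is closed. -/
theorem IsVariety.isClosed_eq (hX : IsVariety X) {f g : Y → X} (hf : IsMorphism Y X f)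
    (hg : IsMorphism Y X g) : IsClosed {y | f y = g y} :=
  hX.2.preimage (isMorphism_prod.2 ⟨hf, hg⟩ : IsMorphism Y (X.prod X) fun y => (f y, g y)).1

theorem IsVariety.sub_closed (hX : IsVariety X) {C : Set X} (hC : IsClosed C) :
    IsVariety (X.sub C) := by
  obtain ⟨n, U, hU, hc⟩ := hX.1
  refine isVariety_of_cover (fun i => ((Subtype.val : C → X) ⁻¹' U i)) (fun i => ⟨?_, ?_⟩)
    (fun x => hc x.1) ?_
  · exact (hU i).1.preimage isMorphism_val.1
  · exact ((hU i).2.sub_closed (hC.preimage isMorphism_val.1)).of_isIso (isIso_sub_sub C (U i))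
  · have := hX.isClosed_eq ((isMorphism_val (X := X) (S := C)).comp
      (isMorphism_fst (X := X.sub C) (Y := X.sub C)))
      ((isMorphism_val (X := X) (S := C)).comp (isMorphism_snd (X := X.sub C) (Y := X.sub C)))
    convert this using 1
    ext z
    exact Subtype.ext_iff

theorem IsAffineVariety.pi {ι : Type w} [Finite ι] {X : ι → FunSpace.{u}}
    (hX : ∀ i, IsAffineVariety (X i)) : IsAffineVariety (FunSpace.pi X) := by
  choose n S hS φ hφ ψ hψ h1 h2 using hX
  have h1 : ∀ i x, ψ i (φ i x) = x := fun i => congrFun (h1 i)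
  have h2 : ∀ i x, φ i (ψ i x) = x := fun i => congrFun (h2 i)
  have hproj : ∀ i, IsMorphism (vec (∀ i, Fin (n i) → ℂ)) (vec (Fin (n i) → ℂ))
      (fun v : ∀ i, Fin (n i) → ℂ => v i) := fun i =>
    isMorphism_linearMap (LinearMap.proj (φ := fun i => Fin (n i) → ℂ) i)
  refine isAffineVariety_of_closed_embedding (E := ∀ i, Fin (n i) → ℂ)
    (S := {v | ∀ i, v i ∈ S i}) ?_ (φ := fun (x : ∀ i, X i) i => (show S i from φ i (x i)).1)
    (ψ := fun (s : {v : ∀ i, Fin (n i) → ℂ | ∀ i, v i ∈ S i}) i => ψ i (⟨s.1 i, s.2 i⟩ : S i))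
    ?_ ?_ ?_ ?_ ?_
  · have hc := isClosed_iInter (X := vec (∀ i, Fin (n i) → ℂ)) fun i =>
      (hS i).preimage (hproj i).1
    exact (congrArg (@IsClosed (vec (∀ i, Fin (n i) → ℂ)) _) (Set.ext fun v =>
      ⟨fun h i => Set.mem_iInter.1 h i, fun h => Set.mem_iInter.2 h⟩)).mp hc
  · intro x
    refine (regAt_pi (E := fun i => Fin (n i) → ℂ)).2 fun i => (morphAt_vec (E := Fin (n i) → ℂ)).1 ?_
    have h := ((isMorphism_val (X := vec (Fin (n i) → ℂ)) (S := S i)).comp (hφ i)).comp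
      (isMorphism_eval (X := X) i)
    exact h.morphAt x
  · exact fun x i => (show S i from φ i (x i)).2
  · refine isMorphism_iff.2 fun s => morphAt_pi.2 fun i => ?_
    let f : (vec (∀ i, Fin (n i) → ℂ)).sub {v | ∀ i, v i ∈ S i} → (vec (Fin (n i) → ℂ)).sub (S i) :=
      fun s : {v : ∀ i, Fin (n i) → ℂ | ∀ i, v i ∈ S i} => (⟨s.1 i, s.2 i⟩ : S i)
    exact ((hψ i).morphAt (f s)).comp (φ := f)
      (morphAt_sub.2 (((hproj i).comp isMorphism_val).morphAt s))
  · exact fun x => funext fun i => h1 i (x i)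
  · exact fun s => funext fun i => congrArg Subtype.val (h2 i ⟨s.1 i, s.2 i⟩)

theorem isIso_sub_pi {ι : Type w} {X : ι → FunSpace.{u}} (U : ∀ i, Set (X i)) :
    IsIso ((pi X).sub {x : ∀ i, X i | ∀ i, x i ∈ U i}) (pi fun i => (X i).sub (U i))
      (fun (x : {x : ∀ i, X i | ∀ i, x i ∈ U i}) i => (⟨x.1 i, x.2 i⟩ : U i)) := by
  refine IsIso.of_inverse (ψ := fun x : ∀ i, U i =>
    (⟨fun i => (x i).1, fun i => (x i).2⟩ : {x : ∀ i, X i | ∀ i, x i ∈ U i})) ?_ ?_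
    (fun _ => rfl) fun _ => rfl
  · exact isMorphism_iff.2 fun x => morphAt_pi.2 fun i => morphAt_sub.2
      (((isMorphism_eval i).morphAt _).comp (morphAt_val x))
  · exact isMorphism_iff.2 fun x => morphAt_sub.2 (morphAt_pi.2 fun i => (morphAt_val _).comp
      ((isMorphism_eval (X := fun i => (X i).sub (U i)) i).morphAt x))

theorem IsVariety.pi {ι : Type w} [Finite ι] {X : ι → FunSpace.{u}}
    (hX : ∀ i, IsVariety (X i)) : IsVariety (FunSpace.pi X) := by
  choose n U hU hc using fun i => (hX i).1
  refine isVariety_of_cover (ι := ∀ i, Fin (n i)) (fun c => {x : ∀ i, X i | ∀ i, x i ∈ U i (c i)})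
    (fun c => ⟨?_, ?_⟩) (fun x => ?_) ?_
  · refine isOpen_iff_mem_nhds.2 fun x hx => ?_
    exact eventually_all.2 fun i => ((isMorphism_eval i).1.continuousAt).eventually
      ((hU i (c i)).1.mem_nhds (hx i))
  · exact (IsAffineVariety.pi fun i => (hU i (c i)).2).of_isIso (isIso_sub_pi fun i => U i (c i))
  · choose c hc using fun i => hc i ((show ∀ i, X i from x) i)
    exact ⟨c, hc⟩
  · have : {z : (FunSpace.pi X).prod (FunSpace.pi X) |
        (show FunSpace.pi X × FunSpace.pi X from z).1 = (show FunSpace.pi X × FunSpace.pi X from z).2} =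
        ⋂ i, {z : (FunSpace.pi X).prod (FunSpace.pi X) |
          (show ∀ i, X i from (show FunSpace.pi X × FunSpace.pi X from z).1) i =
          (show ∀ i, X i from (show FunSpace.pi X × FunSpace.pi X from z).2) i} := by
      ext z
      rw [Set.mem_iInter]
      exact funext_iff
    rw [this]
    exact isClosed_iInter fun i => (hX i).isClosed_eq ((isMorphism_eval i).comp isMorphism_fst)
      ((isMorphism_eval i).comp isMorphism_snd)

end Varieties

/-! ### The Grassmannian is a variety -/

section Grass

variable {V : Type v} [AddCommGroup V] [Module ℂ V] [FiniteDimensional ℂ V] {k : ℕ}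

/-- The dual frame identifies the chart with the affine-linear subspace of tuples satisfying `B (v
i) = e_i`. -/
theorem isAffineVariety_dualChart (B : V →ₗ[ℂ] (Fin k → ℂ)) :
    IsAffineVariety ((grass k V).sub (dualChart B)) := by
  let S : Set (Fin k → V) := {v | ∀ i, B (v i) = Pi.single i 1}
  have hS : ∀ v, v ∈ S ↔ B ∘ₗ tupleMap _ V v = LinearMap.id := fun v => by
    constructor
    · intro h
      refine (Pi.basisFun ℂ (Fin k)).ext fun i => ?_
      rw [Pi.basisFun_apply, LinearMap.comp_apply, tupleMap_single, h, LinearMap.id_apply]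
    · intro h i
      have := LinearMap.congr_fun h (Pi.single i 1)
      rwa [LinearMap.comp_apply, tupleMap_single] at this
  have hli : ∀ v ∈ S, LinearIndependent ℂ v := fun v hv => by
    rw [linearIndependent_iff_tupleMap]
    exact Function.LeftInverse.injective (g := B) fun c => LinearMap.congr_fun ((hS v).1 hv) c
  refine isAffineVariety_of_closed_embedding (E := Fin k → V) (S := S) ?_
    (φ := fun U : dualChart B => dualFrame B U.1) ?_ ?_
    (ψ := fun v : S => (⟨frameSpan ⟨v.1, hli _ v.2⟩, ⟨v.1, (hS _).1 v.2, rfl⟩⟩ : dualChart B))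
    ?_ ?_ ?_
  · have : S = ⋂ i, ⋂ j, {v | B (v i) j = (Pi.single i 1 : Fin k → ℂ) j} := by
      ext v
      simp only [Set.mem_iInter]
      exact forall_congr' fun i => funext_iff
    rw [this]
    refine isClosed_iInter (X := vec (Fin k → V)) fun i => isClosed_iInter fun j =>
      isClosed_eq_of_reg (X := vec (Fin k → V)) (fun v => ?_) fun v => const_reg v _
    have h1 := regAt_pi.1 (regAt_id (E := Fin k → V) v) i
    exact regAt_complex.1 (regAt_pi.1 (h1.linear B) j)
  · exact fun U => (regAt_dualFrame U.2).comp (morphAt_val (X := grass k V) U)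
  · exact fun U => (hS _).2 (comp_dualFrame U.2)
  · refine isMorphism_iff.2 fun v => morphAt_sub.2 ?_
    let f : (vec (Fin k → V)).sub S → frames k V := fun v : S =>
      (⟨v.1, hli _ v.2⟩ : {v : Fin k → V // LinearIndependent ℂ v})
    exact (isMorphism_frameSpan.morphAt (f v)).comp (φ := f) (morphAt_sub.2 (morphAt_val v))
  · exact fun U => Subtype.ext (grass_ext (span_dualFrame U.2))
  · exact fun v => dualFrame_unique ((hS _).1 v.2) rfl

theorem isMorphism_grass_id_family {X : FunSpace.{u}} {φ : X → grass k V}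
    (hφ : IsMorphism X (grass k V) φ) (x : X) : RegFamAt X k (fun y => grass.space (φ y)) x :=
  morphAt_grass.1 (hφ.morphAt x)

/-- Finitely many coordinate charts suffice: the coordinate functionals span the dual of `U`, so
some `k` of them restrict to a basis of it. The diagonal is closed because inclusion is a closed
condition, and inclusion between spaces of equal dimension is equality. -/
theorem isVariety_grass (k : ℕ) (V : Type v) [AddCommGroup V] [Module ℂ V]
    [FiniteDimensional ℂ V] : IsVariety (grass k V) := by
  let b := Module.finBasis ℂ V
  let B : (Fin k → Fin (Module.finrank ℂ V)) → V →ₗ[ℂ] (Fin k → ℂ) := fun s =>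
    LinearMap.pi fun i => b.coord (s i)
  refine isVariety_of_cover (fun s => dualChart (B s))
    (fun s => ⟨isOpen_dualChart _, isAffineVariety_dualChart _⟩) (fun U => ?_) ?_
  · let f : Fin (Module.finrank ℂ V) → Module.Dual ℂ (grass.space U) := fun j =>
      (grass.space U).dualRestrict (b.coord j)
    have hf : Submodule.span ℂ (Set.range f) = ⊤ := by
      have h1 : Set.range f = (grass.space U).dualRestrict '' Set.range b.dualBasis := by
        rw [← Set.range_comp]
        congr 1
        ext j : 1
        simp [f]
      rw [h1, ← Submodule.map_span, b.dualBasis.span_eq, Submodule.map_top,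
        LinearMap.range_eq_top]
      exact Subspace.dualRestrict_surjective
    obtain ⟨s, hsu, hss, hsl⟩ := exists_linearIndependent ℂ (Set.range f)
    have hsf : Finite s := (Set.finite_range f).subset hsu
    have hcard : Nat.card s = k := by
      have := Fintype.ofFinite s
      have h := finrank_span_eq_card hsl
      rw [Subtype.range_coe, hss, hf, finrank_top, Subspace.dual_finrank_eq, finrank_space] at h
      exact Nat.card_eq_fintype_card.trans h.symm
    let e : Fin k ≃ s := (Finite.equivFinOfCardEq hcard).symm
    choose σ hσ using fun i : Fin k => hsu (e i).2
    refine ⟨σ, ?_⟩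
    obtain ⟨v, rfl⟩ := exists_frame U
    rw [frameSpan_mem_dualChart, det_ne_zero_iff_injective, injective_iff_map_eq_zero]
    intro c hc
    have hmem : tupleMap _ V v.1 c ∈ grass.space (frameSpan v) := by
      rw [frameSpan_space, ← range_tupleMap]
      exact ⟨c, rfl⟩
    -- The chosen functionals span the dual of `U`; a vector of `U` killed by them is killed by all
    -- coordinates.
    have hker : Submodule.span ℂ (Set.range f) ≤
        LinearMap.ker (Module.Dual.eval ℂ (grass.space (frameSpan v)) ⟨_, hmem⟩) := by
      rw [← hss, Submodule.span_le]
      intro g hg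
      obtain ⟨i, hi⟩ := e.surjective ⟨g, hg⟩
      have h1 : f (σ i) = g := (hσ i).trans (congrArg Subtype.val hi)
      rw [← h1]
      exact congrFun hc i
    have h0 : tupleMap _ V v.1 c = 0 := b.ext_elem fun j => by
      have : f j ∈ LinearMap.ker (Module.Dual.eval ℂ (grass.space (frameSpan v)) ⟨_, hmem⟩) :=
        hker (Submodule.subset_span ⟨j, rfl⟩)
      rw [map_zero]
      exact this
    exact (linearIndependent_iff_tupleMap _).1 v.2 (h0.trans (map_zero _).symm)
  · have := isClosed_map_le (X := (grass k V).prod (grass k V)) (LinearMap.id (R := ℂ) (M := V))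
      (isMorphism_grass_id_family isMorphism_fst) (isMorphism_grass_id_family isMorphism_snd)
    convert this using 1
    ext z
    simp only [Submodule.map_id]
    constructor
    · intro h
      exact le_of_eq (congrArg grass.space h)
    · intro h
      exact grass_ext (Submodule.eq_of_le_of_finrank_eq h
        ((finrank_space _).trans (finrank_space _).symm))

end Grass

end FunSpace

namespace FunSpace

universe u v w

set_option linter.unusedSectionVars false

/-! ### Elimination theory -/

section Projective

variable {T : FunSpace.{w}} {n : ℕ} {t₀ : T}

/-- Evaluation of the functions that are regular near `t₀` at a point `t`. -/
def evalHom (t₀ t : T) : T.reg t₀ →+* ℂ :=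
  (Pi.evalRingHom (fun _ : T => ℂ) t).comp (T.reg t₀).val.toRingHom

/-- The value at `(v, t)` of a polynomial whose coefficients are regular near `t₀`. -/
noncomputable def relEval (P : MvPolynomial (Fin n) (T.reg t₀)) (v : Fin n → ℂ) (t : T) : ℂ :=
  MvPolynomial.eval₂ (evalHom t₀ t) v P

theorem relEval_homogeneous {d : ℕ} {P : MvPolynomial (Fin n) (T.reg t₀)} (hP : P.IsHomogeneous d)
    (v : Fin n → ℂ) (t : T) (c : ℂ) : relEval P (c • v) t = c ^ d * relEval P v t := by
  simp only [relEval, MvPolynomial.eval₂_eq', Finset.mul_sum]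
  refine Finset.sum_congr rfl fun μ hμ => ?_
  have hdeg : ∑ i, μ i = d := by
    rw [← Finsupp.degree_eq_sum]
    by_contra hne
    exact MvPolynomial.mem_support_iff.1 hμ (hP.coeff_eq_zero hne)
  simp only [Pi.smul_apply, smul_eq_mul, mul_pow, Finset.prod_mul_distrib,
    Finset.prod_pow_eq_pow_sum, hdeg]
  ring

/-- The values on the punctured line through `v` form a polynomial in `c` whose coefficients are the
values of the homogeneous components; having infinitely many roots, it is zero. -/
theorem relEval_homogeneousComponent_eq_zero {P : MvPolynomial (Fin n) (T.reg t₀)}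
    {v : Fin n → ℂ} {t : T} (h : ∀ c : ℂ, c ≠ 0 → relEval P (c • v) t = 0) (d : ℕ) :
    relEval (MvPolynomial.homogeneousComponent d P) v t = 0 := by
  let q : ℂ[X] := ∑ i ∈ Finset.range (P.totalDegree + 1),
    Polynomial.monomial i (relEval (MvPolynomial.homogeneousComponent i P) v t)
  have hq : ∀ c, q.eval c = relEval P (c • v) t := fun c => by
    conv_rhs => rw [← MvPolynomial.sum_homogeneousComponent P]
    simp only [q, Polynomial.eval_finsetSum, Polynomial.eval_monomial]
    conv_rhs => rw [relEval, MvPolynomial.eval₂_sum]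
    refine Finset.sum_congr rfl fun i _ => ?_
    rw [mul_comm]
    exact (relEval_homogeneous (MvPolynomial.homogeneousComponent_isHomogeneous i P) v t c).symm
  have hq0 : q = 0 := by
    refine Polynomial.eq_zero_of_infinite_isRoot q ?_
    refine Set.Infinite.mono (s := {0}ᶜ) (fun c hc => ?_) (Set.finite_singleton (0 : ℂ)).infinite_compl
    exact (hq c).trans (h c hc)
  by_cases hd : d < P.totalDegree + 1
  · have := congrArg (fun r => Polynomial.coeff r d) hq0
    simpa [q, Polynomial.finsetSum_coeff, Polynomial.coeff_monomial, hd] using this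
  · rw [MvPolynomial.homogeneousComponent_eq_zero _ _ (by omega)]
    simp [relEval]

/-- The coordinates of the first factor and the functions on the second generate the structure of
`ℂⁿ × T`. -/
def affProdGens (n : ℕ) (T : FunSpace.{w}) :
    Set (Set ((Fin n → ℂ) × T) × ((Fin n → ℂ) × T → ℂ)) :=
  {p | ∃ l : Module.Dual ℂ (Fin n → ℂ), p = (Set.univ, fun z => l z.1)} ∪
    pulled T (Prod.snd : (Fin n → ℂ) × T → T)

/-- Linear coordinates already generate the structure of the affine factor. With this smaller set of
generators, basic open sets of the product are given by polynomials in `v`. -/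
theorem morphAt_affProdGens (z : (Fin n → ℂ) × T) :
    MorphAt (generate (affProdGens n T)) ((aff n).prod T) (fun z : (Fin n → ℂ) × T => z) z := by
  refine morphAt_prod.2 ⟨morphAt_vec.2 fun l => ?_, morphAt_of_pulled_subset
    (g := (Prod.snd : (Fin n → ℂ) × T → T)) Set.subset_union_right _⟩
  exact generate_reg (L := affProdGens n T) (p := (Set.univ, fun z => l z.1)) (Or.inl ⟨l, rfl⟩)
    trivial

/-- A basic neighbourhood is the nonvanishing locus of a polynomial in coordinates of `v` and
finitely many functions regular near `t₀`; the latter are absorbed into the coefficients. -/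
theorem exists_relEval_ne_zero {v₀ : Fin n → ℂ} {A : Set ((Fin n → ℂ) × T)}
    (hA : A ∈ @nhds ((aff n).prod T) _ (v₀, t₀)) :
    ∃ P : MvPolynomial (Fin n) (T.reg t₀), relEval P v₀ t₀ ≠ 0 ∧
      ∀ᶠ t in 𝓝 t₀, ∀ v, relEval P v t ≠ 0 → (v, t) ∈ A := by
  have hA' : A ∈ @nhds (generate (affProdGens n T)) _ (v₀, t₀) :=
    (morphAt_affProdGens (v₀, t₀)).1 hA
  obtain ⟨W, hW, hWo, hzW⟩ := (mem_nhds_iff (X := generate (affProdGens n T))).1 hA'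
  obtain ⟨b, hbL, hbf, hzb, q, hq, hqz, hb⟩ := hWo _ hzW
  have hdom : ∀ᶠ t in 𝓝 t₀, ∀ v, (v, t) ∈ dom b := by
    have : ∀ p ∈ b, ∀ᶠ t in 𝓝 t₀, ∀ v, (v, t) ∈ p.1 := by
      intro p hp
      have hzp := hzb p hp
      rcases hbL hp with ⟨l, rfl⟩ | ⟨U, f, hU, hf, rfl⟩
      · exact Eventually.of_forall fun _ _ => trivial
      · filter_upwards [hU.mem_nhds hzp] with t ht v
        exact ht
    filter_upwards [(hbf.eventually_all).2 this] with t ht v p hp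
    exact ht p hp v
  obtain ⟨P, hP⟩ : ∃ P : MvPolynomial (Fin n) (T.reg t₀), ∀ v t, relEval P v t = q (v, t) := by
    clear hqz hb
    induction hq using Algebra.adjoin_induction with
    | mem h hp =>
      obtain ⟨p, hp, rfl⟩ := hp
      have hzp := hzb p hp
      rcases hbL hp with ⟨l, rfl⟩ | ⟨U, f, hU, hf, rfl⟩
      · refine ⟨∑ i, MvPolynomial.C (algebraMap ℂ _ (l (Pi.single i 1))) * MvPolynomial.X i,
          fun v t => ?_⟩
        have : l v = ∑ i, v i * l (Pi.single i 1) := by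
          conv_lhs => rw [← (Pi.basisFun ℂ (Fin n)).sum_repr v]
          simp
        show _ = l v
        rw [this, relEval, MvPolynomial.eval₂_sum]
        refine Finset.sum_congr rfl fun i _ => ?_
        rw [MvPolynomial.eval₂_mul, MvPolynomial.eval₂_C, MvPolynomial.eval₂_X, mul_comm]
        rfl
      · exact ⟨MvPolynomial.C ⟨f, hf _ hzp⟩, fun v t => by
          rw [relEval, MvPolynomial.eval₂_C]; rfl⟩
    | algebraMap r =>
      exact ⟨MvPolynomial.C (algebraMap ℂ _ r), fun v t => by
        rw [relEval, MvPolynomial.eval₂_C]; rfl⟩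
    | add p q _ _ hp hq =>
      obtain ⟨P, hP⟩ := hp
      obtain ⟨Q, hQ⟩ := hq
      exact ⟨P + Q, fun v t => by rw [relEval, MvPolynomial.eval₂_add]; exact congrArg₂ _ (hP v t) (hQ v t)⟩
    | mul p q _ _ hp hq =>
      obtain ⟨P, hP⟩ := hp
      obtain ⟨Q, hQ⟩ := hq
      exact ⟨P * Q, fun v t => by rw [relEval, MvPolynomial.eval₂_mul]; exact congrArg₂ _ (hP v t) (hQ v t)⟩
  refine ⟨P, by rw [hP]; exact hqz, ?_⟩
  filter_upwards [hdom] with t ht v hv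
  rw [hP] at hv
  exact hW (hb (v, t) (ht v) hv)

variable {V : Type v} [AddCommGroup V] [Module ℂ V] [FiniteDimensional ℂ V]

/-- Let `Z` be a set of pairs `(v, t)` with `v ≠ 0` that is closed under scaling of `v` and closed in
`(ℂⁿ - 0) × T`. Then its image in `T` is closed. -/
theorem eventually_not_mem_of_cone {Z : Set ((Fin n → ℂ) × T)}
    (hcone : ∀ v t, (v, t) ∈ Z → ∀ c : ℂ, c ≠ 0 → (c • v, t) ∈ Z)
    (hZ : ∀ v : Fin n → ℂ, v ≠ 0 → Zᶜ ∈ @nhds ((aff n).prod T) _ (v, t₀)) :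
    ∀ᶠ t in 𝓝 t₀, ∀ v, v ≠ 0 → (v, t) ∉ Z := by
  classical
  -- The relations that hold on `Z` over some neighbourhood of `t₀`. Invariance of `Z` under scaling
  -- makes this ideal homogeneous.
  let K : Ideal (MvPolynomial (Fin n) (T.reg t₀)) :=
    { carrier := {P | ∀ᶠ t in 𝓝 t₀, ∀ v, (v, t) ∈ Z → relEval P v t = 0}
      add_mem' := fun {P Q} hP hQ => by
        filter_upwards [hP, hQ] with t h1 h2 v hv
        rw [relEval, MvPolynomial.eval₂_add, ← relEval, ← relEval, h1 v hv, h2 v hv, add_zero]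
      zero_mem' := Eventually.of_forall fun t v _ => by simp [relEval]
      smul_mem' := fun P Q hQ => by
        filter_upwards [hQ] with t h2 v hv
        rw [smul_eq_mul, relEval, MvPolynomial.eval₂_mul, ← relEval, ← relEval, h2 v hv, mul_zero] }
  have hK : ∀ P ∈ K, ∀ d, MvPolynomial.homogeneousComponent d P ∈ K := by
    intro P hP d
    filter_upwards [show ∀ᶠ t in 𝓝 t₀, ∀ v, (v, t) ∈ Z → relEval P v t = 0 from hP] with t ht v hv
    exact relEval_homogeneousComponent_eq_zero (fun c hc => ht _ (hcone v t hv c hc)) d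
  let φ := MvPolynomial.map (σ := Fin n) (evalHom t₀ t₀)
  have hφ : Function.Surjective φ := MvPolynomial.map_surjective _ fun c =>
    ⟨algebraMap ℂ _ c, rfl⟩
  -- Nullstellensatz over `t₀`: a neighbourhood of `(v, t₀)` missing `Z` supplies a relation that is
  -- nonzero at `(v, t₀)`. So no `v ≠ 0` is a common zero of the reduced ideal, and its radical
  -- contains all variables.
  have hrad : MvPolynomial.idealOfVars (Fin n) ℂ ≤ (K.map φ).radical := by
    rw [← MvPolynomial.vanishingIdeal_zeroLocus_eq_radical (k := ℂ) (K := ℂ) (K.map φ), Ideal.span_le]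
    rintro _ ⟨i, rfl⟩ v hv
    by_cases hv0 : v = 0
    · simp [hv0]
    · obtain ⟨P, hP, hPA⟩ := exists_relEval_ne_zero (hZ v hv0)
      have hPK : P ∈ K := by
        filter_upwards [hPA] with t ht w hw
        by_contra hne
        exact ht w hne hw
      refine absurd (hv _ (Ideal.mem_map_of_mem φ hPK)) ?_
      show MvPolynomial.aeval v (MvPolynomial.map (evalHom t₀ t₀) P) ≠ 0
      rw [MvPolynomial.aeval_def, MvPolynomial.eval₂_map]
      exact hP
  obtain ⟨M, hM⟩ := Ideal.exists_pow_le_of_le_radical_of_fg hrad (MvPolynomial.idealOfVars_fg _ _)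
  let ι := ↥(Finset.finsuppAntidiag (Finset.univ : Finset (Fin n)) M)
  let _ : Fintype ι := Finset.fintypeCoeSort _
  have hι : ∀ μ : Fin n →₀ ℕ, μ.degree = M ↔ μ ∈ Finset.finsuppAntidiag Finset.univ M := fun μ => by
    simp [Finsupp.degree_eq_sum]
  -- Each monomial of degree `M` lies in the reduced ideal. A lift to `K`, cut down to its component
  -- of degree `M`, still reduces to that monomial.
  have hQ : ∀ μ : ι, ∃ Q ∈ K, Q.IsHomogeneous M ∧ φ Q = MvPolynomial.monomial μ.1 1 := by
    intro μ
    have hmon : MvPolynomial.monomial μ.1 (1 : ℂ) ∈ K.map φ := by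
      refine hM ?_
      rw [MvPolynomial.mem_pow_idealOfVars_iff]
      intro x hx
      have := MvPolynomial.support_monomial_subset hx
      rw [Finset.mem_singleton.1 this]
      exact ((hι _).2 μ.2).ge
    obtain ⟨Q, hQK, hQ⟩ := (Ideal.mem_map_iff_of_surjective φ hφ).1 hmon
    refine ⟨_, hK Q hQK M, MvPolynomial.homogeneousComponent_isHomogeneous M Q, ?_⟩
    ext d
    have hc := congrArg (MvPolynomial.coeff d) hQ
    simp only [φ, MvPolynomial.coeff_map, MvPolynomial.coeff_homogeneousComponent] at hc ⊢
    split_ifs with hd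
    · exact hc
    · rw [map_zero, MvPolynomial.coeff_monomial, if_neg]
      rintro rfl
      exact hd ((hι _).2 μ.2)
  choose Q hQK hQh hQφ using hQ
  -- The coefficient matrix of the lifts is the identity at `t₀`, hence invertible nearby. A point
  -- of `Z` over such a `t` annihilates all lifts, so all its monomials of degree `M` vanish, in
  -- particular every `v j ^ M`.
  let A : T → Matrix ι ι ℂ := fun t μ ν => ((Q μ).coeff ν.1).1 t
  have hAreg : (fun t => (A t).det) ∈ T.reg t₀ := det_reg fun μ ν => ((Q μ).coeff ν.1).2
  have hA1 : A t₀ = 1 := by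
    ext μ ν
    have hc := congrArg (MvPolynomial.coeff ν.1) (hQφ μ)
    simp only [φ, MvPolynomial.coeff_map, MvPolynomial.coeff_monomial] at hc
    refine Eq.trans hc ?_
    rw [Matrix.one_apply]
    exact if_congr Subtype.ext_iff.symm rfl rfl
  have hval : ∀ μ v t, relEval (Q μ) v t = ∑ ν : ι, A t μ ν * ∏ i, v i ^ ν.1 i := by
    intro μ v t
    rw [relEval, MvPolynomial.eval₂_eq', Finset.sum_coe_sort (Finset.finsuppAntidiag Finset.univ M)
      (fun ν => ((Q μ).coeff ν).1 t * ∏ i, v i ^ ν i)]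
    refine Finset.sum_subset (fun ν hν => ?_) fun ν _ hν => ?_
    · rw [← hι]
      by_contra hne
      exact MvPolynomial.mem_support_iff.1 hν ((hQh μ).coeff_eq_zero hne)
    · rw [MvPolynomial.notMem_support_iff.1 hν]
      simp
  have hdet : ∀ᶠ t in 𝓝 t₀, (A t).det ≠ 0 := eventually_ne hAreg (by simp [hA1])
  filter_upwards [hdet, eventually_all.2 fun μ =>
    (show ∀ᶠ t in 𝓝 t₀, ∀ v, (v, t) ∈ Z → relEval (Q μ) v t = 0 from hQK μ)] with t h1 h2 v hv0 hv
  have hmul : (A t).mulVec (fun ν : ι => ∏ i, v i ^ ν.1 i) = 0 := by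
    ext μ
    exact (hval μ v t).symm.trans (h2 μ v hv)
  have hzero := Matrix.eq_zero_of_mulVec_eq_zero h1 hmul
  obtain ⟨j, hj⟩ := Function.ne_iff.1 hv0
  have := congrFun hzero ⟨Finsupp.single j M, (hι _).1 (by simp)⟩
  simp only [Pi.zero_apply, Finset.prod_eq_zero_iff, Finset.mem_univ, true_and] at this
  obtain ⟨i, hi⟩ := this
  by_cases hij : i = j
  · subst hij
    rw [Finsupp.single_eq_same] at hi
    exact hj (eq_zero_of_pow_eq_zero hi)
  · rw [Finsupp.single_eq_of_ne hij] at hi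
    simp at hi

end Projective

end FunSpace

namespace FunSpace

universe u v w

set_option linter.unusedSectionVars false

/-! ### Completeness and properness -/

section Complete

theorem isClosed_of_compl_mem_nhds {X : FunSpace.{u}} {Z : Set X} (h : ∀ x ∉ Z, Zᶜ ∈ 𝓝 x) :
    IsClosed Z := by
  rw [← isOpen_compl_iff, isOpen_iff_mem_nhds]
  exact h

/-- Completeness: projections along `P` are closed maps. -/
def IsComplete (P : FunSpace.{u}) : Prop :=
  ∀ (T : FunSpace.{u}) (Z : Set (P × T)), @IsClosed (P.prod T) _ Z →
    ∀ t₀ : T, (∀ p, (p, t₀) ∉ Z) → ∀ᶠ t in 𝓝 t₀, ∀ p, (p, t) ∉ Z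

theorem IsComplete.isClosed_image {P T : FunSpace.{u}} (hP : IsComplete P) {Z : Set (P × T)}
    (hZ : @IsClosed (P.prod T) _ Z) : IsClosed (Prod.snd '' Z : Set T) := by
  rw [← isOpen_compl_iff, isOpen_iff_mem_nhds]
  intro t₀ ht₀
  filter_upwards [hP T Z hZ t₀ fun p hp => ht₀ ⟨_, hp, rfl⟩] with t ht
  rintro ⟨⟨p, t⟩, hz, rfl⟩
  exact ht p hz

variable {V : Type u} [AddCommGroup V] [Module ℂ V] [FiniteDimensional ℂ V]

theorem span_singleton_tuple (v : V) :
    Submodule.span ℂ (Set.range fun _ : Fin 1 => v) = Submodule.span ℂ {v} := by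
  rw [Set.range_const]

theorem morphAt_line {E : Type w} [AddCommGroup E] [Module ℂ E] (e : E →ₗ[ℂ] V)
    (he : Function.Injective e) {line : E → grass 1 V}
    (hline : ∀ v, v ≠ 0 → grass.space (line v) = Submodule.span ℂ {e v}) (v : E) (hv : v ≠ 0) :
    MorphAt (vec E) (grass 1 V) line v := by
  have hr : RegAt (vec E) (fun w : E => fun _ : Fin 1 => e w) v :=
    regAt_pi.2 fun _ => (regAt_id v).linear e
  have hli : ∀ w, w ≠ 0 ↔ LinearIndependent ℂ (fun _ : Fin 1 => e w) := fun w => by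
    rw [linearIndependent_unique_iff, Ne, Ne, map_eq_zero_iff e he]
  refine morphAt_grass.2 ⟨_, hr, (hli v).1 hv, ?_⟩
  filter_upwards [eventually_linearIndependent hr ((hli v).1 hv)] with z hz
  exact (span_singleton_tuple _).trans (hline _ ((hli _).2 hz)).symm

/-- Pull `Z` back along `v ↦ ℂ v` to a cone in `(ℂⁿ - 0) × T` and apply elimination. -/
theorem isComplete_grass_one : IsComplete (grass 1 V) := by
  classical
  intro T Z hZ t₀ ht₀
  let n := Module.finrank ℂ V
  let b := Module.finBasis ℂ V
  let e : (Fin n → ℂ) ≃ₗ[ℂ] V := b.equivFun.symm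
  by_cases hV : Nonempty (grass 1 V)
  · obtain ⟨L₀⟩ := hV
    -- The value at `v = 0` is junk; the cone below leaves out `0`.
    let line : (Fin n → ℂ) → grass 1 V := fun v =>
      if h : v = 0 then L₀ else
        grass.mk (Submodule.span ℂ {e v}) (finrank_span_singleton fun h0 => h (by simpa using h0))
    have hline : ∀ v, v ≠ 0 → grass.space (line v) = Submodule.span ℂ {e v} := fun v hv => by
      simp only [line, dif_neg hv]
      rfl
    have hsurj : ∀ L : grass 1 V, ∃ v, v ≠ 0 ∧ line v = L := fun L => by
      obtain ⟨v, hv0, hv⟩ := finrank_eq_one_iff'.1 (finrank_space L)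
      have hne : e.symm v ≠ 0 := by simpa using hv0
      refine ⟨e.symm v, hne, grass_ext ?_⟩
      rw [hline _ hne, LinearEquiv.apply_symm_apply]
      refine le_antisymm ((Submodule.span_singleton_le_iff_mem _ _).2 v.2) fun w hw => ?_
      obtain ⟨c, hc⟩ := hv ⟨w, hw⟩
      exact Submodule.mem_span_singleton.2 ⟨c, congrArg Subtype.val hc⟩
    have key := eventually_not_mem_of_cone (n := n) (t₀ := t₀)
      (Z := {z : (Fin n → ℂ) × T | z.1 ≠ 0 ∧ (line z.1, z.2) ∈ Z}) ?_ ?_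
    · filter_upwards [key] with t ht L hL
      obtain ⟨v, hv0, rfl⟩ := hsurj L
      exact ht v hv0 ⟨hv0, hL⟩
    · rintro v t ⟨hv, hz⟩ c hc
      have hcv : c • v ≠ 0 := smul_ne_zero hc hv
      refine ⟨hcv, ?_⟩
      have : line (c • v) = line v := grass_ext (by
        rw [hline _ hcv, hline _ hv, map_smul]
        exact Submodule.span_singleton_smul_eq (IsUnit.mk0 c hc) _)
      show (line (c • v), t) ∈ Z
      rwa [this]
    · intro v hv
      have hm : MorphAt ((aff n).prod T) ((grass 1 V).prod T)
          (fun z : (Fin n → ℂ) × T => (line z.1, z.2)) ((v, t₀) : (Fin n → ℂ) × T) :=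
        morphAt_prod.2 ⟨(morphAt_line e.toLinearMap e.injective hline v hv).comp
          ((isMorphism_fst (X := aff n)).morphAt ((v, t₀) : (Fin n → ℂ) × T)),
          isMorphism_snd.morphAt _⟩
      have := hm.1 (hZ.isOpen_compl.mem_nhds (ht₀ (line v)))
      filter_upwards [this] with z hz h
      exact hz h.2
  · exact Eventually.of_forall fun t p => absurd ⟨p⟩ hV

theorem isCompl_of_mem_dualChart {k : ℕ} {B : V →ₗ[ℂ] (Fin k → ℂ)} {U : grass k V}
    (h : U ∈ dualChart B) : IsCompl (grass.space U) (LinearMap.ker B) := by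
  have h1 := comp_dualFrame h
  have h2 := span_dualFrame h
  rw [← range_tupleMap] at h2
  rw [← h2, isCompl_comm]
  refine ⟨Submodule.disjoint_def.2 ?_, codisjoint_iff.2 (eq_top_iff.2 fun v _ => ?_)⟩
  · rintro _ hv ⟨c, rfl⟩
    have := LinearMap.congr_fun h1 c
    rw [LinearMap.comp_apply, LinearMap.mem_ker.1 hv] at this
    rw [← LinearMap.id_apply (R := ℂ) c, ← this, map_zero]
  · rw [← sub_add_cancel v (tupleMap _ V (dualFrame B U) (B v))]
    refine Submodule.add_mem_sup ?_ ⟨_, rfl⟩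
    rw [LinearMap.mem_ker, map_sub, sub_eq_zero]
    exact (LinearMap.congr_fun h1 (B v)).symm

theorem morphAt_sup_of_le {X : FunSpace.{w}} {k l d : ℕ} {C : Submodule ℂ V} {f : X → grass k V}
    {g : X → grass l C} {φ : X → grass d V} {x : X}
    (h : ∀ y, grass.space (φ y) = grass.space (f y) ⊔ (grass.space (g y)).map C.subtype)
    (hf : MorphAt X (grass k V) f x) (hg : MorphAt X (grass l C) g x) :
    MorphAt X (grass d V) φ x := by
  refine morphAt_grass.2 ?_
  have h1 : RegFamAt X l (fun y => (grass.space (g y)).map C.subtype) x := by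
    refine RegFamAt.map (A := fun _ => C.subtype) (morphAt_grass.1 hg) (regAt_const _ _)
      (Eventually.of_forall fun y => ?_)
    rw [(Submodule.equivMapOfInjective _ C.injective_subtype _).finrank_eq.symm]
    exact finrank_space _
  have h2 := (morphAt_grass.1 hf).sup h1 (d := d)
    (Eventually.of_forall fun y => by rw [← h, finrank_space])
  simpa only [h] using h2

/-- Induction through flags `U' ⊂ U` of dimensions `k` and `k + 1`. While `U'` stays in a dual chart
it keeps the complement `C = ker B`, so the spaces `U` above it are the `U' ⊕ L` for lines `L` in
`C`. Completeness of the space of lines in `C` makes the set of `U'` contained in a member of `Z`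
closed, and the induction hypothesis applies to that set. -/
theorem isComplete_grass (k : ℕ) : IsComplete (grass k V) := by
  induction k with
  | zero =>
    intro T Z hZ t₀ ht₀
    let o : grass 0 V := grass.mk ⊥ (finrank_bot ℂ V)
    have ho : ∀ U : grass 0 V, U = o := fun U =>
      grass_ext (Submodule.finrank_eq_zero.1 (finrank_space U))
    have hm : MorphAt T ((grass 0 V).prod T) (fun t => (o, t)) t₀ :=
      morphAt_prod.2 ⟨morphAt_const o t₀, morphAt_id t₀⟩
    filter_upwards [hm.1 (hZ.isOpen_compl.mem_nhds (ht₀ o))] with t ht p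
    rw [ho p]
    exact ht
  | succ k ih =>
    intro T Z hZ t₀ ht₀
    let Z₂ : Set (grass k V × T) :=
      {z | ∃ U : grass (k + 1) V, grass.space z.1 ≤ grass.space U ∧ (U, z.2) ∈ Z}
    have hZ₂ : @IsClosed ((grass k V).prod T) _ Z₂ := by
      refine isClosed_of_compl_mem_nhds (X := (grass k V).prod T) ?_
      rintro ⟨U₀, s₀⟩ h₀
      obtain ⟨B, hB⟩ := exists_mem_dualChart U₀
      let C := LinearMap.ker B
      let Q : Set ((grass k V).prod T) := {z : grass k V × T | z.1 ∈ dualChart B}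
      have hQ : IsOpen Q := (isOpen_dualChart B).preimage (isMorphism_fst (Y := T)).1
      have hsum : ∀ (L : grass 1 C) (U : grass k V), U ∈ dualChart B →
          Module.finrank ℂ ↥(grass.space U ⊔ (grass.space L).map C.subtype) = k + 1 := by
        intro L U hU
        have h1 := Submodule.finrank_sup_add_finrank_inf_eq (grass.space U)
          ((grass.space L).map C.subtype)
        have h2 : grass.space U ⊓ (grass.space L).map C.subtype = ⊥ := by
          refine eq_bot_iff.2 ((inf_le_inf_left _ (Submodule.map_subtype_le _ _)).trans ?_)
          exact (isCompl_of_mem_dualChart hU).inf_eq_bot.le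
        rw [h2, finrank_bot, add_zero, finrank_space,
          (Submodule.equivMapOfInjective _ C.injective_subtype _).finrank_eq.symm,
          finrank_space] at h1
        exact h1
      let f : grass 1 C × ((grass k V).prod T).sub Q → grass (k + 1) V × T := fun z =>
        (grass.mk _ (hsum z.1 (show Q from z.2).1.1 (show Q from z.2).2), (show Q from z.2).1.2)
      have hf : IsMorphism ((grass 1 C).prod (((grass k V).prod T).sub Q))
          ((grass (k + 1) V).prod T) f := by
        refine isMorphism_iff.2 fun z => ?_
        have hz2 : MorphAt ((grass 1 C).prod (((grass k V).prod T).sub Q)) ((grass k V).prod T)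
            (fun z : grass 1 C × ((grass k V).prod T).sub Q => (show Q from z.2).1) z :=
          (morphAt_val (X := (grass k V).prod T) (S := Q) _).comp
            ((isMorphism_snd (X := grass 1 C)).morphAt z)
        exact morphAt_prod.2 ⟨morphAt_sup_of_le (fun _ => rfl)
          ((isMorphism_fst (X := grass k V) (Y := T)).morphAt _ |>.comp hz2)
          (isMorphism_fst.morphAt z),
          ((isMorphism_snd (X := grass k V) (Y := T)).morphAt _).comp hz2⟩
      have hcl : @IsClosed ((grass 1 C).prod (((grass k V).prod T).sub Q)) _ (f ⁻¹' Z) :=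
        IsClosed.preimage hf.1 hZ
      have hsp : ∀ z, grass.space (f z).1 =
          grass.space (show Q from z.2).1.1 ⊔ (grass.space z.1).map C.subtype := fun z => rfl
      have key := isComplete_grass_one (((grass k V).prod T).sub Q) _ hcl
        (⟨(U₀, s₀), hB⟩ : Q) fun L hL => h₀ ⟨_, ?_, hL⟩
      · obtain ⟨A, hA, hAs⟩ := sub_nhds.1 key
        filter_upwards [hA, hQ.mem_nhds (show (U₀, s₀) ∈ Q from hB)]
        rintro ⟨U', s⟩ h1 h2 ⟨U, hU, hz⟩
        have hU : grass.space U' ≤ grass.space U := hU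
        have hc : IsCompl (grass.space U') C := isCompl_of_mem_dualChart h2
        -- By the modular law `U = U' ⊕ (C ∩ U)`, and counting dimensions shows that `C ∩ U` is a
        -- line.
        have hUe : grass.space U = grass.space U' ⊔ (C ⊓ grass.space U) := by
          rw [← sup_inf_assoc_of_le _ hU, hc.sup_eq_top, top_inf_eq]
        have hdim : Module.finrank ℂ ↥((grass.space U).comap C.subtype) = 1 := by
          have h3 := Submodule.finrank_sup_add_finrank_inf_eq (grass.space U') (C ⊓ grass.space U)
          rw [← hUe, ← inf_assoc, hc.inf_eq_bot, bot_inf_eq, finrank_bot, finrank_space,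
            finrank_space] at h3
          have h4 := (Submodule.equivMapOfInjective _ C.injective_subtype
            ((grass.space U).comap C.subtype)).finrank_eq
          rw [Submodule.map_comap_subtype] at h4
          omega
        refine hAs (a := (⟨(U', s), h2⟩ : Q)) h1 (grass.mk _ hdim) ?_
        have : (f (grass.mk _ hdim, (⟨(U', s), h2⟩ : Q))) = (U, s) := by
          refine Prod.ext (grass_ext ?_) rfl
          rw [hsp]
          show grass.space U' ⊔ ((grass.space U).comap C.subtype).map C.subtype = _
          rw [Submodule.map_comap_subtype, ← hUe]
        show f _ ∈ Z
        rw [this]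
        exact hz
      · exact le_sup_left
    have key := ih T Z₂ hZ₂ t₀ fun U' ⟨U, _, hU⟩ => ht₀ U hU
    filter_upwards [key] with t ht U hU
    -- Every `U` contains some `U'` of dimension `k`, so a point of `Z` over `t` yields a point of
    -- `Z₂` over `t`.
    obtain ⟨u, hu⟩ := exists_linearIndependent_of_le_finrank (R := ℂ) (n := k)
      (M := grass.space U) (by rw [finrank_space]; omega)
    have hu' : LinearIndependent ℂ (fun i => (u i : V)) := hu.map' _ (Submodule.ker_subtype _)
    refine ht (frameSpan ⟨_, hu'⟩) ⟨U, ?_, hU⟩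
    rw [frameSpan_space, Submodule.span_le]
    rintro _ ⟨i, rfl⟩
    exact (u i).2

/-- The total space of a Grassmann bundle over a complete base is complete. -/
theorem IsGrassmannBundle.isComplete {X Y : FunSpace.{u}} {p : Y → X} {W : Type u}
    [AddCommGroup W] [Module ℂ W] [FiniteDimensional ℂ W] {d : ℕ} {K E : X → Submodule ℂ V}
    {S : Y → Submodule ℂ V} (h : IsGrassmannBundle Y X p W d K E S) (hX : IsComplete X) :
    IsComplete Y := by
  intro T Z hZ t₀ ht₀
  -- The projection to `T` is factored through `X × T`: the fibres are Grassmannians, and the base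
  -- is complete by assumption.
  let Z₂ : Set (X × T) := {z | ∃ y, p y = z.1 ∧ (y, z.2) ∈ Z}
  have hZ₂ : @IsClosed (X.prod T) _ Z₂ := by
    refine isClosed_of_compl_mem_nhds (X := X.prod T) ?_
    rintro ⟨x₀, s₀⟩ h₀
    obtain ⟨hp, -, -, hloc⟩ := h
    obtain ⟨O, hO, hx₀, -, ψ, -, -, -, hφ, χ, hχ, h1, h2⟩ := hloc x₀
    -- Over `O` the trivialization turns `Z` into a closed subset of `Gr × (O × T)`, to which
    -- completeness of the Grassmannian applies with `O × T` as parameter space.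
    let g : grass d W × ((X.sub O).prod T) → Y × T := fun z =>
      ((show ↥(p ⁻¹' O) from χ (z.2.1, z.1)).1, z.2.2)
    have hpg : ∀ z, p (g z).1 = (show O from z.2.1).1 := fun z => by
      have := congrFun h2 (z.2.1, z.1)
      exact congrArg (fun q : O × grass d W => q.1.1) this
    have hg : IsMorphism ((grass d W).prod ((X.sub O).prod T)) (Y.prod T) g := by
      refine isMorphism_iff.2 fun z => ?_
      have hz1 : MorphAt ((grass d W).prod ((X.sub O).prod T)) (grass d W)
          (fun z : grass d W × ((X.sub O).prod T) => z.1) z := isMorphism_fst.morphAt z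
      have hz2 : MorphAt ((grass d W).prod ((X.sub O).prod T)) ((X.sub O).prod T)
          (fun z : grass d W × ((X.sub O).prod T) => z.2) z := isMorphism_snd.morphAt z
      have hz3 : MorphAt ((grass d W).prod ((X.sub O).prod T)) (X.sub O)
          (fun z : grass d W × ((X.sub O).prod T) => z.2.1) z :=
        (isMorphism_fst.morphAt _).comp hz2
      have hz4 : MorphAt ((grass d W).prod ((X.sub O).prod T)) (Y.sub (p ⁻¹' O))
          (fun z : grass d W × ((X.sub O).prod T) => χ (z.2.1, z.1)) z := by
        have hz5 : MorphAt ((grass d W).prod ((X.sub O).prod T)) ((X.sub O).prod (grass d W))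
            (fun z : grass d W × ((X.sub O).prod T) => (z.2.1, z.1)) z := morphAt_prod.2 ⟨hz3, hz1⟩
        exact (hχ.morphAt _).comp hz5
      exact morphAt_prod.2 ⟨(morphAt_val _).comp hz4,
        ((isMorphism_snd (X := X.sub O) (Y := T)).morphAt _).comp hz2⟩
    have key := isComplete_grass d ((X.sub O).prod T) _ (IsClosed.preimage hg.1 hZ)
      ((⟨x₀, hx₀⟩ : O), s₀) fun R hR => h₀ ⟨_, hpg _, hR⟩
    have hm : MorphAt ((X.prod T).sub {z : X × T | z.1 ∈ O}) ((X.sub O).prod T)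
        (fun z : {z : X × T | z.1 ∈ O} => ((⟨z.1.1, z.2⟩ : O), z.1.2))
        (⟨(x₀, s₀), hx₀⟩ : {z : X × T | z.1 ∈ O}) := by
      refine morphAt_prod.2 ⟨morphAt_sub.2 ?_, ?_⟩
      · exact (isMorphism_fst.morphAt _).comp (morphAt_val _)
      · exact ((isMorphism_snd (X := X) (Y := T)).morphAt _).comp (morphAt_val _)
    obtain ⟨A, hA, hAs⟩ := sub_nhds.1 (show _ ∈ @nhds ((X.prod T).sub {z : X × T | z.1 ∈ O}) _ _ from hm.1 key)
    have hOo : @IsOpen (X.prod T) _ {z : X × T | z.1 ∈ O} :=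
      hO.preimage (isMorphism_fst (Y := T)).1
    filter_upwards [hA, hOo.mem_nhds hx₀]
    rintro ⟨x, s⟩ hx1 hx2 ⟨y, rfl, hy⟩
    refine hAs (a := (⟨(p y, s), hx2⟩ : {z : X × T | z.1 ∈ O})) hx1 (ψ ⟨y, hx2⟩) ?_
    have := congrFun h1 ⟨y, hx2⟩
    have h3 : g (ψ ⟨y, hx2⟩, ((⟨p y, hx2⟩ : O), s)) = (y, s) :=
      Prod.ext (congrArg (fun q : ↥(p ⁻¹' O) => q.1) this) rfl
    show g _ ∈ Z
    rw [h3]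
    exact hy
  filter_upwards [hX T Z₂ hZ₂ t₀ fun x ⟨y, _, hy⟩ => ht₀ y hy] with t ht y hy
  exact ht (p y) ⟨y, rfl, hy⟩

theorem isComplete_of_unique {P : FunSpace.{u}} [Unique P] : IsComplete P := by
  intro T Z hZ t₀ ht₀
  have hm : MorphAt T (P.prod T) (fun t => (default, t)) t₀ :=
    morphAt_prod.2 ⟨morphAt_const _ t₀, morphAt_id t₀⟩
  filter_upwards [hm.1 (hZ.isOpen_compl.mem_nhds (ht₀ default))] with t ht p
  rw [Unique.eq_default p]
  exact ht

/-- A morphism from a complete variety to a separated one is proper. -/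
theorem IsComplete.isProperMorphism {Y X : FunSpace.{u}} (hY : IsComplete Y) (hX : IsVariety X)
    {φ : Y → X} (hφ : IsMorphism Y X φ) : IsProperMorphism Y X φ := by
  refine ⟨hφ, fun T _ Z hZ => ?_⟩
  -- The image of `Z` in `X × T` is the projection of its lift to the graph of `φ`. That lift is
  -- closed because `X` is separated.
  let Z' : Set (Y × (X.prod T)) := {z | φ z.1 = z.2.1 ∧ (z.1, z.2.2) ∈ Z}
  have hfst : ∀ z, MorphAt (Y.prod (X.prod T)) Y (fun z : Y × (X.prod T) => z.1) z :=
    fun z => isMorphism_fst.morphAt z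
  have hsnd : ∀ z, MorphAt (Y.prod (X.prod T)) (X.prod T) (fun z : Y × (X.prod T) => z.2) z :=
    fun z => isMorphism_snd.morphAt z
  have hZ' : @IsClosed (Y.prod (X.prod T)) _ Z' := by
    refine IsClosed.inter ?_ ?_
    · exact hX.isClosed_eq (Y := Y.prod (X.prod T))
        (isMorphism_iff.2 fun z => (hφ.morphAt _).comp (hfst z))
        (isMorphism_iff.2 fun z => (isMorphism_fst.morphAt _).comp (hsnd z))
    · have : IsMorphism (Y.prod (X.prod T)) (Y.prod T) (fun z : Y × (X.prod T) => (z.1, z.2.2)) :=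
        isMorphism_iff.2 fun z =>
          morphAt_prod.2 ⟨hfst z, ((isMorphism_snd (X := X) (Y := T)).morphAt _).comp (hsnd z)⟩
      exact IsClosed.preimage this.1 hZ
  have := hY.isClosed_image (T := X.prod T) hZ'
  convert this using 1
  ext ⟨x, t⟩
  constructor
  · rintro ⟨⟨y, s⟩, hz, h⟩
    obtain ⟨rfl, rfl⟩ := Prod.mk.inj h
    exact ⟨(y, (φ y, s)), ⟨rfl, hz⟩, rfl⟩
  · rintro ⟨⟨y, ⟨x', s⟩⟩, ⟨h1, hz⟩, h⟩
    obtain ⟨rfl, rfl⟩ := Prod.mk.inj h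
    exact ⟨(y, s), hz, Prod.ext h1 rfl⟩

end Complete

end FunSpace

namespace TruncPoly

universe u v w

/-! ### Ideals of the truncated polynomial ring -/

section Ideals

variable {N : ℕ}

/-- The class of a polynomial in `A_N`. -/
noncomputable def mk (N : ℕ) : ℂ[X] →+* TruncPoly N := Ideal.Quotient.mk _

theorem mk_surjective : Function.Surjective (mk N) := Ideal.Quotient.mk_surjective

theorem mk_eq_zero {p : ℂ[X]} : mk N p = 0 ↔ Polynomial.X ^ N ∣ p :=
  Ideal.Quotient.eq_zero_iff_mem.trans Ideal.mem_span_singleton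

theorem t_pow (a : ℕ) : t N ^ a = mk N (Polynomial.X ^ a) := (map_pow (mk N) _ _).symm

theorem mk_C (r : ℂ) : mk N (Polynomial.C r) = algebraMap ℂ (TruncPoly N) r := rfl

theorem mk_mem_span_t_pow {a : ℕ} (ha : a ≤ N) (p : ℂ[X]) :
    mk N p ∈ Ideal.span {t N ^ a} ↔ Polynomial.X ^ a ∣ p := by
  rw [t_pow, Ideal.mem_span_singleton']
  constructor
  · rintro ⟨y, hy⟩
    obtain ⟨q, rfl⟩ := mk_surjective y
    rw [← map_mul, ← sub_eq_zero, ← map_sub, mk_eq_zero] at hy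
    exact (dvd_sub_right (dvd_mul_left _ _)).1 ((pow_dvd_pow _ ha).trans hy)
  · rintro ⟨q, rfl⟩
    exact ⟨mk N q, by rw [← map_mul, mul_comm]⟩

theorem t_pow_eq_zero {a : ℕ} (ha : N ≤ a) : t N ^ a = 0 := by
  rw [t_pow, mk_eq_zero]
  exact pow_dvd_pow _ ha

/-- Cancel `X ^ a` in the divisibility by `X ^ N`. For `a ≥ N` truncated subtraction gives the unit
ideal, as it should. -/
theorem mul_t_pow_eq_zero {a : ℕ} (x : TruncPoly N) :
    x * t N ^ a = 0 ↔ x ∈ Ideal.span {t N ^ (N - a)} := by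
  obtain ⟨p, rfl⟩ := mk_surjective x
  rw [mk_mem_span_t_pow (Nat.sub_le _ _), t_pow, ← map_mul, mk_eq_zero]
  rcases le_total a N with h | h
  · rw [← Nat.sub_add_cancel h, pow_add, Nat.add_sub_cancel]
    exact mul_dvd_mul_iff_right (pow_ne_zero _ Polynomial.X_ne_zero)
  · rw [Nat.sub_eq_zero_of_le h, pow_zero]
    exact ⟨fun _ => one_dvd _, fun _ => (pow_dvd_pow _ h).mul_left _⟩

instance : Module.Finite ℂ (TruncPoly N) :=
  (Polynomial.monic_X_pow N).finite_quotient

noncomputable def quotEquivSpan {a : ℕ} :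
    (TruncPoly N ⧸ Ideal.span {t N ^ (N - a)}) ≃ₗ[TruncPoly N]
      (Ideal.span {t N ^ a} : Ideal (TruncPoly N)) :=
  (Submodule.quotEquivOfEq _ _ (by
    ext x
    rw [← mul_t_pow_eq_zero, LinearMap.mem_ker, LinearMap.toSpanSingleton_apply, smul_eq_mul])).trans
  ((LinearMap.quotKerEquivRange (LinearMap.toSpanSingleton (TruncPoly N) (TruncPoly N) (t N ^ a))).trans
    (LinearEquiv.ofEq _ _ (LinearMap.range_toSpanSingleton _)))

/-- The map `p ↦ p t ^ a` from `ℂ[t]` onto the ideal has kernel `(X ^ (N - a))`. -/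
theorem finrank_span_t_pow (a : ℕ) :
    Module.finrank ℂ (Ideal.span {t N ^ a} : Ideal (TruncPoly N)) = N - a := by
  let f : ℂ[X] →ₗ[ℂ[X]] TruncPoly N :=
    LinearMap.toSpanSingleton ℂ[X] (TruncPoly N) (t N ^ a)
  have hf : ∀ p, f p = mk N p * t N ^ a := fun p => rfl
  have hker : LinearMap.ker f = Ideal.span {Polynomial.X ^ (N - a)} := by
    ext p
    rw [LinearMap.mem_ker, hf, mul_t_pow_eq_zero, mk_mem_span_t_pow (Nat.sub_le _ _),
      Ideal.mem_span_singleton]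
  have hrange : (LinearMap.range f).restrictScalars ℂ =
      (Ideal.span {t N ^ a} : Ideal (TruncPoly N)).restrictScalars ℂ := by
    ext x
    rw [Submodule.restrictScalars_mem, Submodule.restrictScalars_mem, Ideal.mem_span_singleton']
    constructor
    · rintro ⟨p, rfl⟩
      exact ⟨mk N p, (hf p).symm⟩
    · rintro ⟨y, rfl⟩
      obtain ⟨p, rfl⟩ := mk_surjective y
      exact ⟨p, hf p⟩
  have h1 := (f.quotKerEquivRange.restrictScalars ℂ).finrank_eq
  have h2 := ((Submodule.quotEquivOfEq _ _ hker).restrictScalars ℂ).finrank_eq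
  have h3 : Module.finrank ℂ (ℂ[X] ⧸ Ideal.span {(Polynomial.X : ℂ[X]) ^ (N - a)}) = N - a := by
    rw [finrank_quotient_span_eq_natDegree, Polynomial.natDegree_X_pow]
  have h4 := (LinearEquiv.ofEq _ _ hrange).finrank_eq
  exact h4.symm.trans (h1.symm.trans (h2.trans h3))

end Ideals

/-! ### Submodules adapted to a basis -/

section Box

variable {N m : ℕ} {W : Type u} [AddCommGroup W] [Module ℂ W]

/-- The submodule `⨁ t ^ c_j A_N e_j`. -/
noncomputable def box (e : Module.Basis (Fin m) (TruncPoly N) (Free N W)) (c : Fin m → ℕ) :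
    Submodule (TruncPoly N) (Free N W) :=
  (Submodule.pi Set.univ fun j => Ideal.span {t N ^ c j}).comap e.equivFun.toLinearMap

variable {e : Module.Basis (Fin m) (TruncPoly N) (Free N W)} {c : Fin m → ℕ}

theorem mem_box {x : Free N W} : x ∈ box e c ↔ ∀ j, e.repr x j ∈ Ideal.span {t N ^ c j} := by
  simp [box, Submodule.mem_pi]

noncomputable def boxEquiv : box e c ≃ₗ[TruncPoly N]
    (∀ j, (Ideal.span {t N ^ c j} : Ideal (TruncPoly N))) where
  toFun x := fun j => ⟨e.repr x j, mem_box.1 x.2 j⟩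
  invFun y := ⟨e.equivFun.symm fun j => y j, mem_box.2 fun j => by
    have := congrFun (e.equivFun.apply_symm_apply fun j => (y j : TruncPoly N)) j
    rw [Module.Basis.equivFun_apply] at this
    rw [this]
    exact (y j).2⟩
  map_add' x y := by
    ext j
    simp
  map_smul' a x := by
    ext j
    simp
  left_inv x := Subtype.ext (e.equivFun.symm_apply_apply x.1)
  right_inv y := funext fun j => Subtype.ext
    (congrFun (e.equivFun.apply_symm_apply fun j => (y j : TruncPoly N)) j)

theorem finrank_box : Module.finrank ℂ (box e c) = ∑ j, (N - c j) := by
  rw [((boxEquiv (e := e) (c := c)).restrictScalars ℂ).finrank_eq, Module.finrank_pi_fintype]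
  exact Finset.sum_congr rfl fun j _ => finrank_span_t_pow _

theorem map_box (i : ℕ) : (box e c).map (LinearMap.lsmul (TruncPoly N) (Free N W) (t N ^ i)) =
    box e fun j => c j + i := by
  ext x
  rw [Submodule.mem_map, mem_box]
  constructor
  · rintro ⟨y, hy, rfl⟩ j
    obtain ⟨a, ha⟩ := Ideal.mem_span_singleton'.1 (mem_box.1 hy j)
    rw [Ideal.mem_span_singleton']
    exact ⟨a, by simp [← ha]; ring⟩
  · intro h
    simp only [Ideal.mem_span_singleton'] at h
    choose a ha using h
    refine ⟨e.equivFun.symm fun j => a j * t N ^ c j, mem_box.2 fun j => ?_, ?_⟩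
    · rw [← Module.Basis.equivFun_apply, LinearEquiv.apply_symm_apply]
      exact Ideal.mem_span_singleton'.2 ⟨a j, rfl⟩
    · refine e.equivFun.injective (funext fun j => ?_)
      rw [LinearMap.lsmul_apply, map_smul, LinearEquiv.apply_symm_apply, Module.Basis.equivFun_apply,
        ← ha, Pi.smul_apply, smul_eq_mul]
      ring

/-- Multiplication by `t ^ (N - c_j)` embeds `A_N / (t ^ c_j)` in `A_N`. The model of type `c`
inside `W ⊗ A_N` therefore has the complementary exponents `N - c_j`. -/
noncomputable def boxQuotEquiv (hc : ∀ j, c j ≤ N) :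
    box e (fun j => N - c j) ≃ₗ[TruncPoly N] (∀ j, TruncPoly N ⧸ Ideal.span {t N ^ c j}) :=
  boxEquiv.trans (LinearEquiv.piCongrRight fun j =>
    ((Submodule.quotEquivOfEq _ _ (by rw [Nat.sub_sub_self (hc j)])).trans
      (quotEquivSpan (a := N - c j))).symm)

theorem shift_pow_apply (i : ℕ) (x : Free N W) : (shift N W ^ i) x = t N ^ i • x := by
  induction i with
  | zero => simp
  | succ i ih =>
    rw [pow_succ', Module.End.mul_apply, ih, pow_succ']
    exact (mul_smul (t N) (t N ^ i) x).symm

theorem shift_pow (i : ℕ) : shift N W ^ i =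
    (LinearMap.lsmul (TruncPoly N) (Free N W) (t N ^ i)).restrictScalars ℂ :=
  LinearMap.ext fun x => shift_pow_apply i x

theorem map_shift_pow_restrictScalars (U : Submodule (TruncPoly N) (Free N W)) (i : ℕ) :
    (U.restrictScalars ℂ).map (shift N W ^ i) =
      (U.map (LinearMap.lsmul (TruncPoly N) (Free N W) (t N ^ i))).restrictScalars ℂ := by
  rw [shift_pow]
  rfl

/-- This computes the ranks that characterize a type: a summand of length `c_j` loses one dimension
for each factor `t` until it is zero. -/
theorem finrank_map_box (hc : ∀ j, c j ≤ N) (i : ℕ) :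
    Module.finrank ℂ (((box e fun j => N - c j).restrictScalars ℂ).map (shift N W ^ i)) =
      ∑ j, (c j - i) := by
  rw [map_shift_pow_restrictScalars, map_box]
  refine finrank_box.trans (Finset.sum_congr rfl fun j _ => ?_)
  have := hc j
  omega

theorem mk_monomial_smul (n : ℕ) (r : ℂ) (x : Free N W) :
    mk N (Polynomial.monomial n r) • x = r • (shift N W ^ n) x := by
  rw [shift_pow_apply, ← Polynomial.C_mul_X_pow_eq_monomial, map_mul, mk_C, t_pow]
  exact (mul_smul _ _ _).trans (algebraMap_smul (TruncPoly N) r _)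

/-- `A_N`-submodules, as `ℂ`-subspaces. -/
theorem exists_restrictScalars_eq {U : Submodule ℂ (Free N W)} (h : U.map (shift N W) ≤ U) :
    ∃ U' : Submodule (TruncPoly N) (Free N W), U'.restrictScalars ℂ = U := by
  refine ⟨{ U with smul_mem' := fun a x hx => ?_ }, rfl⟩
  obtain ⟨p, rfl⟩ := mk_surjective a
  induction p using Polynomial.induction_on' with
  | add p q hp hq =>
    have : mk N (p + q) • x = mk N p • x + mk N q • x := by
      rw [map_add]
      exact add_smul _ _ _
    rw [this]
    exact U.add_mem hp hq
  | monomial n r =>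
    rw [mk_monomial_smul]
    refine U.smul_mem _ ?_
    induction n with
    | zero => exact hx
    | succ n ih =>
      rw [pow_succ', Module.End.mul_apply]
      exact h ⟨_, ih, rfl⟩

variable [FiniteDimensional ℂ W]

theorem exists_basis (hm : Module.finrank ℂ W = m) :
    Nonempty (Module.Basis (Fin m) (TruncPoly N) (Free N W)) :=
  ⟨Algebra.TensorProduct.basis (TruncPoly N) (Module.finBasisOfFinrankEq ℂ W hm)⟩

end Box

end TruncPoly

namespace TruncPoly

universe u v w

set_option linter.unusedSectionVars false

/-! ### Smith normal form over the truncated ring -/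

section Smith

variable {N m : ℕ} {W : Type u} [AddCommGroup W] [Module ℂ W]

theorem mk_smul_one (p : ℂ[X]) : p • (1 : TruncPoly N) = mk N p • (1 : TruncPoly N) :=
  Algebra.smul_def p (1 : TruncPoly N)

/-- Reduction `W ⊗ ℂ[t] → W ⊗ A_N`. -/
noncomputable def red (N : ℕ) (y : ℂ[X] ⊗[ℂ] W) : Free N W :=
  TensorProduct.AlgebraTensorModule.cancelBaseChange ℂ ℂ[X] (TruncPoly N) (TruncPoly N) W (1 ⊗ₜ y)

theorem red_add (y z : ℂ[X] ⊗[ℂ] W) : red N (y + z) = red N y + red N z := by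
  rw [red, TensorProduct.tmul_add, map_add]
  rfl

theorem red_smul (p : ℂ[X]) (y : ℂ[X] ⊗[ℂ] W) : red N (p • y) = mk N p • red N y := by
  rw [red, ← TensorProduct.smul_tmul]
  have : (p • (1 : TruncPoly N)) ⊗ₜ[ℂ[X]] y = mk N p • ((1 : TruncPoly N) ⊗ₜ[ℂ[X]] y) := by
    refine Eq.trans ?_ (TensorProduct.smul_tmul' (mk N p) (1 : TruncPoly N) y).symm
    refine congrArg (fun a : TruncPoly N => a ⊗ₜ[ℂ[X]] y) ?_
    exact mk_smul_one p
  rw [this, map_smul]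
  rfl

theorem red_surjective : Function.Surjective (red N (W := W)) := by
  intro x
  induction x using TensorProduct.induction_on with
  | zero => exact ⟨0, by rw [red, TensorProduct.tmul_zero, map_zero]⟩
  | add x y hx hy =>
    obtain ⟨a, rfl⟩ := hx
    obtain ⟨b, rfl⟩ := hy
    exact ⟨a + b, red_add a b⟩
  | tmul a w =>
    obtain ⟨p, rfl⟩ := mk_surjective a
    refine ⟨p ⊗ₜ w, ?_⟩
    rw [red, TensorProduct.AlgebraTensorModule.cancelBaseChange_tmul]
    exact congrArg (fun a : TruncPoly N => a ⊗ₜ[ℂ] w) ((mk_smul_one p).trans (mul_one _))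

noncomputable def redBasis (N : ℕ) (b : Module.Basis (Fin m) ℂ[X] (ℂ[X] ⊗[ℂ] W)) :
    Module.Basis (Fin m) (TruncPoly N) (Free N W) :=
  (b.baseChange (TruncPoly N)).map (TensorProduct.AlgebraTensorModule.cancelBaseChange ℂ ℂ[X]
    (TruncPoly N) (TruncPoly N) W)

theorem redBasis_repr (b : Module.Basis (Fin m) ℂ[X] (ℂ[X] ⊗[ℂ] W)) (y : ℂ[X] ⊗[ℂ] W) (j : Fin m) :
    (redBasis N b).repr (red N y) j = mk N (b.repr y j) := by
  rw [redBasis, Module.Basis.map_repr, LinearEquiv.trans_apply, red, LinearEquiv.symm_apply_apply,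
    Module.Basis.baseChange_repr_tmul, Algebra.smul_def, mul_one]
  rfl

/-- Every submodule of `W ⊗ A_N` is `⨁ t ^ c_j A_N e_j` for some basis. -/
theorem exists_eq_box [FiniteDimensional ℂ W] (hm : Module.finrank ℂ W = m)
    (U : Submodule (TruncPoly N) (Free N W)) :
    ∃ (e : Module.Basis (Fin m) (TruncPoly N) (Free N W)) (c : Fin m → ℕ), (∀ j, c j ≤ N) ∧
      U = box e c := by
  -- The preimage in the free `ℂ[t]`-module, where Smith normal form over a principal ideal domain
  -- is available.
  let Û : Submodule ℂ[X] (ℂ[X] ⊗[ℂ] W) :=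
    { carrier := {y | red N y ∈ U}
      add_mem' := fun {y z} hy hz => by
        show red N (y + z) ∈ U
        rw [red_add]
        exact U.add_mem hy hz
      zero_mem' := by
        show red N 0 ∈ U
        rw [red, TensorProduct.tmul_zero, map_zero]
        exact U.zero_mem
      smul_mem' := fun p y hy => by
        show red N (p • y) ∈ U
        rw [red_smul]
        exact U.smul_mem _ hy }
  obtain ⟨n, S⟩ := Submodule.smithNormalForm
    (Algebra.TensorProduct.basis ℂ[X] (Module.finBasisOfFinrankEq ℂ W hm)) Û
  -- The preimage contains `t ^ N` times everything. Hence it has full rank, and each elementary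
  -- divisor divides `X ^ N`, so it is a power of `X` up to a unit.
  have hX : ∀ y, (Polynomial.X ^ N : ℂ[X]) • y ∈ Û := fun y => by
    show red N _ ∈ U
    rw [red_smul, mk_eq_zero.2 dvd_rfl]
    have : (0 : TruncPoly N) • red N y = 0 := zero_smul (TruncPoly N) (red N y)
    rw [this]
    exact U.zero_mem
  have hsurj : ∀ j, ∃ i, S.f i = j := fun j => by
    by_contra h
    have := S.repr_eq_zero_of_notMem_range ⟨_, hX (S.bM j)⟩ (i := j) h
    simp at this
  choose g hg using hsurj
  have hmem : ∀ y, y ∈ Û ↔ ∀ j, S.a (g j) ∣ S.bM.repr y j := by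
    intro y
    constructor
    · intro hy j
      have := S.repr_apply_embedding_eq_repr_smul (m := ⟨y, hy⟩) (i := g j)
      rw [hg, map_smul] at this
      exact ⟨_, this⟩
    · intro h
      rw [← S.bM.sum_repr y]
      refine Submodule.sum_mem _ fun j _ => ?_
      obtain ⟨d, hd⟩ := h j
      have h1 := S.snf (g j)
      rw [hg] at h1
      rw [hd, mul_comm, mul_smul, ← h1]
      exact Û.smul_mem _ (S.bN (g j)).2
  have ha : ∀ j, ∃ c ≤ N, Associated (S.a (g j)) (Polynomial.X ^ c) := fun j => by
    refine (dvd_prime_pow Polynomial.prime_X N).1 ?_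
    have := (hmem _).1 (hX (S.bM j)) j
    simpa using this
  choose c hcN hc using ha
  refine ⟨redBasis N S.bM, c, hcN, ?_⟩
  ext x
  obtain ⟨y, rfl⟩ := red_surjective x
  rw [mem_box]
  simp only [redBasis_repr, mk_mem_span_t_pow (hcN _)]
  exact (hmem y).trans (forall_congr' fun j => (hc j).dvd_iff_dvd_left)

end Smith

/-! ### Ranks of powers of `t` and the orbit -/

section Orbit

theorem dims_eq {m : ℕ} (lam : Fin m → ℕ) (i : ℕ) : dims lam i = ∑ j, (lam j - i) := by
  rw [dims, Finset.sum_filter]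
  refine Finset.sum_congr rfl fun j _ => ?_
  split_ifs with h
  · rfl
  · omega

theorem dims_eq_add {m : ℕ} (lam : Fin m → ℕ) (i : ℕ) :
    dims lam i = dims lam (i + 1) + conj lam i := by
  rw [dims_eq, dims_eq, conj, Finset.card_filter, ← Finset.sum_add_distrib]
  refine Finset.sum_congr rfl fun j _ => ?_
  split_ifs with h <;> omega

theorem dims_eq_zero {m N : ℕ} {lam : Fin m → ℕ} (hlam : ∀ j, lam j ≤ N) {i : ℕ} (hi : N ≤ i) :
    dims lam i = 0 := by
  rw [dims_eq]
  exact Finset.sum_eq_zero fun j _ => Nat.sub_eq_zero_of_le ((hlam j).trans hi)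

theorem conj_le {m : ℕ} (lam : Fin m → ℕ) (i : ℕ) : conj lam i ≤ m :=
  (Finset.card_filter_le _ _).trans (by simp)

/-- First differences of `dims` are the numbers of parts exceeding `i`, and differences of these are
the multiplicities of the parts. Equal multiplicities give a bijection on each fibre, and these glue
to a permutation. -/
theorem exists_perm_of_dims_eq {m : ℕ} {lam mu : Fin m → ℕ} (h : ∀ i, dims mu i = dims lam i) :
    ∃ σ : Equiv.Perm (Fin m), ∀ j, mu (σ j) = lam j := by
  have h1 : ∀ i, conj mu i = conj lam i := fun i => by
    have h1 := dims_eq_add lam i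
    have h2 := dims_eq_add mu i
    rw [h, h] at h2
    omega
  have h2 : ∀ (ν : Fin m → ℕ) i, (Finset.univ.filter fun j => i ≤ ν j).card =
      (Finset.univ.filter fun j => i + 1 ≤ ν j).card + Fintype.card {j // ν j = i} := fun ν i => by
    rw [Fintype.card_subtype, Finset.card_filter, Finset.card_filter, Finset.card_filter,
      ← Finset.sum_add_distrib]
    refine Finset.sum_congr rfl fun j _ => ?_
    split_ifs <;> omega
  -- At `i = 0` all `m` indices are counted, so zero parts agree as well.
  have h3 : ∀ i, (Finset.univ.filter fun j => i ≤ mu j).card =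
      (Finset.univ.filter fun j => i ≤ lam j).card := fun i => by
    cases i with
    | zero => simp
    | succ i => exact h1 i
  have h4 : ∀ i, Nonempty ({j // lam j = i} ≃ {j // mu j = i}) := fun i => by
    refine ⟨Fintype.equivOfCardEq ?_⟩
    have := h2 mu i
    have := h2 lam i
    have := h3 i
    have := h3 (i + 1)
    omega
  choose E _ using fun i => (h4 i).elim fun E => (⟨E, trivial⟩ : ∃ _ : _ ≃ _, True)
  refine ⟨(Equiv.sigmaFiberEquiv lam).symm.trans
    ((Equiv.sigmaCongrRight E).trans (Equiv.sigmaFiberEquiv mu)), fun j => ?_⟩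
  exact (E (lam j) ⟨j, rfl⟩).2

variable {N m : ℕ} {W : Type u} [AddCommGroup W] [Module ℂ W]

theorem box_reindex (e : Module.Basis (Fin m) (TruncPoly N) (Free N W)) (σ : Equiv.Perm (Fin m))
    (c : Fin m → ℕ) : box (e.reindex σ.symm) (fun j => c (σ j)) = box e c := by
  ext x
  simp only [mem_box, Module.Basis.repr_reindex_apply, Equiv.symm_symm]
  exact σ.forall_congr_right (q := fun j => e.repr x j ∈ Ideal.span {t N ^ c j})

theorem map_box_equiv (e e' : Module.Basis (Fin m) (TruncPoly N) (Free N W)) (c : Fin m → ℕ) :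
    (box e c).map (e.equiv e' (Equiv.refl _)).toLinearMap = box e' c := by
  have h : ∀ y j, e'.repr (e.equiv e' (Equiv.refl _) y) j = e.repr y j := fun y j => by
    simp [Module.Basis.equiv]
  ext x
  constructor
  · rintro ⟨y, hy, rfl⟩
    exact mem_box.2 fun j => by
      rw [LinearEquiv.coe_coe, h]
      exact mem_box.1 hy j
  · intro hx
    obtain ⟨y, rfl⟩ := (e.equiv e' (Equiv.refl _)).surjective x
    exact ⟨y, mem_box.2 fun j => by rw [← h]; exact mem_box.1 hx j, rfl⟩

/-- `t ^ i U` is the image of an endomorphism of the module `U` itself, so its dimension depends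
only on the isomorphism class of `U`. -/
theorem finrank_map_shift_pow_congr {U U' : Submodule (TruncPoly N) (Free N W)}
    (f : U ≃ₗ[TruncPoly N] U') (i : ℕ) :
    Module.finrank ℂ ((U.restrictScalars ℂ).map (shift N W ^ i)) =
      Module.finrank ℂ ((U'.restrictScalars ℂ).map (shift N W ^ i)) := by
  have key : ∀ U : Submodule (TruncPoly N) (Free N W), Nonempty
      (((U.map (LinearMap.lsmul (TruncPoly N) (Free N W) (t N ^ i)))) ≃ₗ[TruncPoly N]
      LinearMap.range (LinearMap.lsmul (TruncPoly N) U (t N ^ i))) := fun U => by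
    have : (LinearMap.range (LinearMap.lsmul (TruncPoly N) U (t N ^ i))).map U.subtype =
        U.map (LinearMap.lsmul (TruncPoly N) (Free N W) (t N ^ i)) := by
      ext x
      constructor
      · rintro ⟨_, ⟨y, rfl⟩, rfl⟩
        exact ⟨y, y.2, rfl⟩
      · rintro ⟨y, hy, rfl⟩
        exact ⟨_, ⟨⟨y, hy⟩, rfl⟩, rfl⟩
    exact ⟨(LinearEquiv.ofEq _ _ this.symm).trans
      (Submodule.equivMapOfInjective _ U.injective_subtype _).symm⟩
  obtain ⟨k⟩ := key U
  obtain ⟨k'⟩ := key U'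
  have hmap : (LinearMap.range (LinearMap.lsmul (TruncPoly N) U (t N ^ i))).map f.toLinearMap =
      LinearMap.range (LinearMap.lsmul (TruncPoly N) U' (t N ^ i)) := by
    ext x
    constructor
    · rintro ⟨_, ⟨y, rfl⟩, rfl⟩
      exact ⟨f y, (map_smul f (t N ^ i) y).symm⟩
    · rintro ⟨y, rfl⟩
      refine ⟨_, ⟨f.symm y, rfl⟩, ?_⟩
      exact (map_smul f (t N ^ i) (f.symm y)).trans (by rw [f.apply_symm_apply]; rfl)
  have E := k.trans (((f.submoduleMap _).trans (LinearEquiv.ofEq _ _ hmap)).trans k'.symm)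
  rw [map_shift_pow_restrictScalars, map_shift_pow_restrictScalars]
  exact (E.restrictScalars ℂ).finrank_eq

variable [FiniteDimensional ℂ W]

variable {lam : Fin m → ℕ} {k : ℕ}

theorem finrank_box_sub (hlam : ∀ j, lam j ≤ N)
    (e : Module.Basis (Fin m) (TruncPoly N) (Free N W)) :
    Module.finrank ℂ ((box e fun j => N - lam j).restrictScalars ℂ) = dims lam 0 := by
  have h := finrank_map_box (e := e) hlam 0
  rw [pow_zero, Module.End.one_eq_id, Submodule.map_id, ← dims_eq] at h
  exact h

/-- The orbit consists of the submodules on which all `t ^ i` have the right rank. -/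
theorem exists_box_of_rank (hm : Module.finrank ℂ W = m)
    {U : Submodule ℂ (Free N W)} (ht : U.map (shift N W) ≤ U)
    (hr : ∀ i < N, Module.finrank ℂ (U.map (shift N W ^ i)) = dims lam i)
    (hlam : ∀ j, lam j ≤ N) :
    ∃ e : Module.Basis (Fin m) (TruncPoly N) (Free N W),
      (box e fun j => N - lam j).restrictScalars ℂ = U := by
  obtain ⟨U', rfl⟩ := exists_restrictScalars_eq ht
  obtain ⟨e, c, hc, rfl⟩ := exists_eq_box hm U'
  have hc' : c = fun j => N - (N - c j) := funext fun j => (Nat.sub_sub_self (hc j)).symm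
  -- The ranks are given only for `i < N`; from `N` on both sides are zero because no part exceeds
  -- `N`.
  have h1 : ∀ i, dims (fun j => N - c j) i = dims lam i := fun i => by
    rcases lt_or_ge i N with hi | hi
    · rw [← hr i hi, dims_eq, hc', finrank_map_box (fun j => Nat.sub_le _ _)]
      exact Finset.sum_congr rfl fun j _ => by rw [← hc']
    · rw [dims_eq_zero hlam hi, dims_eq_zero (fun j => Nat.sub_le _ _) hi]
  obtain ⟨σ, hσ⟩ := exists_perm_of_dims_eq h1
  refine ⟨e.reindex σ.symm, ?_⟩
  rw [← box_reindex e σ c]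
  congr 2
  ext j
  rw [← hσ j, Nat.sub_sub_self (hc _)]

/-- An abstract isomorphism fixes the ranks of all `t ^ i`, and by Smith normal form these fix the
position of the submodule up to a choice of basis. -/
theorem mem_orbit_iff_exists_box (hm : Module.finrank ℂ W = m) (hlam : ∀ j, lam j ≤ N)
    {U : FunSpace.grass k (Free N W)} : U ∈ orbit N k W lam ↔
      ∃ e : Module.Basis (Fin m) (TruncPoly N) (Free N W),
        (box e fun j => N - lam j).restrictScalars ℂ = FunSpace.grass.space U := by
  constructor
  · rintro ⟨U', hU', ⟨f⟩⟩
    obtain ⟨e₀⟩ := exists_basis (N := N) hm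
    have hr := finrank_map_shift_pow_congr (f.trans (boxQuotEquiv (e := e₀) hlam).symm)
    rw [← hU']
    refine exists_box_of_rank hm ?_ (fun i _ => ?_) hlam
    · rintro _ ⟨x, hx, rfl⟩
      exact U'.smul_mem (t N) hx
    · rw [hr, finrank_map_box hlam, dims_eq]
  · rintro ⟨e, he⟩
    exact ⟨_, he, ⟨boxQuotEquiv hlam⟩⟩

theorem mem_orbit_iff_rank (hm : Module.finrank ℂ W = m) (hlam : ∀ j, lam j ≤ N)
    {U : FunSpace.grass k (Free N W)} : U ∈ orbit N k W lam ↔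
      (FunSpace.grass.space U).map (shift N W) ≤ FunSpace.grass.space U ∧
      ∀ i < N, Module.finrank ℂ ((FunSpace.grass.space U).map (shift N W ^ i)) = dims lam i := by
  rw [mem_orbit_iff_exists_box hm hlam]
  refine ⟨?_, fun h => exists_box_of_rank hm h.1 h.2 hlam⟩
  rintro ⟨e, he⟩
  rw [← he]
  refine ⟨?_, fun i _ => by rw [finrank_map_box hlam, dims_eq]⟩
  rintro _ ⟨x, hx, rfl⟩
  exact (box e fun j => N - lam j).smul_mem (t N) hx

/-- Automorphisms permute the `A_N`-bases transitively, and points of the orbit are the models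
attached to bases. -/
theorem exists_orbit_eq_autOrbit (hm : Module.finrank ℂ W = m) (hlam : ∀ j, lam j ≤ N) :
    ∃ U₀ : FunSpace.grass (dims lam 0) (Free N W),
      orbit N (dims lam 0) W lam = autOrbit N W U₀ := by
  obtain ⟨e₀⟩ := exists_basis (N := N) hm
  refine ⟨FunSpace.grass.mk _ (finrank_box_sub hlam e₀), Set.ext fun U => ?_⟩
  rw [mem_orbit_iff_exists_box hm hlam]
  constructor
  · rintro ⟨e, he⟩
    refine ⟨e₀.equiv e (Equiv.refl _), ?_⟩
    rw [← he, FunSpace.grass.space_mk, ← map_box_equiv e₀ e]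
    rfl
  · rintro ⟨g, hg⟩
    refine ⟨e₀.map g, ?_⟩
    rw [hg, FunSpace.grass.space_mk]
    have : box (e₀.map g) (fun j => N - lam j) = (box e₀ fun j => N - lam j).map g.toLinearMap := by
      rw [← map_box_equiv e₀ (e₀.map g)]
      congr 1
      exact e₀.ext fun i => by simp
    rw [this]
    rfl

theorem finrank_level (hm : Module.finrank ℂ W = m) (i : ℕ) :
    Module.finrank ℂ (level N W i) = m * (N - i) := by
  obtain ⟨e⟩ := exists_basis (N := N) hm
  have h := finrank_map_box (e := e) (c := fun _ => N) (fun _ => le_rfl) i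
  have htop : (box e fun _ => N - N).restrictScalars ℂ = ⊤ := by
    rw [eq_top_iff]
    intro x _
    rw [Submodule.restrictScalars_mem, mem_box]
    intro j
    rw [Nat.sub_self, pow_zero, Ideal.span_singleton_one]
    trivial
  rw [htop, Submodule.map_top] at h
  rw [Finset.sum_const, Finset.card_univ, Fintype.card_fin, smul_eq_mul] at h
  exact h

theorem shift_pow_eq_zero : shift N W ^ N = 0 := LinearMap.ext fun x => by
  rw [shift_pow_apply, t_pow_eq_zero le_rfl]
  exact zero_smul (TruncPoly N) x

theorem map_shift_level (i : ℕ) : (level N W i).map (shift N W) = level N W (i + 1) := by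
  rw [level, level, pow_succ', Module.End.mul_eq_comp, LinearMap.range_comp]

theorem level_succ_le (i : ℕ) : level N W (i + 1) ≤ level N W i := by
  rw [level, level, pow_succ, Module.End.mul_eq_comp]
  exact LinearMap.range_comp_le_range _ _

end Orbit

end TruncPoly

namespace FunSpace

universe u v w

set_option linter.unusedSectionVars false

/-! ### Splitting a quotient of subspaces -/

section Split

variable {V W : Type u} [AddCommGroup V] [Module ℂ V] [AddCommGroup W] [Module ℂ W]

theorem finrank_map_add_finrank_inf_ker [FiniteDimensional ℂ V] (S : Submodule ℂ V)
    (l : V →ₗ[ℂ] W) :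
    Module.finrank ℂ (S.map l) + Module.finrank ℂ ↥(S ⊓ LinearMap.ker l) = Module.finrank ℂ S := by
  have h := LinearMap.finrank_range_add_finrank_ker (l ∘ₗ S.subtype)
  rw [LinearMap.range_comp, Submodule.range_subtype, LinearMap.ker_comp] at h
  rw [← h, ← Submodule.map_comap_subtype,
    (Submodule.equivMapOfInjective _ S.injective_subtype _).finrank_eq]

/-- `s : W → E` and `l : E → W` split the quotient of `E` by `K`. -/
structure IsSplit (K E : Submodule ℂ V) (s : W →ₗ[ℂ] V) (l : V →ₗ[ℂ] W) : Prop where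
  le : K ≤ E
  mem : ∀ w, s w ∈ E
  apply_eq_zero : ∀ v ∈ K, l v = 0
  apply_section : ∀ w, l (s w) = w
  sub_mem : ∀ v ∈ E, v - s (l v) ∈ K

namespace IsSplit

variable {K E S : Submodule ℂ V} {s : W →ₗ[ℂ] V} {l : V →ₗ[ℂ] W} (h : IsSplit K E s l)

include h

theorem map_eq_top : E.map l = ⊤ :=
  eq_top_iff.2 fun w _ => ⟨s w, h.mem w, h.apply_section w⟩

theorem inf_ker_eq (h1 : K ≤ S) (h2 : S ≤ E) : S ⊓ LinearMap.ker l = K := by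
  refine le_antisymm ?_ (le_inf h1 h.apply_eq_zero)
  rintro v ⟨hv, hl⟩
  have := h.sub_mem v (h2 hv)
  rwa [LinearMap.mem_ker.1 hl, map_zero, sub_zero] at this

/-- Together with `map_sup_map` this makes `S ↦ l S` and `R ↦ K + s R` inverse bijections between
the subspaces from `K` to `E` and the subspaces of `W`. -/
theorem sup_map_map (h1 : K ≤ S) (h2 : S ≤ E) : K ⊔ (S.map l).map s = S := by
  refine le_antisymm (sup_le h1 ?_) fun v hv => ?_
  · rintro _ ⟨_, ⟨v, hv, rfl⟩, rfl⟩
    have := S.sub_mem hv (h1 (h.sub_mem v (h2 hv)))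
    rwa [sub_sub_cancel] at this
  · rw [← sub_add_cancel v (s (l v))]
    exact Submodule.add_mem_sup (h.sub_mem v (h2 hv)) ⟨_, ⟨v, hv, rfl⟩, rfl⟩

theorem map_sup_map (R : Submodule ℂ W) : (K ⊔ R.map s).map l = R := by
  have h1 : K.map l = ⊥ := (Submodule.map_le_iff_le_comap.2 h.apply_eq_zero).antisymm bot_le
  have h2 : l ∘ₗ s = LinearMap.id := LinearMap.ext h.apply_section
  rw [Submodule.map_sup, h1, bot_sup_eq, ← Submodule.map_comp, h2, Submodule.map_id]

theorem sup_map_le (R : Submodule ℂ W) : K ⊔ R.map s ≤ E :=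
  sup_le h.le (by
    rintro _ ⟨w, -, rfl⟩
    exact h.mem w)

theorem finrank_map [FiniteDimensional ℂ V] (h1 : K ≤ S) (h2 : S ≤ E) :
    Module.finrank ℂ (S.map l) + Module.finrank ℂ K = Module.finrank ℂ S := by
  rw [← finrank_map_add_finrank_inf_ker S l, h.inf_ker_eq h1 h2]

theorem finrank_sup_map [FiniteDimensional ℂ V] (R : Submodule ℂ W) :
    Module.finrank ℂ ↥(K ⊔ R.map s) = Module.finrank ℂ R + Module.finrank ℂ K := by
  rw [← h.finrank_map le_sup_left (h.sup_map_le R), h.map_sup_map]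

end IsSplit

end Split

/-! ### Grassmann bundles -/

section Bundle

variable {V W : Type u} [AddCommGroup V] [Module ℂ V] [FiniteDimensional ℂ V]
  [AddCommGroup W] [Module ℂ W] [FiniteDimensional ℂ W] {X Y : FunSpace.{u}}

/-- Near `x₀`, the quotient `E / K` is split by regular maps. -/
def SplitsAt (X : FunSpace.{u}) (W : Type u) [AddCommGroup W] [Module ℂ W]
    (K E : X → Submodule ℂ V) (x₀ : X) : Prop :=
  ∃ (s : X → W →ₗ[ℂ] V) (l : X → V →ₗ[ℂ] W),
    ∀ᶠ x in 𝓝 x₀, RegAt X s x ∧ RegAt X l x ∧ IsSplit (K x) (E x) (s x) (l x)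

/-- A frame of `K x` and the section give an injection `M x` from `ℂ ^ k ⊕ W` onto `E x`. A left
inverse `B` at `x₀`, corrected by the inverse of `B ∘ M x`, is a left inverse nearby, and its second
component is the required retraction. -/
theorem splitsAt_of_section {k : ℕ} {K E : X → Submodule ℂ V} {x₀ : X} (hK : RegFamAt X k K x₀)
    {s : X → W →ₗ[ℂ] V} (hs : RegAt X s x₀) (hinj : Function.Injective (s x₀))
    (hdisj : Disjoint (K x₀) (LinearMap.range (s x₀)))
    (hle : ∀ᶠ x in 𝓝 x₀, K x ≤ E x ∧ LinearMap.range (s x) ≤ E x ∧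
      Module.finrank ℂ (E x) = k + Module.finrank ℂ W) :
    SplitsAt X W K E x₀ := by
  obtain ⟨u, hu, hui, huK⟩ := hK
  let M : X → ((Fin k → ℂ) × W) →ₗ[ℂ] V := fun x => (tupleMap _ V (u x)).coprod (s x)
  have hM : ∀ {x}, RegAt X u x → RegAt X s x → RegAt X M x := fun hu hs =>
    ((hu.linear (tupleMap (Fin k) V)).lcomp (regAt_const (LinearMap.fst ℂ (Fin k → ℂ) W) _)).add
      (hs.lcomp (regAt_const (LinearMap.snd ℂ (Fin k → ℂ) W) _))
  have hMi : Function.Injective (M x₀) := by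
    rw [← LinearMap.ker_eq_bot, LinearMap.ker_coprod_of_disjoint_range,
      LinearMap.ker_eq_bot.2 ((linearIndependent_iff_tupleMap _).1 hui),
      LinearMap.ker_eq_bot.2 hinj, Submodule.prod_bot]
    rw [range_tupleMap, huK.self_of_nhds]
    exact hdisj
  obtain ⟨B, hB⟩ := (M x₀).exists_leftInverse_of_injective (LinearMap.ker_eq_bot.2 hMi)
  have hC : ∀ {x}, RegAt X u x → RegAt X s x → RegAt X (fun x => B ∘ₗ M x) x := fun hu hs =>
    (regAt_const B _).lcomp (hM hu hs)
  refine ⟨s, fun x => LinearMap.snd ℂ (Fin k → ℂ) W ∘ₗ (Ring.inverse (B ∘ₗ M x) ∘ₗ B), ?_⟩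
  filter_upwards [eventually_regAt hu, eventually_regAt hs, huK, hle,
    eventually_ne (hC hu hs).det (by simp [hB])] with x h1 h2 h3 h4 h5
  have hPM : ∀ z, Ring.inverse (B ∘ₗ M x) (B (M x z)) = z := fun z => inverse_apply_apply h5 z
  have hMx : Function.Injective (M x) := Function.LeftInverse.injective
    (g := fun v => Ring.inverse (B ∘ₗ M x) (B v)) hPM
  have hr : LinearMap.range (M x) = E x := by
    apply Submodule.eq_of_le_of_finrank_eq
    · rw [LinearMap.range_coprod, range_tupleMap, h3]
      exact sup_le h4.1 h4.2.1
    · rw [LinearMap.finrank_range_of_inj hMx, Module.finrank_prod, Module.finrank_fin_fun, h4.2.2]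
  refine ⟨h2, (regAt_const _ x).lcomp (((hC h1 h2).ringInverse h5).lcomp (regAt_const B x)), h4.1,
    fun w => h4.2.1 ⟨w, rfl⟩, fun v hv => ?_, fun w => ?_, fun v hv => ?_⟩
  · rw [← h3, ← range_tupleMap] at hv
    obtain ⟨c, rfl⟩ := hv
    have := hPM (c, 0)
    simp only [M, LinearMap.coprod_apply, map_zero, add_zero] at this
    simp only [LinearMap.comp_apply, M]
    rw [this]
    rfl
  · have := hPM (0, w)
    simp only [M, LinearMap.coprod_apply, map_zero, zero_add] at this
    simp only [LinearMap.comp_apply, M]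
    rw [this]
    rfl
  · rw [← hr] at hv
    obtain ⟨⟨c, w⟩, rfl⟩ := hv
    simp only [LinearMap.comp_apply]
    rw [hPM, ← h3, ← range_tupleMap]
    exact ⟨c, by simp [M]⟩

/-- The Grassmann bundle of a quotient of vector bundles, characterized by its universal property. -/
theorem isGrassmannBundle_of_splitsAt {p : Y → X} {k d : ℕ} {K E : X → Submodule ℂ V}
    {S : Y → Submodule ℂ V} (hp : IsMorphism Y X p) (hK : ∀ x, RegFamAt X k K x)
    (hKE : ∀ x, K x ≤ E x) (hE : ∀ x, SplitsAt X W K E x)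
    (hS : ∀ y, RegFamAt Y (k + d) S y) (hKS : ∀ y, K (p y) ≤ S y ∧ S y ≤ E (p y))
    (hinj : ∀ y y', p y = p y' → S y = S y' → y = y')
    (hex : ∀ x S', K x ≤ S' → S' ≤ E x → Module.finrank ℂ S' = k + d → ∃ y, p y = x ∧ S y = S')
    (hmor : ∀ (Z : FunSpace.{u}) (g : Z → Y) (z : Z), MorphAt Z X (fun z => p (g z)) z →
      RegFamAt Z (k + d) (fun z => S (g z)) z → MorphAt Z Y g z) :
    IsGrassmannBundle Y X p W d K E S := by
  refine ⟨hp, hKE, hKS, fun x₀ => ?_⟩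
  obtain ⟨s, l, hsl⟩ := hE x₀
  obtain ⟨T, hT, hTo, hxT⟩ := eventually_nhds_iff.1 hsl
  have hfK : ∀ x, Module.finrank ℂ (K x) = k := fun x => (hK x).eventually_finrank.self_of_nhds
  have hfS : ∀ y, Module.finrank ℂ (S y) = k + d := fun y => (hS y).eventually_finrank.self_of_nhds
  have hfl : ∀ y : ↥(p ⁻¹' T), Module.finrank ℂ ((S y).map (l (p y))) = d := fun y => by
    have := (hT _ y.2).2.2.finrank_map (hKS y).1 (hKS y).2
    rw [hfK, hfS] at this
    omega
  have hfs : ∀ (x : T) (R : grass d W),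
      Module.finrank ℂ ↥(K x ⊔ (grass.space R).map (s x)) = k + d := fun x R => by
    rw [(hT _ x.2).2.2.finrank_sup_map, hfK, finrank_space, add_comm]
  -- The inverse of the trivialization sends `(x, R)` to the point over `x` whose subspace is `K x +
  -- s x (R)`.
  choose lift hlp hlS using fun (x : T) (R : grass d W) => hex x _ le_sup_left
    ((hT _ x.2).2.2.sup_map_le (grass.space R)) (hfs x R)
  let ψ : ↥(p ⁻¹' T) → grass d W := fun y => grass.mk _ (hfl y)
  let χ : T × grass d W → ↥(p ⁻¹' T) := fun z => ⟨lift z.1 z.2, by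
    show p _ ∈ T
    rw [hlp]
    exact z.1.2⟩
  refine ⟨T, hTo, hxT, fun x => l x, ψ, ?_, fun x => ?_, fun y => rfl, ?_⟩
  · exact isMorphism_iff.2 fun x => (morphAt_vec.2 (hT _ (show T from x).2).2.1).comp
      (morphAt_val x)
  · exact ⟨(hT _ x.2).2.2.map_eq_top, (hT _ x.2).2.2.inf_ker_eq (hKE x) le_rfl⟩
  · refine IsIso.of_inverse (ψ := χ) (isMorphism_iff.2 fun y => ?_) (isMorphism_iff.2 fun z => ?_)
      (fun y => ?_) (fun z => ?_)
    · have hv := morphAt_val (X := Y) (S := p ⁻¹' T) y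
      have hpv : MorphAt (Y.sub (p ⁻¹' T)) X (fun y : ↥(p ⁻¹' T) => p y) y :=
        (hp.morphAt _).comp hv
      refine morphAt_prod.2 ⟨morphAt_sub.2 hpv, morphAt_grass.2 ?_⟩
      have hl : RegAt (Y.sub (p ⁻¹' T)) (fun y : ↥(p ⁻¹' T) => l (p y)) y :=
        RegAt.comp (Y := X) (X := Y.sub (p ⁻¹' T)) (g := fun y : ↥(p ⁻¹' T) => p y)
          (hT _ (show ↥(p ⁻¹' T) from y).2).2.1 hpv
      have hSv : RegFamAt (Y.sub (p ⁻¹' T)) (k + d) (fun y : ↥(p ⁻¹' T) => S y) y := (hS _).comp hv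
      exact hSv.map hl (Eventually.of_forall hfl)
    · have h1 : MorphAt ((X.sub T).prod (grass d W)) X (fun z : T × grass d W => (z.1 : X)) z :=
        (morphAt_val (X := X) (S := T) _).comp (isMorphism_fst.morphAt z)
      have h2 : MorphAt ((X.sub T).prod (grass d W)) (grass d W)
          (fun z : T × grass d W => z.2) z := isMorphism_snd.morphAt z
      refine morphAt_sub.2 (hmor _ _ z ?_ ?_)
      · have : (fun z : T × grass d W => p (χ z).1) = fun z => (z.1 : X) :=
          funext fun z => hlp z.1 z.2
        exact Eq.mpr (congrArg (fun f => MorphAt ((X.sub T).prod (grass d W)) X f z) this) h1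
      · have : (fun z : T × grass d W => S (χ z).1) = fun z =>
            K z.1 ⊔ (grass.space z.2).map (s z.1) := funext fun z => hlS z.1 z.2
        refine Eq.mpr (congrArg (fun f => RegFamAt ((X.sub T).prod (grass d W)) (k + d) f z) this) ?_
        refine RegFamAt.sup ((hK _).comp h1) (RegFamAt.map (d := d)
          (A := fun z : T × grass d W => s z.1) ((regFamAt_space _).comp h2)
          (((hT _ (show T × grass d W from z).1.2).1).comp h1) (Eventually.of_forall fun z => ?_))
          (Eventually.of_forall fun z => hfs _ _)
        have h3 := (hT _ (show T × grass d W from z).1.2).2.2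
        rw [← (Submodule.equivMapOfInjective _ (Function.LeftInverse.injective
          h3.apply_section) _).finrank_eq, finrank_space]
    · refine Subtype.ext (hinj _ _ (hlp _ _) ((hlS _ _).trans ?_))
      exact (hT _ (show ↥(p ⁻¹' T) from y).2).2.2.sup_map_map (hKS _).1 (hKS _).2
    · refine Prod.ext (Subtype.ext (hlp _ _)) (grass_ext ?_)
      show (S (lift _ _)).map (l (p (lift _ _))) = _
      rw [hlS, hlp]
      exact (hT _ (show T × grass d W from z).1.2).2.2.map_sup_map _

/-- The subspaces `{v ∈ L | A v ∈ K x}` form a vector bundle if `K x ⊆ A L`. -/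
theorem splitsAt_inf_comap {k : ℕ} {K : X → Submodule ℂ V} {L : Submodule ℂ V} {A : V →ₗ[ℂ] V}
    {x₀ : X} (hK : RegFamAt X k K x₀) (hL : ∀ x, K x ≤ L.map A)
    (hKE : ∀ x, K x ≤ L ⊓ (K x).comap A)
    (hdim : Module.finrank ℂ ↥(L ⊓ LinearMap.ker A) = Module.finrank ℂ W) :
    SplitsAt X W K (fun x => L ⊓ (K x).comap A) x₀ := by
  -- `A` maps `L ∩ A⁻¹ (K x)` onto `K x`, and its kernel there is `L ∩ ker A`, independent of `x`.
  have hfE : ∀ x, Module.finrank ℂ ↥(L ⊓ (K x).comap A) =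
      Module.finrank ℂ (K x) + Module.finrank ℂ W := fun x => by
    have h1 : (L ⊓ (K x).comap A).map A = K x := by
      refine le_antisymm (Submodule.map_le_iff_le_comap.2 inf_le_right) fun v hv => ?_
      obtain ⟨w, hw, rfl⟩ := hL x hv
      exact ⟨w, ⟨hw, hv⟩, rfl⟩
    have h2 : L ⊓ (K x).comap A ⊓ LinearMap.ker A = L ⊓ LinearMap.ker A := by
      refine le_antisymm (inf_le_inf_right _ inf_le_left) fun v hv => ⟨⟨hv.1, ?_⟩, hv.2⟩
      rw [SetLike.mem_coe, Submodule.mem_comap, LinearMap.mem_ker.1 hv.2]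
      exact zero_mem _
    rw [← finrank_map_add_finrank_inf_ker _ A, ← hdim, h1, h2]
  obtain ⟨u, hu, hui, huK⟩ := id hK
  -- a section of `A` over `A L`
  obtain ⟨σ, hσ⟩ : ∃ σ : V →ₗ[ℂ] V, ∀ v ∈ L.map A, σ v ∈ L ∧ A (σ v) = v := by
    let A' : L →ₗ[ℂ] L.map A := A.submoduleMap L
    obtain ⟨σ', hσ'⟩ := A'.exists_rightInverse_of_surjective
      (LinearMap.range_eq_top.2 (A.submoduleMap_surjective L))
    obtain ⟨σ, hσ⟩ := (L.subtype ∘ₗ σ').exists_extend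
    refine ⟨σ, fun v hv => ?_⟩
    have h1 : σ v = σ' ⟨v, hv⟩ := LinearMap.congr_fun hσ ⟨v, hv⟩
    rw [h1]
    exact ⟨(σ' ⟨v, hv⟩).2, congrArg Subtype.val (LinearMap.congr_fun hσ' ⟨v, hv⟩)⟩
  -- a complement of `K x₀`
  obtain ⟨s₀, hs₀i, hs₀E, hs₀K⟩ : ∃ s₀ : W →ₗ[ℂ] V, Function.Injective s₀ ∧
      LinearMap.range s₀ ≤ L ⊓ (K x₀).comap A ∧ Disjoint (K x₀) (LinearMap.range s₀) := by
    obtain ⟨Q, hQ⟩ := Submodule.exists_isCompl ((K x₀).comap (L ⊓ (K x₀).comap A).subtype)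
    have hd : Module.finrank ℂ Q = Module.finrank ℂ W := by
      have h1 := Submodule.finrank_add_eq_of_isCompl hQ
      have h2 : Module.finrank ℂ ((K x₀).comap (L ⊓ (K x₀).comap A).subtype) =
          Module.finrank ℂ (K x₀) := (Submodule.comapSubtypeEquivOfLe (hKE x₀)).finrank_eq
      rw [h2, hfE] at h1
      omega
    let e : W ≃ₗ[ℂ] Q := LinearEquiv.ofFinrankEq _ _ hd.symm
    refine ⟨(L ⊓ (K x₀).comap A).subtype ∘ₗ Q.subtype ∘ₗ e.toLinearMap, ?_, ?_, ?_⟩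
    · exact (Submodule.injective_subtype _).comp ((Submodule.injective_subtype _).comp e.injective)
    · rintro _ ⟨w, rfl⟩
      exact (Q.subtype (e w)).2
    · refine Submodule.disjoint_def.2 ?_
      rintro _ hv ⟨w, rfl⟩
      have : Q.subtype (e w) = 0 := Submodule.disjoint_def.1 hQ.disjoint _ hv (e w).2
      exact (congrArg (L ⊓ (K x₀).comap A).subtype this).trans (map_zero _)
  obtain ⟨B, hB⟩ := (tupleMap _ V (u x₀)).exists_leftInverse_of_injective
    (LinearMap.ker_eq_bot.2 ((linearIndependent_iff_tupleMap _).1 hui))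
  have hsplit : ∀ w, tupleMap _ V (u x₀) (B (A (s₀ w))) = A (s₀ w) := fun w => by
    have : A (s₀ w) ∈ K x₀ := (hs₀E ⟨w, rfl⟩).2
    rw [← huK.self_of_nhds, ← range_tupleMap] at this
    obtain ⟨c, hc⟩ := this
    rw [← hc]
    exact congrArg _ (LinearMap.congr_fun hB c)
  -- `A (s₀ w)` lies in `K x₀`. Keeping its coordinates while the frame moves gives a vector of `K
  -- x`, lifted to `L` by `σ`. Exchanging `σ (A (s₀ w))` for this lift inside `s₀ w` puts the
  -- section into `L ∩ A⁻¹ (K x)` and changes nothing at `x₀`.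
  let s : X → W →ₗ[ℂ] V := fun x =>
    σ ∘ₗ (tupleMap _ V (u x) ∘ₗ (B ∘ₗ A ∘ₗ s₀)) + (s₀ - σ ∘ₗ A ∘ₗ s₀)
  have hs : RegAt X s x₀ := ((regAt_const σ _).lcomp ((hu.linear (tupleMap _ V)).lcomp
    (regAt_const _ _))).add (regAt_const _ _)
  have hsx : s x₀ = s₀ := by
    ext w
    have := hsplit w
    simp only [s, LinearMap.add_apply, LinearMap.sub_apply, LinearMap.comp_apply, this]
    abel
  refine splitsAt_of_section hK hs (by rwa [hsx]) (by rwa [hsx]) ?_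
  filter_upwards [huK, hK.eventually_finrank] with x h1 h2
  refine ⟨hKE x, ?_, by rw [hfE, h2]⟩
  rintro _ ⟨w, rfl⟩
  have hm : tupleMap _ V (u x) (B (A (s₀ w))) ∈ K x := by
    rw [← h1, ← range_tupleMap]
    exact ⟨_, rfl⟩
  have h3 := hσ _ (hL x hm)
  have h4 : A (s₀ w) ∈ L.map A := ⟨_, (hs₀E ⟨w, rfl⟩).1, rfl⟩
  have h5 := hσ _ h4
  refine ⟨L.add_mem h3.1 (L.sub_mem (hs₀E ⟨w, rfl⟩).1 h5.1), ?_⟩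
  show A (σ _ + (s₀ w - σ (A (s₀ w)))) ∈ K x
  rw [map_add, map_sub, h5.2, sub_self, add_zero]
  exact h3.2.symm ▸ hm

/-- The topology of the product is finer than the product topology in general, but each slice `x ↦
(x, y)` is continuous, and that suffices. -/
theorem isOpenMap_fst : IsOpenMap (X := X.prod Y) (Y := X) (Prod.fst : X × Y → X) := by
  intro O hO
  refine isOpen_iff_mem_nhds.2 ?_
  rintro _ ⟨⟨x, y⟩, hz, rfl⟩
  have hm : MorphAt X (X.prod Y) (fun x => (x, y)) x :=
    morphAt_prod.2 ⟨morphAt_id x, morphAt_const y x⟩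
  filter_upwards [hm.1 (hO.mem_nhds hz)] with x' hx'
  exact ⟨_, hx', rfl⟩

namespace IsGrassmannBundle

variable {p : Y → X} {d : ℕ} {K E : X → Submodule ℂ V} {S : Y → Submodule ℂ V}

theorem locallyAffine (h : IsGrassmannBundle Y X p W d K E S) {n r : ℕ} (hX : LocallyAffine X n)
    (hr : d + r = Module.finrank ℂ W) : LocallyAffine Y (n + d * r) := by
  refine LocallyAffine.of_open_cover fun y => ?_
  obtain ⟨T, hT, hxT, -, ψ, -, -, -, hiso⟩ := h.2.2.2 (p y)
  exact ⟨p ⁻¹' T, hT.preimage h.1.1, hxT,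
    ((hX.sub_open hT).prod (grass_locallyAffine d W hr)).of_isIso hiso⟩

/-- Openness is local on the base, where the map is a projection from a product. -/
theorem isOpenMap (h : IsGrassmannBundle Y X p W d K E S) : IsOpenMap p := by
  intro O hO
  refine isOpen_iff_mem_nhds.2 ?_
  rintro _ ⟨y, hy, rfl⟩
  obtain ⟨T, hT, hxT, -, ψ, -, -, -, hφ, χ, hχ, h1, h2⟩ := h.2.2.2 (p y)
  have hop : IsOpen (X := (X.sub T).prod (grass d W))
      {z | (show ↥(p ⁻¹' T) from χ z).1 ∈ O} :=
    (hO.preimage (isMorphism_val (X := Y) (S := p ⁻¹' T)).1).preimage hχ.1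
  obtain ⟨Q, hQ, hQe⟩ := sub_isOpen.1 (isOpenMap_fst _ hop)
  have hxQ : ∀ x (hx : x ∈ T), x ∈ Q ↔ ∃ R, (show ↥(p ⁻¹' T) from χ (⟨x, hx⟩, R)).1 ∈ O := by
    intro x hx
    have : x ∈ Q ↔ (⟨x, hx⟩ : T) ∈ (Subtype.val ⁻¹' Q : Set T) := Iff.rfl
    rw [this, hQe]
    constructor
    · rintro ⟨⟨x', R⟩, hz, rfl⟩
      exact ⟨R, hz⟩
    · rintro ⟨R, hR⟩
      exact ⟨_, hR, rfl⟩
  have hyQ : p y ∈ Q := (hxQ _ hxT).2 ⟨ψ ⟨y, hxT⟩, by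
    have := congrFun h1 ⟨y, hxT⟩
    have h3 : (show ↥(p ⁻¹' T) from χ (⟨p y, hxT⟩, ψ ⟨y, hxT⟩)).1 = y :=
      congrArg (fun q : ↥(p ⁻¹' T) => q.1) this
    rwa [h3]⟩
  filter_upwards [hQ.mem_nhds hyQ, hT.mem_nhds hxT] with x hx hx'
  obtain ⟨R, hR⟩ := (hxQ x hx').1 hx
  refine ⟨_, hR, ?_⟩
  exact congrArg (fun q : T × grass d W => q.1.1) (congrFun h2 (⟨x, hx'⟩, R))

/-- An open map with irreducible fibres has irreducible preimages of irreducible sets; the fibres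
are images of the Grassmannian under the trivializations. -/
theorem irreducibleSpace (h : IsGrassmannBundle Y X p W d K E S) [IrreducibleSpace X]
    (hd : d ≤ Module.finrank ℂ W) : IrreducibleSpace Y := by
  have : IrreducibleSpace (grass d W) := grass_irreducibleSpace hd
  have hfib : ∀ x, ∃ f : grass d W → Y, IsMorphism (grass d W) Y f ∧ Set.range f = p ⁻¹' {x} := by
    intro x
    obtain ⟨T, hT, hxT, -, ψ, -, -, -, hφ, χ, hχ, h1, h2⟩ := h.2.2.2 x
    refine ⟨fun R => (show ↥(p ⁻¹' T) from χ (⟨x, hxT⟩, R)).1, isMorphism_iff.2 fun R => ?_, ?_⟩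
    · have hm : MorphAt (grass d W) ((X.sub T).prod (grass d W))
          (fun R => ((⟨x, hxT⟩ : T), R)) R :=
        morphAt_prod.2 ⟨morphAt_const (Y := X.sub T) _ R, morphAt_id R⟩
      exact (morphAt_val (X := Y) (S := p ⁻¹' T) _).comp ((hχ.morphAt _).comp hm)
    · ext y
      constructor
      · rintro ⟨R, rfl⟩
        exact congrArg (fun q : T × grass d W => q.1.1) (congrFun h2 (⟨x, hxT⟩, R))
      · rintro rfl
        exact ⟨ψ ⟨y, hxT⟩, congrArg (fun q : ↥(p ⁻¹' T) => q.1) (congrFun h1 ⟨y, hxT⟩)⟩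
  have hirr : ∀ x, IsPreirreducible (p ⁻¹' {x}) := fun x => by
    obtain ⟨f, hf, hr⟩ := hfib x
    rw [← hr, ← Set.image_univ]
    exact PreirreducibleSpace.isPreirreducible_univ.image _ hf.1.continuousOn
  have hne : Nonempty Y := by
    obtain ⟨x⟩ := (inferInstance : Nonempty X)
    obtain ⟨R⟩ := (inferInstance : Nonempty (grass d W))
    exact ⟨(hfib x).choose R⟩
  refine { toNonempty := hne, isPreirreducible_univ := ?_ }
  rw [← Set.preimage_univ (f := p)]
  exact PreirreducibleSpace.isPreirreducible_univ.preimage_of_isPreirreducible_fiber p h.isOpenMap hirr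

end IsGrassmannBundle

end Bundle

end FunSpace

namespace FunSpace

universe u v w

set_option linter.unusedSectionVars false

variable {V : Type u} [AddCommGroup V] [Module ℂ V] [FiniteDimensional ℂ V] {X : FunSpace.{v}}

theorem regFamAt_const {k : ℕ} {K : Submodule ℂ V} (hK : Module.finrank ℂ K = k) (x : X) :
    RegFamAt X k (fun _ => K) x :=
  morphAt_grass.1 (morphAt_const (grass.mk K hK) x)

theorem isClosed_le {k k' : ℕ} {K K' : X → Submodule ℂ V} (hK : ∀ x, RegFamAt X k K x)
    (hK' : ∀ x, RegFamAt X k' K' x) : IsClosed {x | K x ≤ K' x} := by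
  simpa only [Submodule.map_id] using isClosed_map_le LinearMap.id hK hK'

theorem locallyAffine_of_unique [Unique X] : LocallyAffine X 0 := fun x =>
  ⟨fun _ => 0, fun _ => x, Set.univ, Set.univ, isOpen_univ, trivial, isOpen_univ (X := aff 0),
    fun _ _ => ⟨trivial, Subsingleton.elim _ _, regAt_const _ _⟩,
    fun _ _ => ⟨trivial, Subsingleton.elim _ _, morphAt_const _ _⟩⟩

end FunSpace

namespace TruncPoly

open FunSpace

universe u v w

set_option linter.unusedSectionVars false

/-! ### The tower of chains -/

section Chains

variable {N : ℕ} {W : Type u} [AddCommGroup W] [Module ℂ W] [FiniteDimensional ℂ W] {k : ℕ → ℕ}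
  {i : ℕ}

theorem chains_ext {y y' : chains N W k i}
    (h : ∀ j, grass.space (member y j) = grass.space (member y' j)) : y = y' :=
  Subtype.ext (funext fun j => grass_ext (h j))

theorem morphAt_member (j : Idx N i) (y : chains N W k i) :
    MorphAt (chains N W k i) (grass (k j.1) (Free N W)) (fun y => member y j) y :=
  ((isMorphism_eval (X := fun j : Idx N i => grass (k j.1) (Free N W)) j).morphAt _).comp
    (morphAt_val (X := grassProd N W k i) (S := chainSet N W k i) y)

theorem morphAt_chains {Z : FunSpace.{v}} {g : Z → chains N W k i} {z : Z}
    (h : ∀ j, RegFamAt Z (k j.1) (fun z => grass.space (member (g z) j)) z) :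
    MorphAt Z (chains N W k i) g z :=
  morphAt_sub.2 (morphAt_pi.2 fun j => morphAt_grass.2 (h j))

theorem isClosed_chainSet : IsClosed (chainSet N W k i) := by
  have hreg : ∀ (j : Idx N i) (U : grassProd N W k i), RegFamAt (grassProd N W k i) (k j.1)
      (fun U : ∀ j : Idx N i, grass (k j.1) (Free N W) => grass.space (U j)) U := fun j U =>
    morphAt_grass.1
      ((isMorphism_eval (X := fun j : Idx N i => grass (k j.1) (Free N W)) j).morphAt U)
  have h1 : ∀ j : Idx N i, IsClosed (X := grassProd N W k i)
      {U : ∀ j : Idx N i, grass (k j.1) (Free N W) | grass.space (U j) ≤ level N W j.1} := fun j =>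
    isClosed_le (hreg j) (fun U => regFamAt_const (K := level N W j.1) rfl U)
  have h2 : ∀ j j' : Idx N i, IsClosed (X := grassProd N W k i)
      {U : ∀ j : Idx N i, grass (k j.1) (Free N W) | grass.space (U j') ≤ grass.space (U j)} :=
    fun j j' => isClosed_le (hreg j') (hreg j)
  have h3 : ∀ j j' : Idx N i, IsClosed (X := grassProd N W k i)
      {U : ∀ j : Idx N i, grass (k j.1) (Free N W) |
        (grass.space (U j)).map (shift N W) ≤ grass.space (U j')} :=
    fun j j' => isClosed_map_le (shift N W) (hreg j) (hreg j')
  have h4 : chainSet N W k i = (⋂ j : Idx N i, {U : ∀ j : Idx N i, grass (k j.1) (Free N W) |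
      grass.space (U j) ≤ level N W j.1}) ∩ ⋂ (j : Idx N i) (j' : Idx N i)
      (_ : (j'.1 : ℕ) = j.1 + 1), ({U : ∀ j : Idx N i, grass (k j.1) (Free N W) |
        grass.space (U j') ≤ grass.space (U j)} ∩ {U : ∀ j : Idx N i, grass (k j.1) (Free N W) |
        (grass.space (U j)).map (shift N W) ≤ grass.space (U j')}) := by
    ext U
    constructor
    · rintro ⟨a, b⟩
      exact ⟨Set.mem_iInter.2 a, Set.mem_iInter.2 fun j => Set.mem_iInter.2 fun j' =>
        Set.mem_iInter.2 fun h => b j j' h⟩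
    · rintro ⟨a, b⟩
      exact ⟨Set.mem_iInter.1 a, fun j j' h =>
        Set.mem_iInter.1 (Set.mem_iInter.1 (Set.mem_iInter.1 b j) j') h⟩
  rw [h4]
  exact (isClosed_iInter (X := grassProd N W k i) h1).inter
    (isClosed_iInter (X := grassProd N W k i) fun j =>
      isClosed_iInter (X := grassProd N W k i) fun j' =>
        isClosed_iInter (X := grassProd N W k i) fun _ => (h2 j j').inter (h3 j j'))

theorem isVariety_chains : IsVariety (chains N W k i) :=
  (IsVariety.pi fun _ => isVariety_grass _ _).sub_closed isClosed_chainSet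

theorem first_eq (h : i < N) (y : chains N W k i) :
    first y = grass.space (member y ⟨⟨i, h⟩, le_rfl⟩) := dif_pos h

theorem first_eq_bot (h : N ≤ i) (y : chains N W k i) : first y = ⊥ := dif_neg h.not_gt

theorem member_le_level (y : chains N W k i) (j : Idx N i) :
    grass.space (member y j) ≤ level N W j.1 := (show chainSet N W k i from y).2.1 j

theorem member_succ_le (y : chains N W k i) (j j' : Idx N i) (h : (j'.1 : ℕ) = j.1 + 1) :
    grass.space (member y j') ≤ grass.space (member y j) :=
  ((show chainSet N W k i from y).2.2 j j' h).1

theorem map_shift_member_le (y : chains N W k i) (j j' : Idx N i) (h : (j'.1 : ℕ) = j.1 + 1) :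
    (grass.space (member y j)).map (shift N W) ≤ grass.space (member y j') :=
  ((show chainSet N W k i from y).2.2 j j' h).2

theorem first_le_level (y : chains N W k i) : first y ≤ level N W i := by
  rcases lt_or_ge i N with h | h
  · rw [first_eq h]
    exact member_le_level y _
  · rw [first_eq_bot h]
    exact bot_le

theorem first_forget_le (y : chains N W k i) : first (forget y) ≤ first y := by
  rcases lt_or_ge (i + 1) N with h | h
  · rw [first_eq h, first_eq (Nat.lt_of_succ_lt h)]
    exact member_succ_le y ⟨⟨i, Nat.lt_of_succ_lt h⟩, le_rfl⟩ ⟨⟨i + 1, h⟩, Nat.le_succ i⟩ rfl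
  · rw [first_eq_bot h]
    exact bot_le

theorem map_shift_first_le_forget (y : chains N W k i) :
    (first y).map (shift N W) ≤ first (forget y) := by
  rcases lt_or_ge (i + 1) N with h | h
  · rw [first_eq h, first_eq (Nat.lt_of_succ_lt h)]
    exact map_shift_member_le y ⟨⟨i, Nat.lt_of_succ_lt h⟩, le_rfl⟩ ⟨⟨i + 1, h⟩, Nat.le_succ i⟩ rfl
  -- At the end of the chain the convention `U_N = 0` is consistent: `t` sends `W ⊗ t ^ i A_N` into
  -- `W ⊗ t ^ (i + 1) A_N`, which vanishes when `i + 1 ≥ N`.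
  · have h1 : (first y).map (shift N W) ≤ level N W (i + 1) := by
      rw [← map_shift_level]
      exact Submodule.map_mono (first_le_level y)
    refine h1.trans (le_trans ?_ bot_le)
    have h2 : shift N W ^ (i + 1) = 0 := by
      rw [← Nat.sub_add_cancel h, pow_add, shift_pow_eq_zero, mul_zero]
    rw [level, h2, LinearMap.range_zero]

theorem map_shift_first_le (y : chains N W k i) : (first y).map (shift N W) ≤ first y :=
  (map_shift_first_le_forget y).trans (first_forget_le y)

theorem morphAt_forget (y : chains N W k i) :
    MorphAt (chains N W k i) (chains N W k (i + 1)) forget y :=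
  morphAt_chains fun j => morphAt_grass.1
    (morphAt_member (⟨j.1, (Nat.le_succ i).trans j.2⟩ : Idx N i) y)

/-- The chain `(S, x)`. -/
theorem exists_forget_eq (hi : i < N) (x : chains N W k (i + 1)) {S : Submodule ℂ (Free N W)}
    (h1 : first x ≤ S) (h2 : S ≤ level N W i ⊓ (first x).comap (shift N W))
    (hS : Module.finrank ℂ S = k i) : ∃ y : chains N W k i, forget y = x ∧ first y = S := by
  let U : ∀ j : Idx N i, grass (k j.1) (Free N W) := fun j =>
    if h : (j.1 : ℕ) = i then grass.mk S (by rw [hS, h]) else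
      member x ⟨j.1, lt_of_le_of_ne j.2 (Ne.symm h)⟩
  have hU1 : ∀ j : Idx N i, (j.1 : ℕ) = i → grass.space (U j) = S := fun j hj => by
    simp only [U, dif_pos hj]
    rfl
  have hU2 : ∀ (j : Idx N i) (hj : i + 1 ≤ (j.1 : ℕ)), U j = member x ⟨j.1, hj⟩ := fun j hj => by
    have : ¬ (j.1 : ℕ) = i := by omega
    simp only [U, dif_neg this]
  have hmem : U ∈ chainSet N W k i := by
    refine ⟨fun j => ?_, fun j j' hjj => ?_⟩
    · rcases eq_or_lt_of_le j.2 with h | h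
      · rw [hU1 j h.symm, ← h]
        exact h2.trans inf_le_left
      · rw [hU2 j h]
        exact member_le_level x _
    · have hj' : i + 1 ≤ (j'.1 : ℕ) := by
        have := j.2
        omega
      rw [hU2 j' hj']
      rcases eq_or_lt_of_le j.2 with h | h
      · rw [hU1 j h.symm]
        have hfi : first x = grass.space (member x ⟨j'.1, hj'⟩) := by
          have hlt : i + 1 < N := by
            have := j'.1.2
            omega
          rw [first_eq hlt]
          have : (⟨⟨i + 1, hlt⟩, le_rfl⟩ : Idx N (i + 1)) = ⟨j'.1, hj'⟩ :=
            Subtype.ext (Fin.ext (by simp only; omega))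
          rw [this]
        rw [← hfi]
        exact ⟨h1, Submodule.map_le_iff_le_comap.2 (h2.trans inf_le_right)⟩
      · rw [hU2 j h]
        exact ⟨member_succ_le x _ _ hjj, map_shift_member_le x _ _ hjj⟩
  refine ⟨(⟨U, hmem⟩ : chainSet N W k i), chains_ext fun j => ?_, ?_⟩
  · exact congrArg grass.space (hU2 ⟨j.1, (Nat.le_succ i).trans j.2⟩ j.2)
  · exact (first_eq hi _).trans (hU1 _ rfl)

theorem eq_of_forget_eq (hi : i < N) {y y' : chains N W k i} (h1 : forget y = forget y')
    (h2 : first y = first y') : y = y' := by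
  refine chains_ext fun j => ?_
  rcases eq_or_lt_of_le j.2 with h | h
  · rw [first_eq hi, first_eq hi] at h2
    have : j = ⟨⟨i, hi⟩, le_rfl⟩ := Subtype.ext (Fin.ext h.symm)
    rw [this]
    exact h2
  · exact congrArg (fun x => grass.space (member x ⟨j.1, h⟩)) h1

theorem morphAt_of_forget (hi : i < N) {Z : FunSpace.{v}} {g : Z → chains N W k i} {z : Z}
    (h1 : MorphAt Z (chains N W k (i + 1)) (fun z => forget (g z)) z)
    (h2 : RegFamAt Z (k i) (fun z => first (g z)) z) : MorphAt Z (chains N W k i) g z := by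
  refine morphAt_chains fun j => ?_
  obtain ⟨⟨j, hjN⟩, hj⟩ := j
  rcases eq_or_lt_of_le hj with h | h
  · dsimp only at h
    subst h
    simpa only [first_eq hi] using h2
  · exact morphAt_grass.1
      ((morphAt_member (⟨⟨j, hjN⟩, h⟩ : Idx N (i + 1)) (forget (g z))).comp
        (φ := fun z => forget (g z)) h1)

theorem unique_chains : Nonempty (Unique (chains N W k N)) := by
  have hE : IsEmpty (Idx N N) := ⟨fun j => absurd j.1.2 (not_lt.2 j.2)⟩
  refine ⟨⟨⟨(⟨fun j => hE.elim j, fun j => hE.elim j, fun j => hE.elim j⟩ : chainSet N W k N)⟩,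
    fun y => chains_ext fun j => hE.elim j⟩⟩

variable {m : ℕ} {lam : Fin m → ℕ}

theorem regFamAt_first (hlam : ∀ j, lam j ≤ N) (y : chains N W (dims lam) i) :
    RegFamAt (chains N W (dims lam) i) (dims lam i) first y := by
  rcases lt_or_ge i N with h | h
  · simp only [funext (first_eq h)]
    exact morphAt_grass.1 (morphAt_member (⟨⟨i, h⟩, le_rfl⟩ : Idx N i) y)
  · simp only [funext (first_eq_bot h)]
    exact regFamAt_const (by rw [finrank_bot, dims_eq_zero hlam h]) y

theorem finrank_level_inf_ker (hi : i < N) :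
    Module.finrank ℂ ↥(level N W i ⊓ LinearMap.ker (shift N W)) = Module.finrank ℂ W := by
  have h := finrank_map_add_finrank_inf_ker (level N W i) (shift N W)
  rw [map_shift_level, finrank_level rfl, finrank_level rfl] at h
  have h2 : N - i = (N - (i + 1)) + 1 := by omega
  rw [h2, mul_add, mul_one] at h
  exact Nat.add_left_cancel h

/-- The conditions on `U_i` given `U_{i+1}` say exactly that it lies between `U_{i+1}` and `W ⊗ t ^
i A_N ∩ t⁻¹ U_{i+1}`. The quotient has rank `dim W` since `t` maps each level onto the next with
kernel of that dimension. -/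
theorem isGrassmannBundle_forget (hlam : ∀ j, lam j ≤ N) (hi : i < N) :
    IsGrassmannBundle (chains N W (dims lam) i) (chains N W (dims lam) (i + 1)) forget
      W (conj lam i) (fun x => first x)
      (fun x => level N W i ⊓ (first x).comap (shift N W)) (fun y => first y) := by
  have hK : ∀ x : chains N W (dims lam) (i + 1),
      first x ≤ level N W i ⊓ (first x).comap (shift N W) := fun x =>
    le_inf ((first_le_level x).trans (level_succ_le i))
      (Submodule.map_le_iff_le_comap.1 (map_shift_first_le x))
  refine isGrassmannBundle_of_splitsAt (k := dims lam (i + 1)) (isMorphism_iff.2 morphAt_forget)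
    (regFamAt_first hlam) hK (fun x => ?_) ?_ (fun y => ?_)
    (fun y y' => eq_of_forget_eq hi) (fun x S h1 h2 hS => ?_) ?_
  · refine splitsAt_inf_comap (regFamAt_first hlam x) (fun x => ?_) hK (finrank_level_inf_ker hi)
    rw [map_shift_level]
    exact first_le_level x
  · rw [← dims_eq_add]
    exact regFamAt_first hlam
  · exact ⟨first_forget_le y, le_inf (first_le_level y)
      (Submodule.map_le_iff_le_comap.1 (map_shift_first_le_forget y))⟩
  · rw [← dims_eq_add] at hS
    exact exists_forget_eq hi x h1 h2 hS
  · rw [← dims_eq_add]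
    exact fun Z g z => morphAt_of_forget hi

/-- The dimension of the variety of chains. -/
def chainDim {m : ℕ} (lam : Fin m → ℕ) (N i : ℕ) : ℕ :=
  ∑ j ∈ Finset.Ico i N, conj lam j * (m - conj lam j)

/-- Descending induction from the point at `i = N`; each bundle preserves completeness and
irreducibility and adds `dim Gr = λ'_i (m - λ'_i)` to the dimension of the charts. -/
theorem chains_tower (hm : Module.finrank ℂ W = m) (hlam : ∀ j, lam j ≤ N) (hi : i ≤ N) :
    IsComplete (chains N W (dims lam) i) ∧ IrreducibleSpace (chains N W (dims lam) i) ∧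
      LocallyAffine (chains N W (dims lam) i) (chainDim lam N i) := by
  induction hi using Nat.decreasingInduction with
  | self =>
    obtain ⟨h⟩ := unique_chains (N := N) (W := W) (k := dims lam)
    refine ⟨isComplete_of_unique, { toNonempty := ⟨default⟩, isPreirreducible_univ := ?_ }, ?_⟩
    · exact Set.subsingleton_univ.isPreirreducible
    · rw [chainDim, Finset.Ico_self, Finset.sum_empty]
      exact locallyAffine_of_unique
  | of_succ i hi ih =>
    obtain ⟨h1, h2, h3⟩ := ih
    have hb := isGrassmannBundle_forget (W := W) hlam hi
    have hc := conj_le lam i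
    refine ⟨hb.isComplete h1, hb.irreducibleSpace (hc.trans hm.ge), ?_⟩
    have h4 := hb.locallyAffine h3 (r := m - conj lam i) (by omega)
    rwa [chainDim, Finset.sum_eq_sum_Ico_succ_bot hi, add_comm]

end Chains

/-! ### The resolution and its dimension -/

section Resolution

variable {N m : ℕ} {W : Type u} [AddCommGroup W] [Module ℂ W] [FiniteDimensional ℂ W]
  {lam : Fin m → ℕ}

theorem map_shift_pow_le_member (hN : 0 < N) (y : chains N W (dims lam) 0) (j : ℕ) (hj : j < N) :
    (grass.space (proj hN y)).map (shift N W ^ j) ≤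
      grass.space (member y ⟨⟨j, hj⟩, Nat.zero_le j⟩) := by
  induction j with
  | zero =>
    rw [pow_zero, Module.End.one_eq_id, Submodule.map_id]
    exact le_rfl
  | succ j ih =>
    rw [pow_succ', Module.End.mul_eq_comp, Submodule.map_comp]
    exact (Submodule.map_mono (ih (by omega))).trans
      (map_shift_member_le y ⟨⟨j, by omega⟩, Nat.zero_le j⟩ ⟨⟨j + 1, hj⟩, Nat.zero_le _⟩ rfl)

theorem map_shift_proj_le (hN : 0 < N) (y : chains N W (dims lam) 0) :
    (grass.space (proj hN y)).map (shift N W) ≤ grass.space (proj hN y) := by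
  have h := map_shift_first_le y
  rwa [first_eq hN] at h

theorem finrank_map_shift_proj_le (hN : 0 < N) (y : chains N W (dims lam) 0) {j : ℕ} (hj : j < N) :
    Module.finrank ℂ ((grass.space (proj hN y)).map (shift N W ^ j)) ≤ dims lam j :=
  (Submodule.finrank_mono (map_shift_pow_le_member hN y j hj)).trans (finrank_space _).le

/-- `t ^ j U_0 ⊆ U_j` bounds the ranks from above, so only the lower bounds, which are open
conditions, have to be imposed. -/
theorem proj_mem_orbit_iff (hN : 0 < N) (hm : Module.finrank ℂ W = m) (hlam : ∀ j, lam j ≤ N)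
    (y : chains N W (dims lam) 0) : proj hN y ∈ orbit N (dims lam 0) W lam ↔ ∀ j : Fin N,
      dims lam j ≤ Module.finrank ℂ ((grass.space (proj hN y)).map (shift N W ^ (j : ℕ))) := by
  rw [mem_orbit_iff_rank hm hlam]
  exact ⟨fun h j => (h.2 j j.2).ge, fun h => ⟨map_shift_proj_le hN y, fun j hj =>
    (finrank_map_shift_proj_le hN y hj).antisymm (h ⟨j, hj⟩)⟩⟩

/-- The inclusion `t ^ j U_0 ⊆ U_j` becomes an equality by dimension: over the orbit a chain is
determined by its first member. -/
theorem member_eq_of_mem_orbit (hN : 0 < N) (hm : Module.finrank ℂ W = m)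
    (hlam : ∀ j, lam j ≤ N) {y : chains N W (dims lam) 0}
    (hy : proj hN y ∈ orbit N (dims lam 0) W lam) (j : Idx N 0) :
    grass.space (member y j) = (grass.space (proj hN y)).map (shift N W ^ (j.1 : ℕ)) :=
  (Submodule.eq_of_le_of_finrank_eq (map_shift_pow_le_member hN y j.1 j.1.2) (by
    rw [finrank_space, ((mem_orbit_iff_rank hm hlam).1 hy).2 _ j.1.2])).symm

/-- The chain `(t ^ j U)` for `U` in the orbit. -/
theorem exists_chain (hm : Module.finrank ℂ W = m) (hlam : ∀ j, lam j ≤ N)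
    {U : grass (dims lam 0) (Free N W)} (hU : U ∈ orbit N (dims lam 0) W lam) :
    ∃ y : chains N W (dims lam) 0, ∀ j : Idx N 0,
      grass.space (member y j) = (grass.space U).map (shift N W ^ (j.1 : ℕ)) := by
  obtain ⟨h1, h2⟩ := (mem_orbit_iff_rank hm hlam).1 hU
  refine ⟨(⟨fun j => grass.mk _ (h2 j.1 j.1.2), fun j => ?_, fun j j' h => ?_⟩ :
    chainSet N W (dims lam) 0), fun j => rfl⟩
  · rw [grass.space_mk, level, ← Submodule.map_top]
    exact Submodule.map_mono le_top
  · rw [grass.space_mk, grass.space_mk, h]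
    constructor
    · rw [pow_succ, Module.End.mul_eq_comp, Submodule.map_comp]
      exact Submodule.map_mono h1
    · rw [pow_succ', Module.End.mul_eq_comp, Submodule.map_comp]

theorem morphAt_proj (hN : 0 < N) (y : chains N W (dims lam) 0) :
    MorphAt (chains N W (dims lam) 0) (grass (dims lam 0) (Free N W)) (proj hN) y :=
  morphAt_member (⟨⟨0, hN⟩, le_rfl⟩ : Idx N 0) y

theorem isOpen_orbit_preimage (hN : 0 < N) (hm : Module.finrank ℂ W = m) (hlam : ∀ j, lam j ≤ N) :
    IsOpen {y : chains N W (dims lam) 0 | proj hN y ∈ orbit N (dims lam 0) W lam} := by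
  simp only [proj_mem_orbit_iff hN hm hlam, Set.ofPred_forall]
  exact isOpen_iInter_of_finite fun j => isOpen_le_finrank_map _
    (fun y => morphAt_grass.1 (morphAt_proj hN y)) _

theorem orbit_nonempty (hm : Module.finrank ℂ W = m) (hlam : ∀ j, lam j ≤ N) :
    (orbit N (dims lam 0) W lam).Nonempty := by
  obtain ⟨e⟩ := exists_basis (N := N) hm
  exact ⟨grass.mk _ (finrank_box_sub hlam e), (mem_orbit_iff_exists_box hm hlam).2 ⟨e, rfl⟩⟩

/-- A nonempty open subset of an irreducible space is dense; the chain `(t ^ j U)` shows that it is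
nonempty. -/
theorem dense_orbit_preimage (hN : 0 < N) (hm : Module.finrank ℂ W = m) (hlam : ∀ j, lam j ≤ N) :
    Dense {y : chains N W (dims lam) 0 | proj hN y ∈ orbit N (dims lam 0) W lam} := by
  have := (chains_tower hm hlam (Nat.zero_le N)).2.1
  refine (isOpen_orbit_preimage hN hm hlam).dense ?_
  obtain ⟨U, hU⟩ := orbit_nonempty (N := N) hm hlam
  obtain ⟨y, hy⟩ := exists_chain hm hlam hU
  refine ⟨y, ?_⟩
  have : proj hN y = U := grass_ext ((hy _).trans (by
    rw [pow_zero, Module.End.one_eq_id, Submodule.map_id]))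
  show proj hN y ∈ orbit N (dims lam 0) W lam
  rwa [this]

theorem proj_mem_closure (hN : 0 < N) (hm : Module.finrank ℂ W = m) (hlam : ∀ j, lam j ≤ N)
    (y : chains N W (dims lam) 0) : proj hN y ∈ closure (orbit N (dims lam 0) W lam) :=
  map_mem_closure (isMorphism_iff.2 (morphAt_proj hN)).1 (dense_orbit_preimage hN hm hlam y)
    fun _ h => h

/-- The orbit is open in its closure. -/
theorem mem_orbit_iff_of_mem_closure (hm : Module.finrank ℂ W = m) (hlam : ∀ j, lam j ≤ N)
    {U : grass (dims lam 0) (Free N W)} (hU : U ∈ closure (orbit N (dims lam 0) W lam)) :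
    U ∈ orbit N (dims lam 0) W lam ↔ ∀ j : Fin N,
      dims lam j ≤ Module.finrank ℂ ((grass.space U).map (shift N W ^ (j : ℕ))) := by
  rw [mem_orbit_iff_rank hm hlam]
  refine ⟨fun h j => (h.2 j j.2).ge, fun h => ⟨?_, fun j hj => le_antisymm ?_ (h ⟨j, hj⟩)⟩⟩
  -- Stability under `t` and the upper bounds on the ranks are closed conditions, so they persist on
  -- the closure. Only the lower bounds distinguish the orbit there.
  · exact closure_minimal (fun U hU => ((mem_orbit_iff_rank hm hlam).1 hU).1)
      (isClosed_map_le (shift N W) regFamAt_space regFamAt_space) hU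
  · have hc : IsClosed {U : grass (dims lam 0) (Free N W) |
        dims lam j + 1 ≤ Module.finrank ℂ ((grass.space U).map (shift N W ^ j))}ᶜ :=
      (isOpen_le_finrank_map _ regFamAt_space _).isClosed_compl
    have := closure_minimal (fun U hU => by
      rw [Set.mem_compl_iff, Set.mem_ofPred_eq, ((mem_orbit_iff_rank hm hlam).1 hU).2 j hj]
      omega) hc hU
    rw [Set.mem_compl_iff, Set.mem_ofPred_eq] at this
    omega

/-- Smoothness, irreducibility and completeness come from the tower. Birationality uses the orbit as
open set downstairs and its preimage upstairs. -/
theorem isResolution_proj (hN : 0 < N) (hm : Module.finrank ℂ W = m) (hlam : ∀ j, lam j ≤ N) :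
    IsResolution (chains N W (dims lam) 0)
      ((grass (dims lam 0) (Free N W)).sub (closure (orbit N (dims lam 0) W lam)))
      (fun y => (⟨proj hN y, proj_mem_closure hN hm hlam y⟩ :
        ↥(closure (orbit N (dims lam 0) W lam)))) := by
  obtain ⟨hcomp, hirr, hla⟩ := chains_tower (W := W) hm hlam (Nat.zero_le N)
  have hX : IsVariety ((grass (dims lam 0) (Free N W)).sub
      (closure (orbit N (dims lam 0) W lam))) :=
    (isVariety_grass _ _).sub_closed isClosed_closure
  let φ : chains N W (dims lam) 0 → (grass (dims lam 0) (Free N W)).sub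
      (closure (orbit N (dims lam 0) W lam)) := fun y =>
    (⟨proj hN y, proj_mem_closure hN hm hlam y⟩ : ↥(closure (orbit N (dims lam 0) W lam)))
  have hφ : IsMorphism (chains N W (dims lam) 0) ((grass (dims lam 0) (Free N W)).sub
      (closure (orbit N (dims lam 0) W lam))) φ :=
    isMorphism_iff.2 fun y => morphAt_sub.2 (morphAt_proj hN y)
  refine ⟨isVariety_chains, hX, hirr, hla.isSmooth, hcomp.isProperMorphism hX hφ, hφ,
    {y | proj hN y ∈ orbit N (dims lam 0) W lam},
    {U : ↥(closure (orbit N (dims lam 0) W lam)) | U.1 ∈ orbit N (dims lam 0) W lam},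
    isOpen_orbit_preimage hN hm hlam, dense_orbit_preimage hN hm hlam, ?_, ?_, fun y hy => hy, ?_⟩
  -- The orbit is the trace on its closure of the open set where all ranks are large enough.
  · refine sub_isOpen.2 ⟨{U | ∀ j : Fin N,
      dims lam j ≤ Module.finrank ℂ ((grass.space U).map (shift N W ^ (j : ℕ)))}, ?_, ?_⟩
    · rw [Set.ofPred_forall]
      exact isOpen_iInter_of_finite fun j => isOpen_le_finrank_map _ regFamAt_space _
    · ext U
      exact (mem_orbit_iff_of_mem_closure hm hlam U.2).symm
  · intro U
    rw [sub_isInducing.closure_eq_preimage_closure_image]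
    refine closure_mono ?_ (show ↥(closure (orbit N (dims lam 0) W lam)) from U).2
    exact fun U hU => ⟨(⟨U, subset_closure hU⟩ : ↥(closure (orbit N (dims lam 0) W lam))), hU, rfl⟩
  -- The inverse over the orbit is `U ↦ (t ^ j U)`. It is a morphism because `t ^ j` has constant
  -- rank there.
  · choose c hc using fun U : {U : ↥(closure (orbit N (dims lam 0) W lam)) |
      U.1 ∈ orbit N (dims lam 0) W lam} => exists_chain hm hlam U.2
    have hpc : ∀ U, proj hN (c U) = U.1.1 := fun U => grass_ext ((hc U _).trans (by
      rw [pow_zero, Module.End.one_eq_id, Submodule.map_id]))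
    have hmem : ∀ U, proj hN (c U) ∈ orbit N (dims lam 0) W lam := fun U => by
      rw [hpc]
      exact U.2
    have hfin : ∀ (U : {U : ↥(closure (orbit N (dims lam 0) W lam)) |
        U.1 ∈ orbit N (dims lam 0) W lam}) (j : Idx N 0), Module.finrank ℂ ((grass.space U.1.1).map
        (shift N W ^ (j.1 : ℕ))) = dims lam j.1 := fun U j => by rw [← hc, finrank_space]
    refine IsIso.of_inverse (ψ := fun U => (⟨c U, hmem U⟩ :
      {y : chains N W (dims lam) 0 | proj hN y ∈ orbit N (dims lam 0) W lam}))
      (isMorphism_iff.2 fun y => morphAt_sub.2 ((hφ.morphAt _).comp (morphAt_val y)))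
      (isMorphism_iff.2 fun U => morphAt_sub.2 (morphAt_chains fun j => ?_)) (fun y => ?_)
      (fun U => ?_)
    · have e := funext fun U => hc U j
      refine Eq.mpr (congrArg (fun f => RegFamAt _ _ f U) e) ?_
      refine RegFamAt.map (A := fun _ => shift N W ^ (j.1 : ℕ)) ((regFamAt_space _).comp
        ((morphAt_val _).comp (morphAt_val U))) (regAt_const _ _) (Eventually.of_forall fun U => hfin U j)
    · refine Subtype.ext (chains_ext fun j => ?_)
      refine (hc _ j).trans ?_
      exact (member_eq_of_mem_orbit hN hm hlam
        (show {y : chains N W (dims lam) 0 | proj hN y ∈ orbit N (dims lam 0) W lam} from y).2 j).symm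
    · exact Subtype.ext (Subtype.ext (hpc U))

/-- The differences `dims lam i - dims lam (i + 1)` telescope, and `dims lam N = 0`. -/
theorem sum_conj (hlam : ∀ j, lam j ≤ N) : ∑ i ∈ Finset.range N, conj lam i = ∑ j, lam j := by
  have h : ∀ n, ∑ i ∈ Finset.range n, conj lam i + dims lam n = dims lam 0 := fun n => by
    induction n with
    | zero => simp
    | succ n ih =>
      rw [Finset.sum_range_succ, add_assoc, add_comm (conj lam n), ← dims_eq_add, ih]
  have h1 := h N
  rw [dims_eq_zero hlam le_rfl, add_zero] at h1
  rw [h1, dims_eq]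
  simp

/-- Each bundle contributes `m λ'_i - (λ'_i) ^ 2`, and the first terms add up to `m k`. -/
theorem chainDim_eq (hlam : ∀ j, lam j ≤ N) : (chainDim lam N 0 : ℤ) =
    (m : ℤ) * (∑ j, lam j : ℕ) - ∑ i ∈ Finset.range N, (conj lam i : ℤ) ^ 2 := by
  rw [← sum_conj hlam, chainDim, Nat.Ico_zero_eq_range, Nat.cast_sum, Nat.cast_sum, Finset.mul_sum,
    ← Finset.sum_sub_distrib]
  refine Finset.sum_congr rfl fun i _ => ?_
  rw [Nat.cast_mul, Nat.cast_sub (conj_le lam i)]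
  ring

end Resolution

end TruncPoly

end

theorem proposition3 {N : ℕ} (hN : 0 < N) {m : ℕ} (W : Type*) [AddCommGroup W] [Module ℂ W]
    [FiniteDimensional ℂ W] (hm : Module.finrank ℂ W = m)
    (lam : Fin m → ℕ) (hanti : Antitone lam) (hlam : ∀ j, lam j ≤ N) :
    -- `O_λ` is an orbit of the group of `A_N`-linear automorphisms of `W ⊗ A_N`
    (∃ U₀ : FunSpace.grass (TruncPoly.dims lam 0) (TruncPoly.Free N W),
      TruncPoly.orbit N (TruncPoly.dims lam 0) W lam = TruncPoly.autOrbit N W U₀) ∧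
    -- the projection is a resolution of singularities of the closure of `O_λ`
    (∃ h : ∀ y : TruncPoly.chains N W (TruncPoly.dims lam) 0,
        TruncPoly.proj hN y ∈ closure (TruncPoly.orbit N (TruncPoly.dims lam 0) W lam),
      FunSpace.IsResolution (TruncPoly.chains N W (TruncPoly.dims lam) 0)
        ((FunSpace.grass (TruncPoly.dims lam 0) (TruncPoly.Free N W)).sub
          (closure (TruncPoly.orbit N (TruncPoly.dims lam 0) W lam)))
        (fun y => (⟨TruncPoly.proj hN y, h y⟩ :
          ↥(closure (TruncPoly.orbit N (TruncPoly.dims lam 0) W lam))))) ∧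
    -- the variety of chains is a tower of Grassmann bundles over a point
    (∀ i < N, FunSpace.IsGrassmannBundle (TruncPoly.chains N W (TruncPoly.dims lam) i)
      (TruncPoly.chains N W (TruncPoly.dims lam) (i + 1)) TruncPoly.forget
      W (TruncPoly.conj lam i)
      (fun x => TruncPoly.first x)
      (fun x => TruncPoly.level N W i ⊓ (TruncPoly.first x).comap (TruncPoly.shift N W))
      (fun y => TruncPoly.first y)) ∧
    Nonempty (Unique (TruncPoly.chains N W (TruncPoly.dims lam) N)) ∧
    -- its dimension is `m k - ∑ (λ'_i) ^ 2`
    ∃ d : ℕ, topologicalKrullDim (TruncPoly.chains N W (TruncPoly.dims lam) 0) = (d : WithBot ℕ∞) ∧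
      (d : ℤ) = (m : ℤ) * (∑ j, lam j : ℕ) -
        ∑ i ∈ Finset.range N, (TruncPoly.conj lam i : ℤ) ^ 2 := by
  exact ⟨TruncPoly.exists_orbit_eq_autOrbit hm hlam,
    ⟨TruncPoly.proj_mem_closure hN hm hlam, TruncPoly.isResolution_proj hN hm hlam⟩,
    fun i hi => TruncPoly.isGrassmannBundle_forget hlam hi, TruncPoly.unique_chains, by
      obtain ⟨-, hirr, hla⟩ := TruncPoly.chains_tower (N := N) hm hlam (Nat.zero_le N)
      exact ⟨TruncPoly.chainDim lam N 0, hla.topologicalKrullDim_eq, TruncPoly.chainDim_eq hlam⟩⟩
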